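/- **Setting.** On $H=\mathbb C^2$ consider the area Hermitian form $\langle z,w\rangle=\frac{\sqrt{-1}}4(z_1\overline{w_2}-z_2\overline{w_1})$, so that $\langle z,z\rangle$ is the signed area of the triangle with vertices $0,z_1,z_2$. Let $H^+=\{z\in H:\langle z,z\rangle>0\}$ be the set of positively oriented triangles, and let $\mathbb PH^+\subset\mathbb P(H)$ be its complex projectivization. The group $\mathrm{PSL}(2,\mathbb Z)$ acts on $\mathbb PH^+$ by matrices acting on column vectors $(z_1,z_2)^T$. A cone metric on the oriented sphere $S^2$ is the length metric obtained from a finite, coherently oriented Euclidean triangulation: finitely many triangles covering $S^2$, with homeomorphisms onto nondegenerate positively oriented Euclidean triangles in the plane, such that two distinct triangles meet in the empty set, a common vertex or a common edge, on which the two coordinates differ by an isometry of the plane. The cone angle at a point is the total angle of the triangles around this point; the point is singular if this angle is not $2\pi$. Let $C(\pi,\pi,\pi,\pi)$ be the set of cone metrics on $S^2$ with exactly four singular points, all of cone angle $\pi$, where two metrics are identified if one is carried to a positive multiple of the other by an orientation-preserving homeomorphism (that is, up to homothety and orientation-preserving isometry). For $z=(z_1,z_2)\in H^+$, gluing each edge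 of the triangle $0,z_1,z_2$ to itself by the rotation by $\pi$ about its midpoint gives a sphere with the quotient metric and the orientation of the triangle. **Theorem.** 1. $\mathrm{PSL}(2,\mathbb Z)$ is generated by the classes of the matrices $\begin{pmatrix}1&0\\1&1\end{pmatrix}$ and $\begin{pmatrix}1&-1\\0&1\end{pmatrix}$, that is, by the two cutting operations $(z_1,z_2)\mapsto(z_1,z_1+z_2)$ and $(z_1,z_2)\mapsto(z_1-z_2,z_2)$. 2. For every $z\in H^+$ the gluing described above can be realized by a cone metric on $S^2$ with four singular points of cone angle $\pi$. 3. There is a map $\mathbb PH^+/\mathrm{PSL}(2,\mathbb Z)\to C(\pi,\pi,\pi,\pi)$ which sends the class of every $z\in H^+$ to the class of any cone metric obtained from the triangle $0,z_1,z_2$ by this gluing, and this map is both injective and surjective. -/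

import Mathlib

open scoped LinearAlgebra.Projectivization MatrixGroups Topology

noncomputable section

/-! ### The area Hermitian form, `H⁺`, and its projectivization -/

/-- The area Hermitian form on `H = ℂ²`. -/
def areaForm (z w : Fin 2 → ℂ) : ℂ :=
  Complex.I / 4 * (z 0 * star (w 1) - z 1 * star (w 0))

/-- The square-norm is real; it is the signed area of the triangle with vertices `0, z 0, z 1`. -/
theorem areaForm_self (z : Fin 2 → ℂ) :
    areaForm z z = (((z 0).re * (z 1).im - (z 0).im * (z 1).re) / 2 : ℝ) := by
  apply Complex.ext <;> simp [areaForm, Complex.mul_re, Complex.mul_im] <;> ring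

/-- The positive part `H⁺`: positively oriented triangles `(0, z 0, z 1)`. -/
def Hplus : Set (Fin 2 → ℂ) := {z | 0 < (areaForm z z).re}

theorem ne_zero_of_mem_Hplus {z : Fin 2 → ℂ} (hz : z ∈ Hplus) : z ≠ 0 := by
  rintro rfl
  simp [Hplus, areaForm] at hz

/-- The complex projectivization `ℙH⁺`, inside the projective line of `ℂ²`. -/
def PHplus : Set (ℙ ℂ (Fin 2 → ℂ)) :=
  {p | ∃ (z : Fin 2 → ℂ) (hz : z ∈ Hplus),
    p = Projectivization.mk ℂ z (ne_zero_of_mem_Hplus hz)}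

/-- The point of `ℙH⁺` represented by an element of `H⁺`. -/
def toPHplus (z : Hplus) : PHplus :=
  ⟨Projectivization.mk ℂ z.1 (ne_zero_of_mem_Hplus z.2), z.1, z.2, rfl⟩

/-! ### The action of `PSL(2, ℤ)` on `ℙH⁺`, by matrices acting on column vectors -/

theorem smul_mem_Hplus (A : SL(2, ℤ)) {z : Fin 2 → ℂ} (hz : z ∈ Hplus) :
    (A.map (Int.castRingHom ℂ)) • z ∈ Hplus := by
  have hdet : ((A 0 0 : ℤ) : ℝ) * A 1 1 - A 0 1 * A 1 0 = 1 := by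
    have h := A.det_coe
    rw [Matrix.det_fin_two] at h
    exact_mod_cast h
  have h0 : ((A.map (Int.castRingHom ℂ)) • z) 0 = A 0 0 * z 0 + A 0 1 * z 1 := by
    change (((A.map (Int.castRingHom ℂ)).1).mulVec z) 0 = _
    simp [Matrix.mulVec, dotProduct, Fin.sum_univ_two]
  have h1 : ((A.map (Int.castRingHom ℂ)) • z) 1 = A 1 0 * z 0 + A 1 1 * z 1 := by
    change (((A.map (Int.castRingHom ℂ)).1).mulVec z) 1 = _
    simp [Matrix.mulVec, dotProduct, Fin.sum_univ_two]
  simp only [Hplus, Set.mem_ofPred_eq, areaForm_self, Complex.ofReal_re] at hz ⊢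
  rw [h0, h1]
  simp only [Complex.add_re, Complex.add_im, Complex.mul_re, Complex.mul_im, Complex.intCast_re,
    Complex.intCast_im, zero_mul, sub_zero, add_zero]
  have key : ((A 0 0 : ℝ) * (z 0).re + A 0 1 * (z 1).re) * (A 1 0 * (z 0).im + A 1 1 * (z 1).im)
      - (A 0 0 * (z 0).im + A 0 1 * (z 1).im) * (A 1 0 * (z 0).re + A 1 1 * (z 1).re)
      = ((A 0 0 : ℝ) * A 1 1 - A 0 1 * A 1 0)
        * ((z 0).re * (z 1).im - (z 0).im * (z 1).re) := by ring
  rw [key, hdet, one_mul]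
  exact hz

theorem smul_mem_PHplus (A : SL(2, ℤ)) {p : ℙ ℂ (Fin 2 → ℂ)} (hp : p ∈ PHplus) :
    (A.map (Int.castRingHom ℂ)) • p ∈ PHplus := by
  obtain ⟨z, hz, rfl⟩ := hp
  exact ⟨_, smul_mem_Hplus A hz, rfl⟩

instance slAction : MulAction SL(2, ℤ) PHplus where
  smul A p := ⟨(A.map (Int.castRingHom ℂ)) • p.1, smul_mem_PHplus A p.2⟩
  one_smul p := Subtype.ext (by
    change (Matrix.SpecialLinearGroup.map (Int.castRingHom ℂ) 1) • p.1 = p.1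
    rw [map_one, one_smul])
  mul_smul A B p := Subtype.ext (by
    change (Matrix.SpecialLinearGroup.map (Int.castRingHom ℂ) (A * B)) • p.1
      = (A.map (Int.castRingHom ℂ)) • ((B.map (Int.castRingHom ℂ)) • p.1)
    rw [map_mul, mul_smul])

theorem center_le_ker :
    Subgroup.center SL(2, ℤ) ≤ (MulAction.toPermHom SL(2, ℤ) PHplus).ker := by
  intro A hA
  obtain ⟨r, hr, hA⟩ := Matrix.SpecialLinearGroup.mem_center_iff.1 hA
  rw [MonoidHom.mem_ker]
  ext1 ⟨p, hp⟩
  obtain ⟨z, hz, rfl⟩ := hp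
  refine Subtype.ext ?_
  change (A.map (Int.castRingHom ℂ)) • Projectivization.mk ℂ z _ = Projectivization.mk ℂ z _
  rw [Projectivization.smul_mk, Projectivization.mk_eq_mk_iff']
  refine ⟨(r : ℂ), ?_⟩
  change _ = ((A.map (Int.castRingHom ℂ)).1).mulVec z
  have : (A.map (Int.castRingHom ℂ)).1 = Matrix.scalar (Fin 2) (r : ℂ) := by
    ext i j
    have := congrFun (congrFun hA i) j
    simp only [Matrix.SpecialLinearGroup.map_apply_coe, RingHom.mapMatrix_apply, Matrix.map_apply]
    rw [← this, Matrix.scalar_apply, Matrix.scalar_apply, Matrix.diagonal_apply,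
      Matrix.diagonal_apply]
    split_ifs <;> simp only [eq_intCast, Int.cast_zero]
  rw [this]
  ext i
  simp

/-- `PSL(2, ℤ) = SL(2, ℤ) / {±1}` acts on `ℙH⁺`. -/
instance pslAction : MulAction PSL(2, ℤ) PHplus :=
  MulAction.compHom PHplus
    (QuotientGroup.lift (Subgroup.center SL(2, ℤ)) (MulAction.toPermHom SL(2, ℤ) PHplus)
      center_le_ker)

/-- The first cutting operation, `(z₁, z₂) ↦ (z₁, z₁ + z₂)`. -/
def cutOne : SL(2, ℤ) := ⟨!![1, 0; 1, 1], by simp [Matrix.det_fin_two]⟩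

/-- The second cutting operation, `(z₁, z₂) ↦ (z₁ - z₂, z₂)`. -/
def cutTwo : SL(2, ℤ) := ⟨!![1, -1; 0, 1], by simp [Matrix.det_fin_two]⟩

/-! ### Metrics glued from planar pieces -/

section Gluing

variable {ι κ S S' : Type*}

/-- `IsChainLength Δ φ x y L`: there is a chain from `x` to `y` each step of which is the image
under some `φ i` of a straight segment in the planar piece `Δ i`, of total Euclidean length `L`. -/
inductive IsChainLength (Δ : ι → Set ℂ) (φ : ι → ℂ → S) : S → S → ℝ → Prop
  | refl (x : S) : IsChainLength Δ φ x x 0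
  | cons (i : ι) (a b : ℂ) (y : S) (L : ℝ) (ha : a ∈ Δ i) (hb : b ∈ Δ i)
      (h : IsChainLength Δ φ (φ i b) y L) : IsChainLength Δ φ (φ i a) y (‖a - b‖ + L)

/-- The length (quotient) metric on a space `S` obtained by gluing the convex planar pieces `Δ i`
via the maps `φ i : Δ i → S`: the infimum of the lengths of chains of straight segments. -/
def gluedDist (Δ : ι → Set ℂ) (φ : ι → ℂ → S) (x y : S) : ℝ :=
  sInf {L | IsChainLength Δ φ x y L}

/-- `f` preserves orientation with respect to the planar pieces: whenever it carries an interior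
point of a piece to an interior point of a piece, it is in these two coordinates locally of the
form `u ↦ w + a (u - z)`, i.e. a rotation and scaling without reflection. -/
def PreservesOrientation (Δ : ι → Set ℂ) (φ : ι → ℂ → S) (Δ' : κ → Set ℂ) (φ' : κ → ℂ → S')
    (f : S → S') : Prop :=
  ∀ (i : ι) (j : κ) (z w : ℂ), z ∈ interior (Δ i) → w ∈ interior (Δ' j) → f (φ i z) = φ' j w →
    ∃ a : ℂ, ∀ᶠ u in 𝓝 z, f (φ i u) = φ' j (w + a * (u - z))

end Gluing

/-! ### Cone metrics on the sphere -/

/-- The 2-sphere. -/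
abbrev Sphere2 : Type := Metric.sphere (0 : EuclideanSpace ℝ (Fin 3)) 1

/-- The closed triangle in the plane with the given vertices. -/
def triangle (v : Fin 3 → ℂ) : Set ℂ := convexHull ℝ (Set.range v)

/-- A finite, coherently oriented Euclidean triangulation of the sphere: triangles in the sphere
parametrized by nondegenerate, positively oriented triangles of the Euclidean plane.
Only the values of `param α` on `triangle (vert α)` matter. -/
structure FlatSphere where
  n : ℕ
  /-- The vertices of the Euclidean triangles. -/
  vert : Fin n → Fin 3 → ℂ
  pos : ∀ α, ![vert α 1 - vert α 0, vert α 2 - vert α 0] ∈ Hplus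
  /-- The inverse of the coordinate homeomorphism of the triangle with index `α`. -/
  param : Fin n → ℂ → Sphere2
  continuousOn : ∀ α, ContinuousOn (param α) (triangle (vert α))
  injOn : ∀ α, Set.InjOn (param α) (triangle (vert α))
  /-- The triangles cover the sphere. -/
  cover : ⋃ α, param α '' triangle (vert α) = Set.univ
  /-- Distinct triangles meet in the empty set, a common vertex, or a common edge. -/
  inter : ∀ α β, α ≠ β → ∃ I J : Finset (Fin 3), I.card ≤ 2 ∧ J.card ≤ 2 ∧
    param α '' triangle (vert α) ∩ param β '' triangle (vert β)
      = param α '' convexHull ℝ (vert α '' I) ∧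
    param α '' triangle (vert α) ∩ param β '' triangle (vert β)
      = param β '' convexHull ℝ (vert β '' J)
  /-- On overlaps the coordinates differ by an isometry of the Euclidean plane. -/
  compat : ∀ α β, ∃ g : ℂ ≃ᵢ ℂ, ∀ x ∈ triangle (vert α), ∀ y ∈ triangle (vert β),
    param α x = param β y → x = g y
  /-- Coherent orientation: distinct triangles never run through a common edge in the same
  direction. -/
  coherent : ∀ α β i j, param α (vert α i) = param β (vert β j) →
    param α (vert α (i + 1)) = param β (vert β (j + 1)) → α = β
  /-- Closedness: each edge of a triangle is also an edge of a neighbouring triangle, which runs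
  through it in the opposite direction. -/
  closed : ∀ α i, ∃ β j, param α (vert α i) = param β (vert β (j + 1)) ∧
    param α (vert α (i + 1)) = param β (vert β j)

namespace FlatSphere

/-- The Euclidean triangles of the triangulation. -/
def tri (T : FlatSphere) (α : Fin T.n) : Set ℂ := triangle (T.vert α)

/-- The cone metric obtained from the triangulation. -/
def dist (T : FlatSphere) (x y : Sphere2) : ℝ := gluedDist T.tri T.param x y

open Classical in
/-- The cone angle at a point: the sum of the angles of the triangles at that point if it is a
vertex, and `2π` otherwise. -/
def coneAngle (T : FlatSphere) (p : Sphere2) : ℝ :=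
  if ∃ α i, T.param α (T.vert α i) = p then
    ∑ α, ∑ i : Fin 3, if T.param α (T.vert α i) = p then
      EuclideanGeometry.angle (T.vert α (i + 1)) (T.vert α i) (T.vert α (i + 2)) else 0
  else 2 * Real.pi

/-- A singular point is a point whose cone angle is not `2π`. -/
def singularSet (T : FlatSphere) : Set Sphere2 := {p | T.coneAngle p ≠ 2 * Real.pi}

/-- There are exactly four singular points, and all have cone angle `π`. -/
def IsPiPiPiPi (T : FlatSphere) : Prop :=
  T.singularSet.ncard = 4 ∧ ∀ p ∈ T.singularSet, T.coneAngle p = Real.pi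

/-- Two cone metrics on the (oriented) sphere agree up to homothety and orientation-preserving
isometry. This is an equivalence relation. -/
def Similar (T T' : FlatSphere) : Prop :=
  ∃ (f : Sphere2 ≃ₜ Sphere2) (c : ℝ), 0 < c ∧
    (∀ x y, T'.dist (f x) (f y) = c * T.dist x y) ∧
    PreservesOrientation T.tri T.param T'.tri T'.param f

end FlatSphere

/-- The set `C(π, π, π, π)` of cone metrics on the sphere with four singular points of cone angle
`π`, up to homothety and orientation-preserving isometry. -/
def ConePi : Type :=
  Quot fun T T' : {T : FlatSphere // T.IsPiPiPiPi} => FlatSphere.Similar T.1 T'.1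

/-! ### Gluing the edges of a triangle at their midpoints -/

/-- `x` and `y` lie on the same edge of the triangle `0, z 0, z 1` and are exchanged by the rotation
by `π` about the midpoint of this edge. -/
def FoldStep (z : Fin 2 → ℂ) (x y : ℂ) : Prop :=
  (x ∈ segment ℝ 0 (z 0) ∧ x + y = z 0) ∨
  (x ∈ segment ℝ (z 0) (z 1) ∧ x + y = z 0 + z 1) ∨
  (x ∈ segment ℝ 0 (z 1) ∧ x + y = z 1)

/-- The oriented cone metric `T` on the sphere is obtained from the triangle `0, z 0, z 1` by gluing
the two halves of each of its edges: `q` identifies the quotient of the triangle with the sphere,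
the quotient metric with the metric of `T`, and it preserves orientation. -/
def IsGluing (z : Fin 2 → ℂ) (T : FlatSphere) : Prop :=
  ∃ q : ℂ → Sphere2,
    ContinuousOn q (triangle ![0, z 0, z 1]) ∧
    q '' triangle ![0, z 0, z 1] = Set.univ ∧
    (∀ x ∈ triangle ![0, z 0, z 1], ∀ y ∈ triangle ![0, z 0, z 1],
      q x = q y ↔ Relation.EqvGen (FoldStep z) x y) ∧
    (∀ x y, T.dist x y
      = gluedDist (fun _ : Unit => triangle ![0, z 0, z 1]) (fun _ => q) x y) ∧
    PreservesOrientation (fun _ : Unit => triangle ![0, z 0, z 1]) (fun _ => q) T.tri T.param id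

end

/-! A cone metric whose cone angles are all `π` or `2π` is locally the plane, or the plane modulo a
half turn; `ConeAtlas` records this. Such a structure can be developed: a germ of a rotated chart
continues uniquely along convex sets (`ConeAtlas.eqOn_of_developsAt`), compactness gives a uniform
radius of continuation, and so the germ extends to a map `E` from the whole plane
(`ConeAtlas.exists_developing`). The half turns at the points of angle `π` are absorbed by `E`
itself, so no universal cover is needed.

Two points with the same image under `E` are related by a direct isometry of the plane preserving
`E` (`ConeAtlas.exists_deck`). Its linear part is `1` or `-1`, since a nontrivial rotation has a
fixed centre and near the centre `E` is injective up to sign. If `E 0` has cone angle `π`, then `E`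
is the quotient by the translations of a lattice together with `v ↦ -v`
(`ConeAtlas.exists_lattice`), and the distance of two points is the least distance of their lifts
(`isLeast_gluedDist`). The metric is thus encoded by a lattice, up to the choices made.

A similarity of two such metrics, read in the plane away from countably many points, is a local
isometry after rescaling. It is locally a rotation or a reflection composed with `E'`; orientation
excludes the reflection, and unique continuation makes it a single map `x ↦ a x + b`. So similar
metrics have homothetic lattices, and conversely multiplication by the ratio descends to a
similarity (`FlatSphere.IsUniformized.exists_of_similar`, `FlatSphere.IsUniformized.similar`).
Positively oriented bases of homothetic lattices differ by a scalar and a matrix in `SL(2, ℤ)`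
(`exists_sl_of_lattice`). This yields a well-defined injective map `ConePi.shape` from cone metrics
to orbits.

The triangle `0, z 0, z 1` is half of a fundamental parallelogram of the lattice it spans, and the
half turns about the midpoints of its sides generate the group of this lattice and `v ↦ -v`. Hence
every gluing of the triangle is uniformized by that lattice
(`FlatSphere.IsPiPiPiPi.isUniformized_of_isGluing`). A gluing exists: the midlines cut the triangle
into four pieces, which fold up to the boundary of a tetrahedron (`foldedSphere`), combinatorially
even when it has no straight realization with these faces. So `ConePi.shape` is bijective, and the
required map is its inverse.

The passage from triangulations to atlases is the technical part. Around each point the triangles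
are arranged in a `FlatSphere.Fan`, a cyclic family of sectors whose angles add up to the cone
angle. That the triangles at a vertex form one cycle uses the connectedness of small punctured discs
in the sphere. -/

noncomputable section

/-! ### Spaces that are locally the plane or the quotient of the plane by a half turn -/

/-- Charts `chart p` around each point `p` of a space, defined on discs of the plane around `0`,
which are injective, respectively injective up to sign at the conic points, and differ by
rotations and translations. -/
structure ConeAtlas (S : Type*) [TopologicalSpace S] where
  radius : S → ℝ
  chart : S → ℂ → S
  conic : Set S
  radius_pos : ∀ p, 0 < radius p
  chart_zero : ∀ p, chart p 0 = p
  continuousAt_zero : ∀ p, ContinuousAt (chart p) 0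
  image_mem_nhds : ∀ p s, 0 < s → chart p '' Metric.ball 0 s ∈ 𝓝 p
  eq_or_eq_neg : ∀ p u v, ‖u‖ < radius p → ‖v‖ < radius p → chart p u = chart p v →
    u = v ∨ (u = -v ∧ p ∈ conic)
  chart_neg : ∀ p ∈ conic, ∀ u, ‖u‖ < radius p → chart p (-u) = chart p u
  transition : ∀ p u, ‖u‖ < radius p →
    ∃ a : ℂ, ‖a‖ = 1 ∧ ∀ᶠ v in 𝓝 u, chart p v = chart (chart p u) (a * (v - u))

namespace ConeAtlas

variable {S : Type*} [TopologicalSpace S] (A : ConeAtlas S)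

/-- Near `x` and within `C`, the map `F` is a chart up to a rotation and a translation. -/
def DevelopsAt (F : ℂ → S) (C : Set ℂ) (x : ℂ) : Prop :=
  ∃ a : ℂ, ‖a‖ = 1 ∧ ∀ᶠ v in 𝓝[C] x, F v = A.chart (F x) (a * (v - x))

variable {A}

theorem DevelopsAt.mono {F : ℂ → S} {C D : Set ℂ} {x : ℂ} (h : A.DevelopsAt F C x) (hD : D ⊆ C) :
    A.DevelopsAt F D x := by
  obtain ⟨a, ha, h⟩ := h
  exact ⟨a, ha, h.filter_mono (nhdsWithin_mono x hD)⟩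

theorem tendsto_mul_sub (a x : ℂ) (C : Set ℂ) :
    Filter.Tendsto (fun v => a * (v - x)) (𝓝[C] x) (𝓝 0) := by
  have : ContinuousAt (fun v => a * (v - x)) x := by fun_prop
  have h := this.tendsto
  simp only [sub_self, mul_zero] at h
  exact h.mono_left nhdsWithin_le_nhds

theorem eventually_norm_mul_sub_lt (a x : ℂ) (C : Set ℂ) {r : ℝ} (hr : 0 < r) :
    ∀ᶠ v in 𝓝[C] x, ‖a * (v - x)‖ < r := by
  have := (tendsto_mul_sub a x C).norm
  rw [norm_zero] at this
  exact this.eventually_lt_const hr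

theorem DevelopsAt.continuousWithinAt {F : ℂ → S} {C : Set ℂ} {x : ℂ}
    (h : A.DevelopsAt F C x) : ContinuousWithinAt F C x := by
  obtain ⟨a, ha, h⟩ := h
  have h1 : Filter.Tendsto (fun v => A.chart (F x) (a * (v - x))) (𝓝[C] x) (𝓝 (F x)) := by
    have := (A.continuousAt_zero (F x)).tendsto.comp (tendsto_mul_sub a x C)
    rwa [A.chart_zero] at this
  exact h1.congr' (h.mono fun _ hv => hv.symm)

theorem DevelopsAt.continuousAt {F : ℂ → S} {x : ℂ}
    (h : A.DevelopsAt F Set.univ x) : ContinuousAt F x := by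
  simpa [continuousWithinAt_univ] using h.continuousWithinAt

theorem DevelopsAt.congr {F G : ℂ → S} {C : Set ℂ} {x : ℂ} (h : A.DevelopsAt F C x)
    (hG : G =ᶠ[𝓝[C] x] F) (hx : G x = F x) : A.DevelopsAt G C x := by
  obtain ⟨a, ha, h⟩ := h
  refine ⟨a, ha, ?_⟩
  filter_upwards [h, hG] with v h1 h2
  rw [h2, h1, hx]

theorem chart_developsAt (p : S) {u : ℂ} (hu : ‖u‖ < A.radius p) :
    A.DevelopsAt (A.chart p) Set.univ u := by
  obtain ⟨a, ha, h⟩ := A.transition p u hu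
  exact ⟨a, ha, by simpa using h⟩

/-- Precomposition with a direct isometry of the plane. -/
theorem DevelopsAt.comp_affine {F : ℂ → S} {C : Set ℂ} {a b x : ℂ} (ha : ‖a‖ = 1)
    (h : A.DevelopsAt F C (a * x + b)) :
    A.DevelopsAt (fun v => F (a * v + b)) ((fun v => a * v + b) ⁻¹' C) x := by
  obtain ⟨c, hc, h⟩ := h
  refine ⟨c * a, by simp [ha, hc], ?_⟩
  have ht : Filter.Tendsto (fun v => a * v + b) (𝓝[(fun v => a * v + b) ⁻¹' C] x)
      (𝓝[C] (a * x + b)) := by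
    have h1 : ContinuousWithinAt (fun v => a * v + b) ((fun v => a * v + b) ⁻¹' C) x := by
      fun_prop
    exact h1.tendsto_nhdsWithin (Set.mapsTo_preimage _ _)
  filter_upwards [ht.eventually h] with v hv
  rw [hv]
  congr 1
  ring

/-- If two rotated charts at a point agree at one other point then they agree. -/
theorem chart_mul_eq_of_eq {p : S} {a b u : ℂ} (ha : ‖a‖ = 1) (hb : ‖b‖ = 1)
    (hu : ‖u‖ < A.radius p) (hu0 : u ≠ 0) (h : A.chart p (a * u) = A.chart p (b * u)) :
    a = b ∨ (a = -b ∧ p ∈ A.conic) := by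
  rcases A.eq_or_eq_neg p (a * u) (b * u) (by simpa [ha]) (by simpa [hb]) h with h | ⟨h, hp⟩
  · exact Or.inl (mul_right_cancel₀ hu0 h)
  · refine Or.inr ⟨mul_right_cancel₀ hu0 (by rw [h]; ring), hp⟩

theorem chart_mul_eq_of_eq_or {p : S} {a b : ℂ} (hb : ‖b‖ = 1)
    (h : a = b ∨ (a = -b ∧ p ∈ A.conic)) {u : ℂ} (hu : ‖u‖ < A.radius p) :
    A.chart p (a * u) = A.chart p (b * u) := by
  rcases h with rfl | ⟨rfl, hp⟩
  · rfl
  · rw [neg_mul, A.chart_neg p hp]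
    simpa [hb]

/-- Unique continuation. -/
theorem eqOn_of_developsAt [T2Space S] {F G : ℂ → S} {C : Set ℂ} (hC : IsPreconnected C)
    (hF : ∀ x ∈ C, A.DevelopsAt F C x) (hG : ∀ x ∈ C, A.DevelopsAt G C x) {x₀ : ℂ} (hx₀ : x₀ ∈ C)
    (h₀ : F =ᶠ[𝓝[C] x₀] G) : Set.EqOn F G C := by
  -- Agreement of the two germs is a locally constant property along `C`, hence constant on a
  -- preconnected set.
  have key : ∀ x ∈ C, ∀ᶠ y in 𝓝[C] x, ((F =ᶠ[𝓝[C] x] G) ↔ (F =ᶠ[𝓝[C] y] G)) := by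
    intro x hx
    by_cases hA : F =ᶠ[𝓝[C] x] G
    · filter_upwards [eventually_eventually_nhdsWithin.2 hA] with y hy
      exact ⟨fun _ => hy, fun _ => hA⟩
    · obtain ⟨a, ha, h1⟩ := hF x hx
      obtain ⟨b, hb, h2⟩ := hG x hx
      by_cases hxx : F x = G x
      -- If the germs agreed at some nearby `y ≠ x`, the two rotated charts would agree at a nonzero
      -- vector. The rotations would then agree up to the ambiguity of the chart, and the germs
      -- would already agree at `x`.
      · filter_upwards [h1, h2, eventually_norm_mul_sub_lt 1 x C (A.radius_pos (F x)),
          self_mem_nhdsWithin] with y h3 h4 h5 hyC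
        refine ⟨fun h => absurd h hA, fun h => absurd ?_ hA⟩
        have hne : y - x ≠ 0 := by
          intro h0
          rw [sub_eq_zero.1 h0] at h
          exact hA h
        have hy : F y = G y := h.self_of_nhdsWithin hyC
        rw [h3, h4, ← hxx] at hy
        rw [one_mul] at h5
        have hab := chart_mul_eq_of_eq ha hb h5 hne hy
        filter_upwards [h1, h2, eventually_norm_mul_sub_lt 1 x C (A.radius_pos (F x))]
          with v h6 h7 h8
        rw [one_mul] at h8
        rw [h6, h7, ← hxx]
        exact chart_mul_eq_of_eq_or hb hab h8
      · have hne : ∀ᶠ y in 𝓝[C] x, F y ≠ G y :=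
          ((hF x hx).continuousWithinAt.tendsto.prodMk_nhds
            (hG x hx).continuousWithinAt.tendsto).eventually
            ((isClosed_diagonal.isOpen_compl).mem_nhds hxx)
        filter_upwards [hne, self_mem_nhdsWithin] with y hy hyC
        exact ⟨fun h => absurd h hA, fun h => absurd (h.self_of_nhdsWithin hyC) hy⟩
  intro y hy
  have := hC.induction₂ (fun x y => (F =ᶠ[𝓝[C] x] G) ↔ (F =ᶠ[𝓝[C] y] G)) key
    (fun _ _ _ _ _ _ h1 h2 => h1.trans h2) (fun _ _ _ _ h => h.symm) hx₀ hy
  exact (this.1 h₀).self_of_nhdsWithin hy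

/-- A germ at `z` with value `p`. -/
theorem exists_extension_radius [CompactSpace S] (A : ConeAtlas S) :
    ∃ δ : ℝ, 0 < δ ∧ ∀ (p : S) (a z : ℂ), ‖a‖ = 1 → ∃ F : ℂ → S,
      (∀ x, ‖x - z‖ < δ → A.DevelopsAt F Set.univ x) ∧
      ∀ᶠ v in 𝓝 z, F v = A.chart p (a * (v - z)) := by
  suffices h : ∃ δ : ℝ, 0 < δ ∧ ∀ p ∈ (Set.univ : Set S), ∀ a z : ℂ, ‖a‖ = 1 → ∃ F : ℂ → S,
      (∀ x, ‖x - z‖ < δ → A.DevelopsAt F Set.univ x) ∧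
      ∀ᶠ v in 𝓝 z, F v = A.chart p (a * (v - z)) by
    obtain ⟨δ, h1, h2⟩ := h
    exact ⟨δ, h1, fun p => h2 p trivial⟩
  -- A radius that serves all points of a set also serves its subsets, and a minimum serves a union
  -- of two; by compactness it is enough to find a radius near each point.
  refine isCompact_univ.induction_on ⟨1, one_pos, fun p hp => absurd hp (Set.notMem_empty p)⟩
    (fun s t hst ⟨δ, h1, h2⟩ => ⟨δ, h1, fun p hp => h2 p (hst hp)⟩) ?_ ?_
  · rintro s t ⟨δ, h1, h2⟩ ⟨ε, h3, h4⟩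
    refine ⟨min δ ε, lt_min h1 h3, ?_⟩
    rintro p (hp | hp) a z ha
    · obtain ⟨F, hF, h⟩ := h2 p hp a z ha
      exact ⟨F, fun x hx => hF x (hx.trans_le (min_le_left _ _)), h⟩
    · obtain ⟨F, hF, h⟩ := h4 p hp a z ha
      exact ⟨F, fun x hx => hF x (hx.trans_le (min_le_right _ _)), h⟩
  · intro p _
    have hr := A.radius_pos p
    refine ⟨A.chart p '' Metric.ball 0 (A.radius p / 2),
      mem_nhdsWithin_of_mem_nhds (A.image_mem_nhds p _ (half_pos hr)), A.radius p / 2,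
      half_pos hr, ?_⟩
    rintro _ ⟨u, hu, rfl⟩ a z ha
    rw [mem_ball_zero_iff] at hu
    obtain ⟨b, hb, h⟩ := A.transition p u (by linarith)
    have hb0 : b ≠ 0 := by rintro rfl; simp at hb
    have hn : ‖b⁻¹ * a‖ = 1 := by simp [ha, hb]
    -- The chart at `p` is precomposed with the direct isometry that takes `z` to `u` and matches
    -- the prescribed rotation. As `u` lies in the disc of half the radius, the other half is left
    -- for the extension.
    refine ⟨fun w => A.chart p (b⁻¹ * a * w + (u - b⁻¹ * a * z)), fun x hx => ?_, ?_⟩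
    · refine ((chart_developsAt p (u := b⁻¹ * a * x + (u - b⁻¹ * a * z)) ?_).comp_affine hn).mono
        (by simp)
      calc ‖b⁻¹ * a * x + (u - b⁻¹ * a * z)‖ = ‖b⁻¹ * a * (x - z) + u‖ := by congr 1; ring
        _ ≤ ‖b⁻¹ * a * (x - z)‖ + ‖u‖ := norm_add_le _ _
        _ < A.radius p := by rw [norm_mul, hn]; linarith
    · have ht : Filter.Tendsto (fun w => b⁻¹ * a * w + (u - b⁻¹ * a * z)) (𝓝 z) (𝓝 u) := by
        have : ContinuousAt (fun w => b⁻¹ * a * w + (u - b⁻¹ * a * z)) z := by fun_prop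
        have h2 := this.tendsto
        simpa using h2
      filter_upwards [ht.eventually h] with w hw
      rw [hw]
      congr 1
      field_simp
      ring

/-- The extension property for germs to translates of a neighbourhood `U` of `0`. -/
def ExtendsTo (A : ConeAtlas S) (U : Set ℂ) : Prop :=
  ∀ (p : S) (a z : ℂ), ‖a‖ = 1 → ∃ F : ℂ → S,
    (∀ x, x - z ∈ U → A.DevelopsAt F Set.univ x) ∧ ∀ᶠ v in 𝓝 z, F v = A.chart p (a * (v - z))

/-- Germs extend to the union of a convex set and a translate of this set which meets it. -/
theorem ExtendsTo.union_translate [T2Space S] {U V : Set ℂ} (h : A.ExtendsTo U) (hU : IsOpen U)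
    (hc : Convex ℝ U) (h0 : (0 : ℂ) ∈ U) {t : ℂ} (ht : t ∈ U)
    (hV : ∀ x ∈ V, x ∈ U ∨ x - t ∈ U) : A.ExtendsTo V := by
  classical
  intro p a z ha
  obtain ⟨F, h1, h2⟩ := h p a z ha
  obtain ⟨b, hb, h3⟩ := h1 (z + t) (by simpa)
  rw [nhdsWithin_univ] at h3
  -- `G` continues the germ of `F` at `z + t`. Both are defined on a convex overlap containing `z +
  -- t`, so they agree there and can be pasted.
  obtain ⟨G, h4, h5⟩ := h (F (z + t)) b (z + t) hb
  set P : Set ℂ := (fun x => x - z) ⁻¹' U with hP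
  set Q : Set ℂ := (fun x => x - (z + t)) ⁻¹' U with hQ
  have hPo : IsOpen P := hU.preimage (by fun_prop)
  have hQo : IsOpen Q := hU.preimage (by fun_prop)
  have hPc : Convex ℝ P := by
    have := hc.translate_preimage_right (-z)
    simpa only [hP, sub_eq_neg_add] using this
  have hQc : Convex ℝ Q := by
    have := hc.translate_preimage_right (-(z + t))
    simpa only [hQ, sub_eq_neg_add] using this
  have hPQ : Set.EqOn F G (P ∩ Q) := by
    refine eqOn_of_developsAt (A := A) (hPc.inter hQc).isPreconnected
      (fun x hx => (h1 x hx.1).mono (Set.subset_univ _))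
      (fun x hx => (h4 x hx.2).mono (Set.subset_univ _)) (x₀ := z + t) ⟨by simpa [hP], by simpa [hQ]⟩ ?_
    refine nhdsWithin_le_nhds ?_
    filter_upwards [h3, h5] with v h6 h7
    rw [h6, h7]
  refine ⟨fun x => if x ∈ P then F x else G x, fun x hx => ?_, ?_⟩
  · by_cases hxP : x ∈ P
    · refine (h1 x hxP).congr ?_ (by simp [hxP])
      rw [nhdsWithin_univ]
      filter_upwards [hPo.mem_nhds hxP] with v hv
      simp [hv]
    · have hxQ : x ∈ Q := by
        rcases hV _ hx with h | h
        · exact absurd h hxP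
        · simpa [hQ, sub_sub] using h
      refine (h4 x hxQ).congr ?_ (by simp [hxP])
      rw [nhdsWithin_univ]
      filter_upwards [hQo.mem_nhds hxQ] with v hv
      by_cases hvP : v ∈ P
      · simp only [hvP, if_true]
        exact hPQ ⟨hvP, hv⟩
      · simp [hvP]
  · filter_upwards [h2, hPo.mem_nhds (show z ∈ P by simpa [hP])] with v hv hvP
    simpa [hvP] using hv

/-- An open rectangle around `0`. -/
def rect (a b c d : ℝ) : Set ℂ := {x | -a < x.re ∧ x.re < b ∧ -c < x.im ∧ x.im < d}

theorem isOpen_rect (a b c d : ℝ) : IsOpen (rect a b c d) :=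
  (isOpen_lt continuous_const Complex.continuous_re).inter
    ((isOpen_lt Complex.continuous_re continuous_const).inter
      ((isOpen_lt continuous_const Complex.continuous_im).inter
        (isOpen_lt Complex.continuous_im continuous_const)))

theorem convex_rect (a b c d : ℝ) : Convex ℝ (rect a b c d) :=
  (convex_halfSpace_re_gt _).inter ((convex_halfSpace_re_lt _).inter
    ((convex_halfSpace_im_gt _).inter (convex_halfSpace_im_lt _)))

/-- Each side is pushed out by `a / 2` in turn. Rectangles are convenient because the union of a
rectangle with its translate along an axis is again a rectangle, so convexity is kept for the next
step. -/
theorem ExtendsTo.rect_grow [T2Space S] {a : ℝ} (ha : 0 < a) (h : A.ExtendsTo (rect a a a a)) :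
    A.ExtendsTo (rect (a + a / 2) (a + a / 2) (a + a / 2) (a + a / 2)) := by
  have h1 : A.ExtendsTo (rect a (a + a / 2) a a) := by
    refine h.union_translate (isOpen_rect _ _ _ _) (convex_rect ..) (t := ((a / 2 : ℝ) : ℂ)) ?_ ?_ ?_
    · simp [rect, ha]
    · simp only [rect, Set.mem_ofPred_eq, Complex.ofReal_re, Complex.ofReal_im]
      refine ⟨?_, ?_, ?_, ?_⟩ <;> linarith
    · rintro x ⟨h1, h2, h3, h4⟩
      simp only [rect, Set.mem_ofPred_eq, Complex.sub_re, Complex.sub_im, Complex.ofReal_re,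
        Complex.ofReal_im]
      by_cases hx : x.re < a
      · exact Or.inl ⟨h1, hx, h3, h4⟩
      · exact Or.inr ⟨by linarith, by linarith, by linarith, by linarith⟩
  have h2 : A.ExtendsTo (rect (a + a / 2) (a + a / 2) a a) := by
    refine h1.union_translate (isOpen_rect _ _ _ _) (convex_rect ..) (t := ((-(a / 2) : ℝ) : ℂ)) ?_ ?_ ?_
    · simp only [rect, Set.mem_ofPred_eq, Complex.zero_re, Complex.zero_im]
      refine ⟨?_, ?_, ?_, ?_⟩ <;> linarith
    · simp only [rect, Set.mem_ofPred_eq, Complex.ofReal_re, Complex.ofReal_im]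
      refine ⟨?_, ?_, ?_, ?_⟩ <;> linarith
    · rintro x ⟨h1, h2, h3, h4⟩
      simp only [rect, Set.mem_ofPred_eq, Complex.sub_re, Complex.sub_im, Complex.ofReal_re,
        Complex.ofReal_im]
      by_cases hx : -a < x.re
      · exact Or.inl ⟨hx, h2, h3, h4⟩
      · exact Or.inr ⟨by linarith, by linarith, by linarith, by linarith⟩
  have h3 : A.ExtendsTo (rect (a + a / 2) (a + a / 2) a (a + a / 2)) := by
    refine h2.union_translate (isOpen_rect _ _ _ _) (convex_rect ..) (t := ⟨0, a / 2⟩) ?_ ?_ ?_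
    · simp only [rect, Set.mem_ofPred_eq, Complex.zero_re, Complex.zero_im]
      refine ⟨?_, ?_, ?_, ?_⟩ <;> linarith
    · simp only [rect, Set.mem_ofPred_eq]
      refine ⟨?_, ?_, ?_, ?_⟩ <;> linarith
    · rintro x ⟨h1, h2, h3, h4⟩
      simp only [rect, Set.mem_ofPred_eq, Complex.sub_re, Complex.sub_im]
      by_cases hx : x.im < a
      · exact Or.inl ⟨h1, h2, h3, hx⟩
      · exact Or.inr ⟨by linarith, by linarith, by linarith, by linarith⟩
  refine h3.union_translate (isOpen_rect _ _ _ _) (convex_rect ..) (t := ⟨0, -(a / 2)⟩) ?_ ?_ ?_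
  · simp only [rect, Set.mem_ofPred_eq, Complex.zero_re, Complex.zero_im]
    refine ⟨?_, ?_, ?_, ?_⟩ <;> linarith
  · simp only [rect, Set.mem_ofPred_eq]
    refine ⟨?_, ?_, ?_, ?_⟩ <;> linarith
  · rintro x ⟨h1, h2, h3, h4⟩
    simp only [rect, Set.mem_ofPred_eq, Complex.sub_re, Complex.sub_im]
    by_cases hx : -a < x.im
    · exact Or.inl ⟨h1, h2, hx, h4⟩
    · exact Or.inr ⟨by linarith, by linarith, by linarith, by linarith⟩

/-- Growth by the factor `3 / 2` can be iterated without any loss, so the rectangles exhaust the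
plane. -/
theorem exists_extendsTo_rect [T2Space S] [CompactSpace S] (A : ConeAtlas S) :
    ∃ δ : ℝ, 0 < δ ∧ ∀ n : ℕ, A.ExtendsTo
      (rect (δ * (3 / 2) ^ n) (δ * (3 / 2) ^ n) (δ * (3 / 2) ^ n) (δ * (3 / 2) ^ n)) := by
  obtain ⟨δ, h0, h⟩ := A.exists_extension_radius
  -- Half of `δ` suffices to put the first square inside the disc, since the norm is at most `|re| +
  -- |im|`.
  refine ⟨δ / 2, half_pos h0, fun n => ?_⟩
  induction n with
  | zero =>
    intro p a z ha
    obtain ⟨F, h1, h2⟩ := h p a z ha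
    refine ⟨F, fun x hx => h1 x ?_, h2⟩
    obtain ⟨h3, h4, h5, h6⟩ := hx
    rw [pow_zero, mul_one] at h3 h4 h5 h6
    have := Complex.norm_le_abs_re_add_abs_im (x - z)
    have h7 := abs_lt.2 ⟨h3, h4⟩
    have h8 := abs_lt.2 ⟨h5, h6⟩
    linarith
  | succ n ih =>
    have := ih.rect_grow (by positivity)
    convert this using 1
    congr 1 <;> ring

/-- The developing map: every germ extends to the whole plane. -/
theorem exists_developing [T2Space S] [CompactSpace S] (A : ConeAtlas S) (p : S) :
    ∃ E : ℂ → S, (∀ x, A.DevelopsAt E Set.univ x) ∧ E 0 = p := by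
  obtain ⟨δ, h0, h⟩ := A.exists_extendsTo_rect
  set R : ℕ → Set ℂ := fun n =>
    rect (δ * (3 / 2) ^ n) (δ * (3 / 2) ^ n) (δ * (3 / 2) ^ n) (δ * (3 / 2) ^ n) with hR
  choose F h1 h2 using fun n => h n p 1 0 norm_one
  have h0R : ∀ n, (0 : ℂ) ∈ R n := fun n => by
    have : 0 < δ * (3 / 2) ^ n := by positivity
    simp only [hR, rect, Set.mem_ofPred_eq, Complex.zero_re, Complex.zero_im]
    refine ⟨?_, ?_, ?_, ?_⟩ <;> linarith
  have hagree : ∀ m n, Set.EqOn (F m) (F n) (R m ∩ R n) := by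
    intro m n
    refine eqOn_of_developsAt (A := A) ((convex_rect ..).inter (convex_rect ..)).isPreconnected
      (fun x hx => (h1 m x (by simpa using hx.1)).mono (Set.subset_univ _))
      (fun x hx => (h1 n x (by simpa using hx.2)).mono (Set.subset_univ _)) (x₀ := 0)
      ⟨h0R m, h0R n⟩ ?_
    refine nhdsWithin_le_nhds ?_
    filter_upwards [h2 m, h2 n] with v h6 h7
    rw [h6, h7]
  have hcov : ∀ x : ℂ, ∃ n, x ∈ R n := by
    intro x
    obtain ⟨n, hn⟩ := pow_unbounded_of_one_lt (‖x‖ / δ) (show (1 : ℝ) < 3 / 2 by norm_num)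
    rw [div_lt_iff₀ h0, mul_comm] at hn
    have h3 := abs_lt.1 ((Complex.abs_re_le_norm x).trans_lt hn)
    have h4 := abs_lt.1 ((Complex.abs_im_le_norm x).trans_lt hn)
    exact ⟨n, h3.1, h3.2, h4.1, h4.2⟩
  choose N hN using hcov
  have hE : ∀ n, Set.EqOn (fun x => F (N x) x) (F n) (R n) := fun n x hx =>
    hagree (N x) n ⟨hN x, hx⟩
  refine ⟨fun x => F (N x) x, fun x => ?_, ?_⟩
  · refine (h1 (N x) x (by simpa using hN x)).congr ?_ rfl
    rw [nhdsWithin_univ]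
    filter_upwards [(isOpen_rect _ _ _ _).mem_nhds (hN x)] with v hv
    exact hE (N x) hv
  · have := (h2 (N 0)).self_of_nhds
    simpa [A.chart_zero] using this

end ConeAtlas

/-! ### Lattices in the plane -/

theorem mem_Hplus_iff {z : Fin 2 → ℂ} :
    z ∈ Hplus ↔ 0 < (z 0).re * (z 1).im - (z 0).im * (z 1).re := by
  simp only [Hplus, Set.mem_ofPred_eq, areaForm_self, Complex.ofReal_re]
  constructor <;> intro h <;> linarith

/-- Discreteness makes `L` a free group of rank the dimension of its real span, and bounded distance
from every point forces that span to be the plane. The basis found is swapped if it is negatively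
oriented. -/
theorem exists_basis_of_discrete_cobounded (L : AddSubgroup ℂ) {ε R : ℝ} (hε : 0 < ε)
    (hd : ∀ b ∈ L, ‖b‖ < ε → b = 0) (hR : ∀ w : ℂ, ∃ b ∈ L, ‖w - b‖ ≤ R) :
    ∃ z ∈ Hplus, ∀ b, b ∈ L ↔ ∃ m n : ℤ, b = m * z 0 + n * z 1 := by
  classical
  set M : Submodule ℤ ℂ := AddSubgroup.toIntSubmodule L with hM
  have hmem : ∀ b, b ∈ M ↔ b ∈ L := fun b => Iff.rfl
  have hdisc : DiscreteTopology M := by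
    refine DiscreteTopology.of_forall_le_norm hε ?_
    intro x hx
    by_contra h
    exact hx (Subtype.ext (hd x.1 x.2 (not_le.1 h)))
  have hspan : Submodule.span ℝ (M : Set ℂ) = ⊤ := by
    rw [eq_top_iff]
    intro w _
    have hcl : IsClosed (Submodule.span ℝ (M : Set ℂ) : Set ℂ) :=
      Submodule.closed_of_finiteDimensional _
    rw [← SetLike.mem_coe, ← hcl.closure_eq, Metric.mem_closure_iff]
    intro η hη
    -- If `b` is within `R` of `N w`, then `b / N` is within `R / N < η` of `w`; so the real span is
    -- dense, and it is closed.
    obtain ⟨N, hN⟩ := exists_nat_gt (max R 0 / η)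
    rw [div_lt_iff₀ hη] at hN
    have hN0 : (0 : ℝ) < N := by
      by_contra h
      have : (N : ℝ) * η ≤ 0 := mul_nonpos_of_nonpos_of_nonneg (not_lt.1 h) hη.le
      linarith [le_max_right R 0]
    obtain ⟨b, hb, hbR⟩ := hR ((N : ℝ) * w)
    refine ⟨(N : ℝ)⁻¹ • b, Submodule.smul_mem _ _ (Submodule.subset_span hb), ?_⟩
    have h1 : w - (N : ℝ)⁻¹ • b = (N : ℝ)⁻¹ • ((N : ℝ) * w - b) := by
      have : ((N : ℝ) : ℂ) ≠ 0 := by exact_mod_cast hN0.ne'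
      rw [Complex.real_smul, Complex.real_smul, Complex.ofReal_inv]
      field_simp
    rw [dist_eq_norm, h1, norm_smul, norm_inv, Real.norm_of_nonneg hN0.le, inv_mul_lt_iff₀ hN0]
    linarith [le_max_left R 0]
  have hZ : IsZLattice ℝ M := ⟨hspan⟩
  have hfree : Module.Free ℤ M := ZLattice.module_free ℝ M
  have hfin : Module.Finite ℤ M := ZLattice.module_finite ℝ M
  have hrank : Module.finrank ℤ M = 2 := by
    rw [ZLattice.rank ℝ M, Complex.finrank_real_complex]
  set b := Module.finBasisOfFinrankEq ℤ M hrank with hb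
  have hrep : ∀ x, x ∈ L ↔ ∃ m n : ℤ, x = m * (b 0 : ℂ) + n * (b 1 : ℂ) := by
    intro x
    constructor
    · intro hx
      refine ⟨b.repr ⟨x, hx⟩ 0, b.repr ⟨x, hx⟩ 1, ?_⟩
      have := congrArg Subtype.val (b.sum_repr ⟨x, hx⟩)
      rw [Fin.sum_univ_two] at this
      simpa [zsmul_eq_mul] using this.symm
    · rintro ⟨m, n, rfl⟩
      have h := M.add_mem (M.smul_mem m (b 0).2) (M.smul_mem n (b 1).2)
      simpa [zsmul_eq_mul, hmem] using h
  have hne : (b 0 : ℂ).re * (b 1 : ℂ).im - (b 0 : ℂ).im * (b 1 : ℂ).re ≠ 0 := by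
    intro h0
    have hli := (b.ofZLatticeBasis ℝ M).linearIndependent
    have hli2 : LinearIndependent ℝ ![(b 0 : ℂ), (b 1 : ℂ)] := by
      have : ![(b 0 : ℂ), (b 1 : ℂ)] = ⇑(b.ofZLatticeBasis ℝ M) := by
        funext i; fin_cases i <;> simp
      rw [this]
      exact hli
    rw [LinearIndependent.pair_iff] at hli2
    have h1 := hli2 (b 1 : ℂ).re (-(b 0 : ℂ).re) (by
      apply Complex.ext <;> simp <;> linarith)
    have h2 := hli2 (b 1 : ℂ).im (-(b 0 : ℂ).im) (by
      apply Complex.ext <;> simp <;> linarith)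
    have h3 : (b 0 : ℂ) = 0 := Complex.ext (by simpa using h1.2) (by simpa using h2.2)
    have := hli2 1 0 (by simp [h3])
    exact one_ne_zero this.1
  rcases lt_or_gt_of_ne hne with h | h
  · refine ⟨![(b 1 : ℂ), (b 0 : ℂ)], ?_, fun x => ?_⟩
    · rw [mem_Hplus_iff]
      simp only [Matrix.cons_val_zero, Matrix.cons_val_one]
      linarith
    · rw [hrep]
      constructor <;> rintro ⟨m, n, rfl⟩ <;> exact ⟨n, m, by simp [add_comm]⟩
  · refine ⟨![(b 0 : ℂ), (b 1 : ℂ)], ?_, fun x => ?_⟩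
    · rw [mem_Hplus_iff]
      simpa using h
    · rw [hrep]
      rfl

/-! ### The deck group of the developing map -/

namespace ConeAtlas

variable {S : Type*} [TopologicalSpace S] {A : ConeAtlas S} {E : ℂ → S}

theorem continuous_of_developsAt (hE : ∀ x, A.DevelopsAt E Set.univ x) : Continuous E :=
  continuous_iff_continuousAt.2 fun x => (hE x).continuousAt

theorem isOpenMap_of_developsAt (hE : ∀ x, A.DevelopsAt E Set.univ x) : IsOpenMap E := by
  rw [isOpenMap_iff_nhds_le]
  intro x U hU
  obtain ⟨a, ha, h⟩ := hE x
  rw [nhdsWithin_univ] at h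
  have hU' : ∀ᶠ v in 𝓝 x, E v ∈ U := hU
  obtain ⟨s, hs, h2⟩ := Metric.eventually_nhds_iff.1 (h.and hU')
  refine Filter.mem_of_superset (A.image_mem_nhds (E x) s hs) ?_
  rintro _ ⟨u, hu, rfl⟩
  have ha0 : a ≠ 0 := by rintro rfl; simp at ha
  have h3 := h2 (y := x + a⁻¹ * u) (by simpa [dist_eq_norm, ha] using hu)
  rw [h3.1, add_sub_cancel_left, mul_inv_cancel_left₀ ha0] at h3
  exact h3.2

/-- The range is open since `E` is an open map. It is closed because, once it meets a chart disc
around `q`, unique continuation identifies `E` with that chart over an entire disc in the plane,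
whose centre is then mapped to `q`. -/
theorem surjective_of_developsAt [T2Space S] [PreconnectedSpace S]
    (hE : ∀ x, A.DevelopsAt E Set.univ x) : Function.Surjective E := by
  have hopen : IsOpen (Set.range E) := (isOpenMap_of_developsAt hE).isOpen_range
  have hclosed : IsClosed (Set.range E) := by
    rw [← isOpen_compl_iff, isOpen_iff_mem_nhds]
    intro q hq
    refine Filter.mem_of_superset (A.image_mem_nhds q _ (A.radius_pos q)) ?_
    rintro _ ⟨u, hu, rfl⟩ ⟨z, hz⟩
    rw [mem_ball_zero_iff] at hu
    obtain ⟨a, ha, h⟩ := hE z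
    rw [nhdsWithin_univ, hz] at h
    obtain ⟨b, hb, hb2⟩ := A.transition q u hu
    have hb0 : b ≠ 0 := by rintro rfl; simp at hb
    have hn : ‖b⁻¹ * a‖ = 1 := by simp [ha, hb]
    have hn0 : b⁻¹ * a ≠ 0 := by intro h; rw [h] at hn; simp at hn
    set c := b⁻¹ * a with hc
    have heq : ∀ w, w ∈ Metric.ball (z - c⁻¹ * u) (A.radius q) →
        ‖c * w + (u - c * z)‖ < A.radius q := by
      intro w hw
      rw [Metric.mem_ball, dist_eq_norm] at hw
      calc ‖c * w + (u - c * z)‖ = ‖c * (w - (z - c⁻¹ * u))‖ := by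
            congr 1; field_simp; ring
        _ < _ := by rw [norm_mul, hn, one_mul]; exact hw
    have := eqOn_of_developsAt (A := A) (F := E) (G := fun w => A.chart q (c * w + (u - c * z)))
      (convex_ball (z - c⁻¹ * u) (A.radius q)).isPreconnected
      (fun x _ => (hE x).mono (Set.subset_univ _))
      (fun x hx => ((chart_developsAt q (heq x hx)).comp_affine hn).mono (by simp))
      (x₀ := z) (by simpa [dist_eq_norm, hn] using hu) ?_
    · refine hq ⟨z - c⁻¹ * u, ?_⟩
      rw [this (Metric.mem_ball_self (A.radius_pos q))]
      have : c * (z - c⁻¹ * u) + (u - c * z) = 0 := by field_simp; ring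
      simp only [this, A.chart_zero]
    · refine nhdsWithin_le_nhds ?_
      have ht : Filter.Tendsto (fun w => c * w + (u - c * z)) (𝓝 z) (𝓝 u) := by
        have : ContinuousAt (fun w => c * w + (u - c * z)) z := by fun_prop
        have h2 := this.tendsto
        simpa using h2
      filter_upwards [h, ht.eventually hb2] with w h1 h2
      rw [h1, h2]
      congr 1
      rw [hc]; field_simp; ring
  have := IsClopen.eq_univ ⟨hclosed, hopen⟩ ⟨E 0, Set.mem_range_self 0⟩
  exact Set.range_eq_univ.1 this

/-- Near `z` and near `w` the map is the chart at one and the same point, up to rotations. The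
direct isometry taking `z` to `w` and matching these rotations therefore preserves the germ of `E`
at `z`, and by unique continuation it preserves `E`. -/
theorem exists_deck [T2Space S] (hE : ∀ x, A.DevelopsAt E Set.univ x) {z w : ℂ} (h : E z = E w) :
    ∃ a : ℂ, ‖a‖ = 1 ∧ ∀ v, E (w + a * (v - z)) = E v := by
  obtain ⟨c, hc, h1⟩ := hE z
  obtain ⟨b, hb, h2⟩ := hE w
  rw [nhdsWithin_univ] at h1 h2
  have hb0 : b ≠ 0 := by rintro rfl; simp at hb
  have hn : ‖b⁻¹ * c‖ = 1 := by simp [hc, hb]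
  refine ⟨b⁻¹ * c, hn, ?_⟩
  have hform : ∀ v, w + b⁻¹ * c * (v - z) = b⁻¹ * c * v + (w - b⁻¹ * c * z) := fun v => by ring
  have := eqOn_of_developsAt (A := A) (F := fun v => E (b⁻¹ * c * v + (w - b⁻¹ * c * z))) (G := E)
    isPreconnected_univ (fun x _ => ((hE _).comp_affine hn).mono (by simp))
    (fun x _ => hE x) (Set.mem_univ z) ?_
  · intro v
    rw [hform]
    exact this (Set.mem_univ v)
  · rw [nhdsWithin_univ]
    have ht : Filter.Tendsto (fun v => b⁻¹ * c * v + (w - b⁻¹ * c * z)) (𝓝 z) (𝓝 w) := by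
      have : ContinuousAt (fun v => b⁻¹ * c * v + (w - b⁻¹ * c * z)) z := by fun_prop
      have h2 := this.tendsto
      simpa using h2
    filter_upwards [h1, ht.eventually h2] with v h3 h4
    rw [h3, h4, h]
    congr 1
    field_simp; ring

theorem exists_injOn_or [T2Space S] (hE : ∀ x, A.DevelopsAt E Set.univ x) (w : ℂ) :
    ∃ ε > 0, ∀ x y, ‖x - w‖ < ε → ‖y - w‖ < ε → E x = E y →
      x = y ∨ (x - w = -(y - w) ∧ E w ∈ A.conic) := by
  obtain ⟨c, hc, h1⟩ := hE w
  rw [nhdsWithin_univ] at h1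
  have hc0 : c ≠ 0 := by rintro rfl; simp at hc
  obtain ⟨s, hs, h2⟩ := Metric.eventually_nhds_iff.1 h1
  refine ⟨min s (A.radius (E w)), lt_min hs (A.radius_pos _), fun x y hx hy hxy => ?_⟩
  rw [h2 (y := x) (by rw [dist_eq_norm]; exact hx.trans_le (min_le_left _ _)),
    h2 (y := y) (by rw [dist_eq_norm]; exact hy.trans_le (min_le_left _ _))] at hxy
  rcases A.eq_or_eq_neg (E w) (c * (x - w)) (c * (y - w)) (by rw [norm_mul, hc, one_mul]; exact hx.trans_le (min_le_right _ _))
    (by rw [norm_mul, hc, one_mul]; exact hy.trans_le (min_le_right _ _)) hxy with h | ⟨h, h'⟩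
  · left
    have := mul_left_cancel₀ hc0 h
    exact sub_left_injective this
  · right
    refine ⟨mul_left_cancel₀ hc0 (by rw [h]; ring), h'⟩

/-- A rotation about `w` preserving `E` moves a test vector of length `ε / 2` inside the disc where
`E` is injective up to sign, so it fixes or negates this vector. -/
theorem eq_one_or_of_stabilizes [T2Space S] (hE : ∀ x, A.DevelopsAt E Set.univ x) {a w : ℂ}
    (ha : ‖a‖ = 1) (h : ∀ v, E (w + a * (v - w)) = E v) :
    a = 1 ∨ (a = -1 ∧ E w ∈ A.conic) := by
  obtain ⟨ε, hε, h1⟩ := exists_injOn_or hE w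
  have hn : ‖((ε / 2 : ℝ) : ℂ)‖ < ε := by
    rw [Complex.norm_real, Real.norm_of_nonneg (by linarith)]; linarith
  have h0 : ((ε / 2 : ℝ) : ℂ) ≠ 0 := by exact_mod_cast (half_pos hε).ne'
  have h2 := h1 (w + a * ((ε / 2 : ℝ) : ℂ)) (w + ((ε / 2 : ℝ) : ℂ))
    (by rw [add_sub_cancel_left, norm_mul, ha, one_mul]; exact hn)
    (by rw [add_sub_cancel_left]; exact hn) (by rw [← h (w + ((ε / 2 : ℝ) : ℂ))]; simp)
  rw [add_sub_cancel_left, add_sub_cancel_left] at h2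
  rcases h2 with h2 | ⟨h2, h3⟩
  · left
    exact mul_right_cancel₀ h0 (by rw [one_mul]; exact add_left_cancel h2)
  · right
    exact ⟨mul_right_cancel₀ h0 (by rw [h2]; ring), h3⟩

/-- A direct isometry with linear part `a ≠ 1` has the fixed point `(w - a z) / (1 - a)`, and
`eq_one_or_of_stabilizes` applied there leaves only the half turn. -/
theorem deck_cases [T2Space S] (hE : ∀ x, A.DevelopsAt E Set.univ x) {z w : ℂ} (h : E z = E w) :
    (∀ v, E (v + (w - z)) = E v) ∨ (∀ v, E (z + w - v) = E v) := by
  obtain ⟨a, ha, h1⟩ := exists_deck hE h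
  by_cases ha1 : a = 1
  · left
    intro v
    rw [← h1 v, ha1]
    congr 1; ring
  · right
    have h1a : 1 - a ≠ 0 := sub_ne_zero.2 (Ne.symm ha1)
    have h2 : ∀ v, E ((w - a * z) / (1 - a) + a * (v - (w - a * z) / (1 - a))) = E v := by
      intro v
      rw [← h1 v]
      congr 1
      field_simp
      ring
    rcases eq_one_or_of_stabilizes hE ha h2 with h3 | ⟨h3, -⟩
    · exact absurd h3 ha1
    · intro v
      rw [← h1 v, h3]
      congr 1; ring

/-- At a conic point the chart is even, so `E` and its composition with the half turn about `w` have
the same germ at `w`. Conversely a half turn preserving `E` is a stabilizer different from the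
identity. -/
theorem mem_conic_iff [T2Space S] (hE : ∀ x, A.DevelopsAt E Set.univ x) {w : ℂ} :
    E w ∈ A.conic ↔ ∀ v, E (2 * w - v) = E v := by
  constructor
  · intro hw v
    obtain ⟨c, hc, h1⟩ := hE w
    rw [nhdsWithin_univ] at h1
    have := eqOn_of_developsAt (A := A) (F := fun v => E ((-1) * v + 2 * w)) (G := E)
      isPreconnected_univ (fun x _ => ((hE _).comp_affine (by simp)).mono (by simp))
      (fun x _ => hE x) (Set.mem_univ w) ?_
    · rw [← this (Set.mem_univ v)]
      ring_nf
    · rw [nhdsWithin_univ]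
      have ht : Filter.Tendsto (fun v => (-1) * v + 2 * w) (𝓝 w) (𝓝 w) := by
        have : ContinuousAt (fun v => (-1) * v + 2 * w) w := by fun_prop
        have h2 := this.tendsto
        convert h2 using 2; ring
      have hr := eventually_norm_mul_sub_lt c w Set.univ (A.radius_pos (E w))
      rw [nhdsWithin_univ] at hr
      filter_upwards [h1, ht.eventually h1, hr] with v h3 h4 h5
      rw [h3, h4, ← A.chart_neg _ hw _ h5]
      congr 1; ring
  · intro h
    rcases eq_one_or_of_stabilizes hE (a := -1) (w := w) (by simp)
      (fun v => by rw [← h v]; congr 1; ring) with h1 | ⟨-, h1⟩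
    · norm_num at h1
    · exact h1

/-- The periods of a map on the plane. -/
def periods (E : ℂ → S) : AddSubgroup ℂ where
  carrier := {b | ∀ v, E (v + b) = E v}
  add_mem' {a b} ha hb v := by rw [← add_assoc, hb, ha]
  zero_mem' v := by rw [add_zero]
  neg_mem' {a} ha v := by rw [← ha (v + -a), neg_add_cancel_right]

/-- As `E` is even about the conic base point, a half turn with `x ↦ y` can be composed with `v ↦
-v`, which turns it into the translation by `x + y`. -/
theorem apply_eq_iff_periods [T2Space S] (hE : ∀ x, A.DevelopsAt E Set.univ x)
    (h0 : E 0 ∈ A.conic) {x y : ℂ} :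
    E x = E y ↔ x - y ∈ periods E ∨ x + y ∈ periods E := by
  have heven : ∀ v, E (-v) = E v := by
    intro v
    have := (mem_conic_iff hE).1 h0 v
    simpa using this
  constructor
  · intro h
    rcases deck_cases hE h.symm with h1 | h1
    · exact Or.inl h1
    · refine Or.inr fun v => ?_
      rw [← heven v, ← h1 (-v)]
      congr 1; ring
  · rintro (h | h)
    · rw [← h y]; congr 1; ring
    · rw [← heven y, ← h (-y)]; congr 1; ring

/-- The developing map at a conic point is the quotient map by a lattice and a half turn. -/
theorem exists_lattice [T2Space S] [CompactSpace S] [PreconnectedSpace S]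
    (hE : ∀ x, A.DevelopsAt E Set.univ x) (h0 : E 0 ∈ A.conic) :
    ∃ z ∈ Hplus, ∀ b, b ∈ periods E ↔ ∃ m n : ℤ, b = m * z 0 + n * z 1 := by
  obtain ⟨ε, hε, h1⟩ := exists_injOn_or hE 0
  have hsurj := surjective_of_developsAt hE
  -- The images of the balls about `0` are open, increasing and cover the compact space, so one of
  -- them is everything. This gives the bounded distance from the group of periods.
  obtain ⟨R, hR⟩ : ∃ R : ℕ, ∀ p, ∃ x, ‖x‖ < R ∧ E x = p := by
    have hcov : (Set.univ : Set S) ⊆ ⋃ n : ℕ, E '' Metric.ball 0 n := by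
      intro p _
      obtain ⟨x, rfl⟩ := hsurj p
      obtain ⟨n, hn⟩ := exists_nat_gt ‖x‖
      exact Set.mem_iUnion.2 ⟨n, x, by simpa using hn, rfl⟩
    have hdir : Directed (· ⊆ ·) fun n : ℕ => E '' Metric.ball 0 (n : ℝ) := by
      refine Monotone.directed_le ?_
      intro m n hmn
      exact Set.image_mono (Metric.ball_subset_ball (by exact_mod_cast hmn))
    obtain ⟨n, hn⟩ := isCompact_univ.elim_directed_cover _
      (fun n => isOpenMap_of_developsAt hE _ Metric.isOpen_ball) hcov hdir
    refine ⟨n, fun p => ?_⟩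
    obtain ⟨x, hx, h⟩ := hn (Set.mem_univ p)
    exact ⟨x, by simpa using hx, h⟩
  refine exists_basis_of_discrete_cobounded (periods E) (ε := ε) (R := R) hε ?_ ?_
  · intro b hb hbε
    have h2 := h1 b 0 (by simpa) (by simpa) (by simpa using hb 0)
    rcases h2 with h2 | ⟨h2, -⟩
    · exact h2
    · simpa using h2
  · intro w
    obtain ⟨x, hx, hxw⟩ := hR (E w)
    rcases (apply_eq_iff_periods hE h0).1 hxw.symm with h | h
    · exact ⟨_, h, by simpa using hx.le⟩
    · exact ⟨_, h, by simpa using hx.le⟩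

end ConeAtlas

/-! ### Chains of segments and the length metric -/

section Chains

variable {ι S : Type*} {Δ : ι → Set ℂ} {φ : ι → ℂ → S}

theorem IsChainLength.trans {x y z : S} {L M : ℝ} (h : IsChainLength Δ φ x y L)
    (h' : IsChainLength Δ φ y z M) : IsChainLength Δ φ x z (L + M) := by
  induction h with
  | refl x => simpa using h'
  | cons i a b y L ha hb h ih =>
    rw [add_assoc]
    exact .cons i a b z _ ha hb (ih h')

theorem IsChainLength.nonneg {x y : S} {L : ℝ} (h : IsChainLength Δ φ x y L) : 0 ≤ L := by
  induction h with
  | refl x => exact le_rfl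
  | cons i a b y L ha hb h ih => positivity

theorem IsChainLength.single {i : ι} {a b : ℂ} (ha : a ∈ Δ i) (hb : b ∈ Δ i) :
    IsChainLength Δ φ (φ i a) (φ i b) ‖a - b‖ := by
  simpa using IsChainLength.cons i a b _ 0 ha hb (.refl (φ i b))

theorem gluedDist_le {x y : S} {L : ℝ} (h : IsChainLength Δ φ x y L) :
    gluedDist Δ φ x y ≤ L :=
  csInf_le ⟨0, fun _ hM => IsChainLength.nonneg hM⟩ h

theorem le_gluedDist {x y : S} {c L : ℝ} (h : IsChainLength Δ φ x y L)
    (hc : ∀ M, IsChainLength Δ φ x y M → c ≤ M) : c ≤ gluedDist Δ φ x y :=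
  le_csInf ⟨L, h⟩ hc

/-- A path which is locally a chain of segments is a chain of segments. -/
theorem isChainLength_of_locally {f : ℝ → S} {ℓ : ℝ}
    (h : ∀ s ∈ Set.Icc (0 : ℝ) 1, ∀ᶠ t in 𝓝[Set.Icc (0 : ℝ) 1] s,
      IsChainLength Δ φ (f s) (f t) (|t - s| * ℓ) ∧ IsChainLength Δ φ (f t) (f s) (|t - s| * ℓ)) :
    IsChainLength Δ φ (f 0) (f 1) ℓ := by
  -- Continuous induction on the parameter: the set of times up to which the path is a chain of the
  -- right length is closed and can be prolonged to the right. The reversed chains in the hypothesis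
  -- serve to reach a limit time.
  set A : Set ℝ := {s | ∀ s' ∈ Set.Icc 0 s, IsChainLength Δ φ (f 0) (f s') (s' * ℓ)} with hA
  have hclosed : IsClosed (A ∩ Set.Icc 0 1) := by
    refine isClosed_of_closure_subset fun x hx => ?_
    have hx01 : x ∈ Set.Icc (0 : ℝ) 1 := isClosed_Icc.closure_subset_iff.2
      Set.inter_subset_right hx
    refine ⟨fun s' hs' => ?_, hx01⟩
    have h1 := h x hx01
    rw [eventually_nhdsWithin_iff, Metric.eventually_nhds_iff] at h1
    obtain ⟨δ, hδ, h1⟩ := h1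
    have hpos : 0 < if s' < x then x - s' else δ := by split_ifs <;> linarith
    obtain ⟨t, ⟨htA, ht01⟩, ht⟩ := Metric.mem_closure_iff.1 hx _ hpos
    by_cases hs : s' < x
    · rw [if_pos hs, Real.dist_eq, abs_lt] at ht
      exact htA s' ⟨hs'.1, by linarith⟩
    · rw [if_neg hs] at ht
      obtain rfl : s' = x := le_antisymm hs'.2 (not_lt.1 hs)
      rcases le_or_gt s' t with hst | hst
      · exact htA s' ⟨hs'.1, hst⟩
      · have h2 := (h1 (by rwa [dist_comm]) ht01).2
        rw [abs_of_neg (by linarith)] at h2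
        have h3 := (htA t ⟨ht01.1, le_rfl⟩).trans h2
        convert h3 using 1
        ring
  have hsub : Set.Icc (0 : ℝ) 1 ⊆ A := by
    refine hclosed.Icc_subset_of_forall_exists_gt ?_ ?_
    · intro s' hs'
      obtain rfl : s' = 0 := le_antisymm hs'.2 hs'.1
      rw [zero_mul]
      exact .refl _
    · rintro x ⟨hxA, hx⟩ y hy
      have h1 := h x ⟨hx.1, hx.2.le⟩
      rw [eventually_nhdsWithin_iff, Metric.eventually_nhds_iff] at h1
      obtain ⟨δ, hδ, h1⟩ := h1
      have hy' : x < y := hy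
      have hlt : x < min (min y 1) (x + δ / 2) := lt_min (lt_min hy' hx.2) (by linarith)
      refine ⟨min (min y 1) (x + δ / 2), fun s' hs' => ?_, hlt,
        (min_le_left _ _).trans (min_le_left _ _)⟩
      rcases le_or_gt s' x with hsx | hsx
      · exact hxA s' ⟨hs'.1, hsx⟩
      · have h3 := hs'.2.trans (min_le_right _ _)
        have h4 := hs'.2.trans ((min_le_left _ _).trans (min_le_right _ _))
        have h2 := (h1 (y := s') (by rw [Real.dist_eq, abs_of_pos] <;> linarith) ⟨hs'.1, h4⟩).1
        rw [abs_of_pos (by linarith)] at h2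
        have h5 := (hxA x ⟨hx.1, le_rfl⟩).trans h2
        convert h5 using 1
        ring
  have := hsub (Set.right_mem_Icc.2 zero_le_one) 1 (Set.right_mem_Icc.2 zero_le_one)
  simpa using this

/-- A segment which is locally contained in pieces is a chain. -/
theorem isChainLength_of_locally_segment {E : ℂ → S} {x y : ℂ}
    (h : ∀ w ∈ segment ℝ x y, ∀ᶠ u in 𝓝[segment ℝ x y] w, ∃ i, ∃ a ∈ Δ i, ∃ b ∈ Δ i,
      φ i a = E w ∧ φ i b = E u ∧ ‖a - b‖ = ‖w - u‖) :
    IsChainLength Δ φ (E x) (E y) ‖x - y‖ := by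
  have h1 := isChainLength_of_locally (Δ := Δ) (φ := φ)
    (f := fun s : ℝ => E (AffineMap.lineMap x y s)) (ℓ := ‖x - y‖) ?_
  · simpa using h1
  · intro s hs
    have hmem : ∀ t ∈ Set.Icc (0 : ℝ) 1, AffineMap.lineMap x y t ∈ segment ℝ x y := by
      intro t ht
      rw [segment_eq_image_lineMap]
      exact ⟨t, ht, rfl⟩
    have hc : ContinuousWithinAt (fun t : ℝ => (AffineMap.lineMap x y t : ℂ)) (Set.Icc 0 1) s :=
      (AffineMap.lineMap_continuous (R := ℝ)).continuousWithinAt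
    have ht := hc.tendsto_nhdsWithin (t := segment ℝ x y) hmem
    filter_upwards [ht.eventually (h _ (hmem s hs))] with t htt
    obtain ⟨i, a, ha, b, hb, h2, h3, h4⟩ := htt
    have h5 : ‖a - b‖ = |t - s| * ‖x - y‖ := by
      rw [h4, AffineMap.lineMap_apply, AffineMap.lineMap_apply]
      have : (s • (y -ᵥ x) +ᵥ x) - (t • (y -ᵥ x) +ᵥ x) = (t - s) • (x - y) := by
        simp only [vsub_eq_sub, vadd_eq_add, Complex.real_smul, Complex.ofReal_sub]
        ring
      rw [this, norm_smul, Real.norm_eq_abs]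
    rw [← h2, ← h3]
    refine ⟨by rw [← h5]; exact .single ha hb, ?_⟩
    rw [← h5, norm_sub_rev]
    exact .single hb ha

/-- Near a point in the interior of a piece which is not identified with any other point, the
length metric is the Euclidean metric. -/
theorem gluedDist_eq_of_ball {i : ι} {x : ℂ} {ρ : ℝ} (hb : Metric.ball x ρ ⊆ Δ i)
    (huniq : ∀ u ∈ Metric.ball x ρ, ∀ j, ∀ a ∈ Δ j, φ j a = φ i u → j = i ∧ a = u)
    {u v : ℂ} (hu : ‖u - x‖ < ρ / 3) (hv : ‖v - x‖ < ρ / 3) :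
    gluedDist Δ φ (φ i u) (φ i v) = ‖u - v‖ := by
  have hρ : 0 < ρ := by linarith [norm_nonneg (u - x)]
  have hvb : v ∈ Metric.ball x ρ := by rw [Metric.mem_ball, dist_eq_norm]; linarith
  have hub : u ∈ Metric.ball x ρ := by rw [Metric.mem_ball, dist_eq_norm]; linarith
  -- A chain too short to leave the ball lifts uniquely to the piece `Δ i`, where the triangle
  -- inequality applies.
  have key : ∀ p q L, IsChainLength Δ φ p q L → ∀ u, p = φ i u → q = φ i v →
      ‖u - x‖ + L < ρ → ‖u - v‖ ≤ L := by
    intro p q L h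
    induction h with
    | refl p =>
      intro u hu hv hL
      have := huniq v hvb i u (hb (by rw [Metric.mem_ball, dist_eq_norm]; linarith))
        (hu.symm.trans hv)
      simp [this.2]
    | cons j a b q L ha hbj h ih =>
      intro u hu hv hL
      have hLn := h.nonneg
      have h1 := norm_nonneg (a - b)
      obtain ⟨rfl, rfl⟩ := huniq u (by rw [Metric.mem_ball, dist_eq_norm]; linarith) j a ha hu
      have h2 : ‖b - x‖ ≤ ‖a - b‖ + ‖a - x‖ := by
        calc ‖b - x‖ = ‖(a - x) - (a - b)‖ := by congr 1; ring
          _ ≤ ‖a - x‖ + ‖a - b‖ := norm_sub_le _ _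
          _ = _ := add_comm _ _
      have h3 := ih b rfl hv (by linarith)
      calc ‖a - v‖ = ‖(a - b) + (b - v)‖ := by congr 1; ring
        _ ≤ ‖a - b‖ + ‖b - v‖ := norm_add_le _ _
        _ ≤ _ := by linarith
  refine le_antisymm (gluedDist_le (.single (hb hub) (hb hvb)))
    (le_gluedDist (.single (hb hub) (hb hvb)) fun M hM => ?_)
  by_cases hMρ : ‖u - x‖ + M < ρ
  · exact key _ _ M hM u rfl rfl hMρ
  -- A longer chain has length at least `ρ - ‖u - x‖ > 2ρ / 3`, while `‖u - v‖ < 2ρ / 3`; this is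
  -- the reason for the factor `3`.
  · have : ‖u - v‖ ≤ ‖u - x‖ + ‖v - x‖ := by
      calc ‖u - v‖ = ‖(u - x) - (v - x)‖ := by congr 1; ring
        _ ≤ _ := norm_sub_le _ _
    linarith

/-- The length metric in terms of a developing map of the pieces. -/
theorem isLeast_gluedDist [TopologicalSpace S] [T1Space S] {E : ℂ → S} (hE : Continuous E)
    (hlift : ∀ i, ∃ a b : ℂ, ‖a‖ = 1 ∧ ∀ v ∈ Δ i, φ i v = E (a * v + b))
    (hdeck : ∀ z w, E z = E w → ∃ a : ℂ, ‖a‖ = 1 ∧ ∀ v, E (w + a * (v - z)) = E v)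
    (hloc : ∀ w, ∀ᶠ u in 𝓝 w, ∃ i, ∃ a ∈ Δ i, ∃ b ∈ Δ i,
      φ i a = E w ∧ φ i b = E u ∧ ‖a - b‖ = ‖w - u‖) (x y : ℂ) :
    IsLeast {d | ∃ y', E y' = E y ∧ d = ‖x - y'‖} (gluedDist Δ φ (E x) (E y)) := by
  have hchain : ∀ y', E y' = E y → IsChainLength Δ φ (E x) (E y) ‖x - y'‖ := by
    intro y' hy'
    rw [← hy']
    exact isChainLength_of_locally_segment fun w _ => nhdsWithin_le_nhds (hloc w)
  -- Chains lift step by step: a deck transformation moves each developed segment so that it begins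
  -- at the current lift. The lifted polygon is at least as long as the distance of its ends.
  have hlift' : ∀ p q L, IsChainLength Δ φ p q L → ∀ x, p = E x → ∃ y', E y' = q ∧ ‖x - y'‖ ≤ L := by
    intro p q L h
    induction h with
    | refl p => exact fun x hx => ⟨x, hx.symm, by simp⟩
    | cons i a b q L ha hb h ih =>
      intro x hx
      obtain ⟨c, d, hc, h1⟩ := hlift i
      rw [h1 a ha] at hx
      obtain ⟨e, he, h2⟩ := hdeck _ _ hx
      obtain ⟨y', hy', h3⟩ := ih (x + e * (c * b + d - (c * a + d))) (by rw [h2, h1 b hb])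
      refine ⟨y', hy', ?_⟩
      calc ‖x - y'‖ = ‖e * c * (a - b) + (x + e * (c * b + d - (c * a + d)) - y')‖ := by
            congr 1; ring
        _ ≤ ‖e * c * (a - b)‖ + ‖x + e * (c * b + d - (c * a + d)) - y'‖ := norm_add_le _ _
        _ ≤ _ := by rw [norm_mul, norm_mul, he, hc, one_mul, one_mul]; linarith
  -- The fibre is closed in the plane, so a nearest lift exists and the infimum is attained.
  have hfc : IsClosed (E ⁻¹' {E y}) := isClosed_singleton.preimage hE
  obtain ⟨y₀, hy₀, hmin⟩ := hfc.exists_infDist_eq_dist ⟨y, rfl⟩ x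
  have hle : ∀ y', E y' = E y → ‖x - y₀‖ ≤ ‖x - y'‖ := by
    intro y' hy'
    rw [← dist_eq_norm, ← hmin, ← dist_eq_norm]
    exact Metric.infDist_le_dist_of_mem hy'
  have heq : gluedDist Δ φ (E x) (E y) = ‖x - y₀‖ := by
    refine le_antisymm (gluedDist_le (hchain y₀ hy₀)) (le_gluedDist (hchain y₀ hy₀) ?_)
    intro M hM
    obtain ⟨y', hy', h⟩ := hlift' _ _ M hM x rfl
    exact (hle y' hy').trans h
  refine ⟨⟨y₀, hy₀, heq⟩, ?_⟩
  rintro _ ⟨y', hy', rfl⟩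
  rw [heq]
  exact hle y' hy'

end Chains

/-! ### Cyclic arithmetic of the vertices of a triangle -/

theorem fin3_add_one_ne : ∀ k : Fin 3, k + 1 ≠ k := by decide

theorem fin3_add_two_ne : ∀ k : Fin 3, k + 2 ≠ k := by decide

theorem fin3_add_one_ne_add_two : ∀ k : Fin 3, k + 1 ≠ k + 2 := by decide

theorem fin3_add_one_add_one : ∀ k : Fin 3, k + 1 + 1 = k + 2 := by decide

theorem fin3_add_one_add_two : ∀ k : Fin 3, k + 1 + 2 = k := by decide

theorem fin3_add_two_add_one : ∀ k : Fin 3, k + 2 + 1 = k := by decide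

theorem fin3_add_two_add_two : ∀ k : Fin 3, k + 2 + 2 = k + 1 := by decide

theorem fin3_cases : ∀ k m : Fin 3, m = k ∨ m = k + 1 ∨ m = k + 2 := by decide

theorem fin3_exists_third : ∀ k j : Fin 3, j ≠ k →
    ∃ l, l ≠ k ∧ l ≠ j ∧ ∀ m, m = k ∨ m = j ∨ m = l := by decide

theorem fin3_eq_add_one_or : ∀ l m : Fin 3, l ≠ m → m = l + 1 ∨ l = m + 1 := by decide

theorem fin3_swap : ∀ i j : Fin 3, i = j + 1 → i + 1 = j → False := by decide

/-! ### Barycentric coordinates in plane triangles -/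

/-- Twice the signed area of the triangle with vertices `0, a, b`. -/
def cross (a b : ℂ) : ℝ := a.re * b.im - a.im * b.re

/-- Twice the signed area of a triangle. -/
def area2 (v : Fin 3 → ℂ) : ℝ := cross (v 1 - v 0) (v 2 - v 0)

/-- The barycentric coordinates of a point with respect to a triangle. -/
def bary (v : Fin 3 → ℂ) (i : Fin 3) (x : ℂ) : ℝ :=
  cross (v (i + 1) - x) (v (i + 2) - x) / area2 v

theorem area2_pos_iff {v : Fin 3 → ℂ} : ![v 1 - v 0, v 2 - v 0] ∈ Hplus ↔ 0 < area2 v := by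
  rw [mem_Hplus_iff]; rfl

theorem area2_eq (v : Fin 3 → ℂ) (i : Fin 3) :
    area2 v = cross (v (i + 1) - v i) (v (i + 2) - v i) := by
  fin_cases i <;> simp [area2, cross] <;> ring

section Triangle

variable {v : Fin 3 → ℂ}

theorem sum_bary (hv : area2 v ≠ 0) (x : ℂ) : ∑ i, bary v i x = 1 := by
  rw [Fin.sum_univ_three]
  simp only [bary]
  rw [← add_div, ← add_div, div_eq_one_iff_eq hv]
  simp [area2, cross]
  ring

theorem sum_bary' (hv : area2 v ≠ 0) (i : Fin 3) (x : ℂ) :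
    bary v i x + bary v (i + 1) x + bary v (i + 2) x = 1 := by
  have := sum_bary hv x
  rw [Fin.sum_univ_three] at this
  fin_cases i <;> simp <;> linarith

theorem sum_bary_smul (hv : area2 v ≠ 0) (x : ℂ) : ∑ i, bary v i x • v i = x := by
  rw [Fin.sum_univ_three]
  simp only [bary]
  apply Complex.ext
  · simp only [Complex.add_re, Complex.smul_re, smul_eq_mul]
    field_simp
    simp [area2, cross]
    ring
  · simp only [Complex.add_im, Complex.smul_im, smul_eq_mul]
    field_simp
    simp [area2, cross]
    ring

theorem eq_of_bary_eq (hv : area2 v ≠ 0) {x y : ℂ} (h : ∀ i, bary v i x = bary v i y) : x = y := by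
  rw [← sum_bary_smul hv x, ← sum_bary_smul hv y]
  simp_rw [h]

/-- Barycentric coordinates are affine. -/
theorem bary_combo (i : Fin 3) (x y : ℂ) (s t : ℝ) (h : s + t = 1) :
    bary v i (s • x + t • y) = s * bary v i x + t * bary v i y := by
  simp only [bary]
  rw [← mul_div_assoc, ← mul_div_assoc, ← add_div]
  congr 1
  obtain rfl : s = 1 - t := by linarith
  simp [cross]
  ring

theorem bary_self (hv : area2 v ≠ 0) (i : Fin 3) : bary v i (v i) = 1 := by
  rw [bary, ← area2_eq v i, div_self hv]

theorem bary_of_ne {i j : Fin 3} (h : j ≠ i) : bary v i (v j) = 0 := by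
  have : j = i + 1 ∨ j = i + 2 := by
    fin_cases i <;> fin_cases j <;> simp_all
  rcases this with rfl | rfl <;> simp [bary, cross]

theorem vertex_injective (hv : area2 v ≠ 0) : Function.Injective v := by
  intro i j h
  by_contra hij
  have h1 := bary_self hv i
  rw [h, bary_of_ne (Ne.symm hij)] at h1
  exact zero_ne_one h1

theorem continuous_bary (i : Fin 3) : Continuous (bary v i) := by
  unfold bary cross
  fun_prop

/-- The face of a triangle spanned by a set of vertices. -/
theorem mem_face_iff (hv : area2 v ≠ 0) (I : Finset (Fin 3)) {x : ℂ} :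
    x ∈ convexHull ℝ (v '' I) ↔ ∀ i, 0 ≤ bary v i x ∧ (i ∉ I → bary v i x = 0) := by
  constructor
  · intro hx
    have hc : Convex ℝ {x | ∀ i, 0 ≤ bary v i x ∧ (i ∉ I → bary v i x = 0)} := by
      intro a ha b hb s t hs ht hst i
      rw [bary_combo i a b s t hst]
      have h1 := ha i
      have h2 := hb i
      exact ⟨add_nonneg (mul_nonneg hs h1.1) (mul_nonneg ht h2.1),
        fun hi => by rw [h1.2 hi, h2.2 hi]; simp⟩
    refine convexHull_min ?_ hc hx
    rintro _ ⟨j, hj, rfl⟩ i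
    by_cases hij : j = i
    · subst hij
      rw [bary_self hv]
      exact ⟨zero_le_one, fun h => absurd hj h⟩
    · rw [bary_of_ne hij]
      exact ⟨le_rfl, fun _ => rfl⟩
  · intro h
    rw [← sum_bary_smul hv x]
    have h1 : ∑ i ∈ I, bary v i x • v i = ∑ i, bary v i x • v i :=
      Finset.sum_subset (Finset.subset_univ I) fun i _ hi => by rw [(h i).2 hi, zero_smul]
    have h2 : ∑ i ∈ I, bary v i x = 1 := by
      rw [← sum_bary hv x]
      exact Finset.sum_subset (Finset.subset_univ I) fun i _ hi => (h i).2 hi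
    rw [← h1]
    exact (convex_convexHull ℝ _).sum_mem (fun i _ => (h i).1) h2
      fun i hi => subset_convexHull ℝ _ ⟨i, hi, rfl⟩

theorem mem_triangle_iff (hv : area2 v ≠ 0) {x : ℂ} : x ∈ triangle v ↔ ∀ i, 0 ≤ bary v i x := by
  have := mem_face_iff hv Finset.univ (x := x)
  simpa [triangle] using this

theorem vertex_mem_triangle (i : Fin 3) : v i ∈ triangle v := subset_convexHull ℝ _ ⟨i, rfl⟩

theorem isCompact_triangle : IsCompact (triangle v) := (Set.finite_range v).isCompact_convexHull ℝ

theorem convex_triangle : Convex ℝ (triangle v) := convex_convexHull ℝ _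

theorem mem_interior_triangle_iff (hv : area2 v ≠ 0) {x : ℂ} :
    x ∈ interior (triangle v) ↔ ∀ i, 0 < bary v i x := by
  constructor
  · intro hx i
    have h1 := (mem_triangle_iff hv).1 (interior_subset hx) i
    refine lt_of_le_of_ne h1 fun h0 => ?_
    have ht : Filter.Tendsto (fun t : ℝ => (1 + t) • x + (-t) • v i) (𝓝[>] 0) (𝓝 x) := by
      have : ContinuousAt (fun t : ℝ => (1 + t) • x + (-t) • v i) 0 := by fun_prop
      have h2 := this.tendsto
      simp only [add_zero, one_smul, neg_zero, zero_smul] at h2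
      exact h2.mono_left nhdsWithin_le_nhds
    have h2 : ∀ᶠ t : ℝ in 𝓝[>] 0, (1 + t) • x + (-t) • v i ∈ triangle v :=
      ht.eventually (mem_interior_iff_mem_nhds.1 hx)
    obtain ⟨t, h3, h4⟩ := (h2.and self_mem_nhdsWithin).exists
    have h5 := (mem_triangle_iff hv).1 h3 i
    rw [bary_combo i _ _ _ _ (by ring), bary_self hv, ← h0] at h5
    have h6 : 0 < t := h4
    linarith
  · intro h
    have ho : IsOpen {x | ∀ i, 0 < bary v i x} := by
      simp only [Set.ofPred_forall]
      exact isOpen_iInter_of_finite fun i => isOpen_lt continuous_const (continuous_bary i)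
    exact mem_interior.2 ⟨_, fun y hy => (mem_triangle_iff hv).2 fun i => (hy i).le, ho, h⟩

theorem closure_interior_triangle (hv : area2 v ≠ 0) : triangle v ⊆ closure (interior (triangle v)) := by
  have hne : (interior (triangle v)).Nonempty := by
    refine ⟨(3 : ℝ)⁻¹ • v 0 + (2 / 3 : ℝ) • ((2 : ℝ)⁻¹ • v 1 + (2 : ℝ)⁻¹ • v 2), ?_⟩
    rw [mem_interior_triangle_iff hv]
    intro i
    rw [bary_combo i _ _ _ _ (by norm_num), bary_combo i _ _ _ _ (by norm_num)]
    fin_cases i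
    · rw [Fin.zero_eta, bary_self hv, bary_of_ne (by decide), bary_of_ne (by decide)]; norm_num
    · rw [Fin.mk_one, bary_self hv, bary_of_ne (by decide), bary_of_ne (by decide)]; norm_num
    · rw [show (⟨2, by decide⟩ : Fin 3) = 2 from rfl, bary_self hv, bary_of_ne (by decide), bary_of_ne (by decide)]; norm_num
  exact (convex_triangle.closure_interior_eq_closure_of_nonempty_interior hne).symm ▸ subset_closure

/-- The two edge vectors at a vertex. -/
theorem sub_eq_bary (hv : area2 v ≠ 0) (i : Fin 3) (x : ℂ) :
    x - v i = bary v (i + 1) x • (v (i + 1) - v i) + bary v (i + 2) x • (v (i + 2) - v i) := by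
  have h1 := sum_bary_smul hv x
  have h2 := sum_bary' hv i x
  have h3 : ∑ j, bary v j x • v j
      = bary v i x • v i + bary v (i + 1) x • v (i + 1) + bary v (i + 2) x • v (i + 2) := by
    rw [Fin.sum_univ_three]
    fin_cases i <;> simp <;> ring
  rw [h3] at h1
  have h4 : bary v i x = 1 - bary v (i + 1) x - bary v (i + 2) x := by linarith
  rw [h4] at h1
  nth_rewrite 1 [← h1]
  simp only [smul_sub, sub_smul, one_smul]
  ring

theorem bary_add_combo (hv : area2 v ≠ 0) (i : Fin 3) (s t : ℝ) :
    bary v (i + 1) (v i + s • (v (i + 1) - v i) + t • (v (i + 2) - v i)) = s ∧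
    bary v (i + 2) (v i + s • (v (i + 1) - v i) + t • (v (i + 2) - v i)) = t ∧
    bary v i (v i + s • (v (i + 1) - v i) + t • (v (i + 2) - v i)) = 1 - s - t := by
  refine ⟨?_, ?_, ?_⟩ <;> rw [bary, div_eq_iff hv, area2_eq v i] <;> fin_cases i <;>
    simp [cross] <;> ring

end Triangle

/-! ### Combinatorics of flat triangulations -/

namespace FlatSphere

variable (T : FlatSphere)

theorem area2_pos (α : Fin T.n) : 0 < area2 (T.vert α) := area2_pos_iff.1 (T.pos α)

theorem area2_ne (α : Fin T.n) : area2 (T.vert α) ≠ 0 := (T.area2_pos α).ne'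

theorem mem_tri_iff {α : Fin T.n} {x : ℂ} : x ∈ T.tri α ↔ ∀ i, 0 ≤ bary (T.vert α) i x :=
  mem_triangle_iff (T.area2_ne α)

theorem vert_mem (α : Fin T.n) (i : Fin 3) : T.vert α i ∈ T.tri α := vertex_mem_triangle i

theorem isCompact_tri (α : Fin T.n) : IsCompact (T.tri α) := isCompact_triangle

theorem exists_param_eq (p : Sphere2) : ∃ α, ∃ x ∈ T.tri α, T.param α x = p := by
  have : p ∈ ⋃ α, T.param α '' triangle (T.vert α) := T.cover ▸ Set.mem_univ p
  obtain ⟨α, x, hx, h⟩ := Set.mem_iUnion.1 this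
  exact ⟨α, x, hx, h⟩

theorem mem_face_iff {α : Fin T.n} (I : Finset (Fin 3)) {x : ℂ} :
    x ∈ convexHull ℝ (T.vert α '' I) ↔
      ∀ i, 0 ≤ bary (T.vert α) i x ∧ (i ∉ I → bary (T.vert α) i x = 0) :=
  _root_.mem_face_iff (T.area2_ne α) I

/-- The intersection of two distinct triangles in coordinates. -/
theorem exists_faces {α β : Fin T.n} (h : α ≠ β) : ∃ I J : Finset (Fin 3), I.card ≤ 2 ∧ J.card ≤ 2 ∧
    (∀ x ∈ T.tri α, (∃ y ∈ T.tri β, T.param α x = T.param β y) ↔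
      ∀ i, i ∉ I → bary (T.vert α) i x = 0) ∧
    (∀ y ∈ T.tri β, (∃ x ∈ T.tri α, T.param α x = T.param β y) ↔
      ∀ j, j ∉ J → bary (T.vert β) j y = 0) := by
  obtain ⟨I, J, hI, hJ, h1, h2⟩ := T.inter α β h
  have hsubI : convexHull ℝ (T.vert α '' I) ⊆ T.tri α := fun x hx =>
    T.mem_tri_iff.2 fun i => ((T.mem_face_iff I).1 hx i).1
  have hsubJ : convexHull ℝ (T.vert β '' J) ⊆ T.tri β := fun x hx =>
    T.mem_tri_iff.2 fun i => ((T.mem_face_iff J).1 hx i).1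
  refine ⟨I, J, hI, hJ, fun x hx => ⟨?_, fun hx' => ?_⟩, fun y hy => ⟨?_, fun hy' => ?_⟩⟩
  · rintro ⟨y, hy, hxy⟩
    have h3 : T.param α x ∈ T.param α '' triangle (T.vert α) ∩ T.param β '' triangle (T.vert β) :=
      ⟨⟨x, hx, rfl⟩, ⟨y, hy, hxy.symm⟩⟩
    rw [h1] at h3
    obtain ⟨x', hx', h4⟩ := h3
    obtain rfl := T.injOn α (hsubI hx') hx h4
    exact fun i => ((T.mem_face_iff I).1 hx' i).2
  · have h3 : T.param α x ∈ T.param α '' convexHull ℝ (T.vert α '' I) :=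
      ⟨x, (T.mem_face_iff I).2 fun i => ⟨T.mem_tri_iff.1 hx i, hx' i⟩, rfl⟩
    rw [← h1] at h3
    obtain ⟨y, hy, h4⟩ := h3.2
    exact ⟨y, hy, h4.symm⟩
  · rintro ⟨x, hx, hxy⟩
    have h3 : T.param β y ∈ T.param α '' triangle (T.vert α) ∩ T.param β '' triangle (T.vert β) :=
      ⟨⟨x, hx, hxy⟩, ⟨y, hy, rfl⟩⟩
    rw [h2] at h3
    obtain ⟨y', hy', h4⟩ := h3
    obtain rfl := T.injOn β (hsubJ hy') hy h4
    exact fun i => ((T.mem_face_iff J).1 hy' i).2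
  · have h3 : T.param β y ∈ T.param β '' convexHull ℝ (T.vert β '' J) :=
      ⟨y, (T.mem_face_iff J).2 fun i => ⟨T.mem_tri_iff.1 hy i, hy' i⟩, rfl⟩
    rw [← h2] at h3
    obtain ⟨x, hx, h4⟩ := h3.1
    exact ⟨x, hx, h4⟩

variable {T}

/-- Interior points of a triangle lie on no other triangle. -/
theorem eq_of_param_eq_of_pos {α β : Fin T.n} {x y : ℂ} (hx : ∀ i, 0 < bary (T.vert α) i x)
    (hy : y ∈ T.tri β) (h : T.param α x = T.param β y) : β = α ∧ y = x := by
  have hxt : x ∈ T.tri α := T.mem_tri_iff.2 fun i => (hx i).le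
  by_cases hαβ : α = β
  · subst hαβ
    exact ⟨rfl, T.injOn α hy hxt h.symm⟩
  · obtain ⟨I, J, hI, -, h1, -⟩ := T.exists_faces hαβ
    have h2 := (h1 x hxt).1 ⟨y, hy, h⟩
    obtain ⟨i, hi⟩ : ∃ i, i ∉ I := by
      by_contra! hall
      have : I = Finset.univ := Finset.eq_univ_of_forall hall
      rw [this] at hI
      simp at hI
    exact absurd (h2 i hi) (hx i).ne'

theorem dist_eq_of_param_eq {α β : Fin T.n} {x y x' y' : ℂ} (hx : x ∈ T.tri α) (hx' : x' ∈ T.tri α)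
    (hy : y ∈ T.tri β) (hy' : y' ∈ T.tri β) (h : T.param α x = T.param β y)
    (h' : T.param α x' = T.param β y') : Dist.dist x x' = Dist.dist y y' := by
  obtain ⟨g, hg⟩ := T.compat α β
  rw [hg x hx y hy h, hg x' hx' y' hy' h', g.dist_eq]

/-- Vertices are identified with vertices only. -/
theorem exists_vert_eq {α β : Fin T.n} {i : Fin 3} {y : ℂ} (hy : y ∈ T.tri β)
    (h : T.param α (T.vert α i) = T.param β y) : ∃ j, T.vert β j = y := by
  by_cases hαβ : α = β
  · subst hαβ
    exact ⟨i, T.injOn α (T.vert_mem α i) hy h⟩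
  by_contra! hne
  obtain ⟨I, J, hI, hJ, h1, h2⟩ := T.exists_faces hαβ
  have hyJ := (h2 y hy).1 ⟨_, T.vert_mem α i, h⟩
  have hβ := T.area2_ne β
  have hα := T.area2_ne α
  -- the point lies on an edge
  obtain ⟨k, hk⟩ : ∃ k, k ∉ J := by
    by_contra! hall
    have : J = Finset.univ := Finset.eq_univ_of_forall hall
    rw [this] at hJ
    simp at hJ
  have hk0 := hyJ k hk
  have hsum := sum_bary' hβ k y
  -- Since `y` is not a vertex, coordinate `k` is the only one to vanish. Hence the shared face is
  -- the whole edge opposite to `k`, and both of its ends also lie in the triangle `α`.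
  have hpos : ∀ j, j ≠ k → bary (T.vert β) j y ≠ 0 := by
    intro j hj h0
    obtain ⟨l, hl1, hl2, hl3⟩ := fin3_exists_third k j hj
    refine hne l (eq_of_bary_eq hβ fun m => ?_)
    have hone : bary (T.vert β) l y = 1 := by
      have h3 := sum_bary hβ y
      have : ∑ m, bary (T.vert β) m y = bary (T.vert β) l y :=
        Finset.sum_eq_single l (fun m _ hm => by
          rcases hl3 m with rfl | rfl | rfl
          · exact hk0
          · exact h0
          · exact absurd rfl hm) (by simp)
      linarith
    rcases hl3 m with rfl | rfl | rfl
    · rw [hk0, bary_of_ne hl1]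
    · rw [h0, bary_of_ne hl2]
    · rw [hone, bary_self hβ]
  have hJ' : ∀ j, j ≠ k → j ∈ J := fun j hj => by
    by_contra hjJ
    exact hpos j hj (hyJ j hjJ)
  have hk1 := fin3_add_one_ne k
  have hk2 := fin3_add_two_ne k
  have hpre : ∀ j, j ≠ k → ∃ x ∈ T.tri α, T.param α x = T.param β (T.vert β j) := by
    intro j hj
    refine (h2 _ (T.vert_mem β j)).2 fun m hm => bary_of_ne ?_
    rintro rfl
    exact hm (hJ' _ hj)
  obtain ⟨x₁, hx₁, h3⟩ := hpre _ hk1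
  obtain ⟨x₂, hx₂, h4⟩ := hpre _ hk2
  have d12 := dist_eq_of_param_eq hx₁ hx₂ (T.vert_mem _ _) (T.vert_mem _ _) h3 h4
  have d1 := dist_eq_of_param_eq hx₁ (T.vert_mem α i) (T.vert_mem _ _) hy h3 h
  have d2 := dist_eq_of_param_eq (T.vert_mem α i) hx₂ hy (T.vert_mem _ _) h h4
  set s := bary (T.vert β) (k + 1) y with hs
  set t := bary (T.vert β) (k + 2) y with ht
  have hst : s + t = 1 := by linarith
  have hy2 : y = AffineMap.lineMap (T.vert β (k + 1)) (T.vert β (k + 2)) t := by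
    have h5 := sub_eq_bary hβ (k + 1) y
    rw [fin3_add_one_add_one, fin3_add_one_add_two, hk0, zero_smul, add_zero, ← ht] at h5
    rw [AffineMap.lineMap_apply, vsub_eq_sub, vadd_eq_add, ← h5]
    ring
  have ht0 : 0 < t := lt_of_le_of_ne (T.mem_tri_iff.1 hy _) (hpos _ hk2).symm
  have hs0 : 0 < s := lt_of_le_of_ne (T.mem_tri_iff.1 hy _) (hpos _ hk1).symm
  -- Distances are preserved on the overlap, so the vertex of `α` divides the segment `x₁ x₂`
  -- exactly as `y` divides the edge of `β`.
  have hv : T.vert α i = AffineMap.lineMap x₁ x₂ t := by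
    refine eq_lineMap_of_dist_eq_mul_of_dist_eq_mul ?_ ?_
    · rw [d1, d12, hy2, dist_left_lineMap, Real.norm_of_nonneg ht0.le]
    · rw [d2, d12, hy2, dist_lineMap_right, Real.norm_of_nonneg (by linarith)]
  have hb := bary_self hα i
  have hlm : AffineMap.lineMap x₁ x₂ t = s • x₁ + t • x₂ := by
    rw [AffineMap.lineMap_apply_module, show 1 - t = s by linarith]
  rw [hv, hlm, bary_combo i _ _ _ _ hst] at hb
  have hle : ∀ x ∈ T.tri α, bary (T.vert α) i x ≤ 1 := by
    intro x hx
    have h5 := sum_bary' hα i x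
    have h6 := T.mem_tri_iff.1 hx
    linarith [h6 (i + 1), h6 (i + 2)]
  -- A vertex is an extreme point: its own coordinate, equal to `1`, is a proper convex combination
  -- of two numbers at most `1`. So `x₁` and `x₂` are both this vertex, although they come from
  -- different vertices of `β`.
  have e1 : bary (T.vert α) i x₁ = 1 := by nlinarith [hle x₁ hx₁, hle x₂ hx₂]
  have e2 : bary (T.vert α) i x₂ = 1 := by nlinarith [hle x₁ hx₁, hle x₂ hx₂]
  have hvert : ∀ x ∈ T.tri α, bary (T.vert α) i x = 1 → x = T.vert α i := by
    intro x hx h1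
    have h5 := sum_bary' hα i x
    have h6 := T.mem_tri_iff.1 hx
    have h7 := sub_eq_bary hα i x
    rw [show bary (T.vert α) (i + 1) x = 0 by linarith [h6 (i + 1), h6 (i + 2)],
      show bary (T.vert α) (i + 2) x = 0 by linarith [h6 (i + 1), h6 (i + 2)]] at h7
    simpa [sub_eq_zero] using h7
  rw [hvert x₁ hx₁ e1, hvert x₂ hx₂ e2, dist_self] at d12
  exact fin3_add_one_ne_add_two k (vertex_injective hβ (dist_eq_zero.1 d12.symm))

/-- A triangle which contains an inner point of an edge shares this edge. -/
theorem exists_opposite_edge {α β : Fin T.n} (hαβ : α ≠ β) {i : Fin 3} {x y : ℂ}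
    (hx : x ∈ T.tri α) (hi : 0 < bary (T.vert α) i x) (hi1 : 0 < bary (T.vert α) (i + 1) x)
    (hy : y ∈ T.tri β) (h : T.param α x = T.param β y) :
    ∃ j, T.param α (T.vert α i) = T.param β (T.vert β (j + 1)) ∧
      T.param α (T.vert α (i + 1)) = T.param β (T.vert β j) := by
  obtain ⟨I, J, hI, hJ, h1, h2⟩ := T.exists_faces hαβ
  have hxI := (h1 x hx).1 ⟨y, hy, h⟩
  have hiI : i ∈ I := by
    by_contra hiI
    exact hi.ne' (hxI i hiI)
  have hiI1 : i + 1 ∈ I := by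
    by_contra hiI
    exact hi1.ne' (hxI (i + 1) hiI)
  have hpre : ∀ j ∈ I, ∃ l, T.param α (T.vert α j) = T.param β (T.vert β l) := by
    intro j hj
    obtain ⟨y', hy', h3⟩ := (h1 _ (T.vert_mem α j)).2 fun m hm => bary_of_ne (by
      rintro rfl
      exact hm hj)
    obtain ⟨l, rfl⟩ := exists_vert_eq hy' h3
    exact ⟨l, h3⟩
  obtain ⟨l, hl⟩ := hpre i hiI
  obtain ⟨m, hm⟩ := hpre (i + 1) hiI1
  have hlm : l ≠ m := by
    rintro rfl
    have := vertex_injective (T.area2_ne α)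
      (T.injOn α (T.vert_mem α _) (T.vert_mem α _) (hl.trans hm.symm))
    exact fin3_add_one_ne i this.symm
  -- Coherence of the orientation excludes that both triangles run through the edge in the same
  -- direction.
  rcases fin3_eq_add_one_or l m hlm with rfl | rfl
  · exact absurd (T.coherent α β i l hl hm) hαβ
  · exact ⟨m, hl, hm⟩

theorem ne_of_opposite {α β : Fin T.n} {i j : Fin 3}
    (h : T.param α (T.vert α i) = T.param β (T.vert β (j + 1)))
    (h' : T.param α (T.vert α (i + 1)) = T.param β (T.vert β j)) : α ≠ β := by
  rintro rfl
  have h1 := vertex_injective (T.area2_ne α) (T.injOn α (T.vert_mem α _) (T.vert_mem α _) h)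
  have h2 := vertex_injective (T.area2_ne α) (T.injOn α (T.vert_mem α _) (T.vert_mem α _) h')
  exact fin3_swap i j h1 h2

/-- The two sides of an edge are identified by an affine map. -/
theorem param_edge_eq {α β : Fin T.n} {i j : Fin 3}
    (h : T.param α (T.vert α i) = T.param β (T.vert β (j + 1)))
    (h' : T.param α (T.vert α (i + 1)) = T.param β (T.vert β j)) {t : ℝ} (ht : t ∈ Set.Icc (0 : ℝ) 1) :
    T.param α (AffineMap.lineMap (T.vert α i) (T.vert α (i + 1)) t)
      = T.param β (AffineMap.lineMap (T.vert β (j + 1)) (T.vert β j) t) := by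
  have hαβ := ne_of_opposite h h'
  obtain ⟨I, J, hI, hJ, h1, h2⟩ := T.exists_faces hαβ
  have hiI := (h1 _ (T.vert_mem α i)).1 ⟨_, T.vert_mem β _, h⟩
  have hiI1 := (h1 _ (T.vert_mem α (i + 1))).1 ⟨_, T.vert_mem β _, h'⟩
  set x := AffineMap.lineMap (T.vert α i) (T.vert α (i + 1)) t with hx
  have hlm : x = (1 - t) • T.vert α i + t • T.vert α (i + 1) := AffineMap.lineMap_apply_module _ _ _
  have hxt : x ∈ T.tri α := by
    rw [hlm]
    exact convex_triangle (T.vert_mem α i) (T.vert_mem α (i + 1)) (by linarith [ht.2]) ht.1 (by ring)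
  obtain ⟨y, hy, hxy⟩ := (h1 x hxt).2 fun m hm => by
    rw [hlm, bary_combo m _ _ _ _ (by ring), hiI m hm, hiI1 m hm]
    simp
  rw [hxy]
  congr 1
  -- A point whose distances from the two ends add up to the length of the edge is determined by
  -- these distances.
  have d12 := dist_eq_of_param_eq (T.vert_mem _ _) (T.vert_mem _ _) (T.vert_mem _ _)
    (T.vert_mem _ _) h h'
  have d1 := dist_eq_of_param_eq (T.vert_mem _ _) hxt (T.vert_mem _ _) hy h hxy
  have d2 := dist_eq_of_param_eq hxt (T.vert_mem _ _) hy (T.vert_mem _ _) hxy h'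
  refine eq_lineMap_of_dist_eq_mul_of_dist_eq_mul ?_ ?_
  · rw [← d1, ← d12, hx, dist_left_lineMap, Real.norm_of_nonneg ht.1]
  · rw [← d2, ← d12, hx, dist_lineMap_right, Real.norm_of_nonneg (by linarith [ht.2])]

end FlatSphere

/-! ### Fans of sectors around a point -/

/-- The unit complex number with argument `t`. -/
def cis (t : ℝ) : ℂ := Complex.exp (t * Complex.I)

theorem norm_cis (t : ℝ) : ‖cis t‖ = 1 := Complex.norm_exp_ofReal_mul_I t

theorem cis_ne_zero (t : ℝ) : cis t ≠ 0 := Complex.exp_ne_zero _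

theorem cis_add (s t : ℝ) : cis (s + t) = cis s * cis t := by
  simp [cis, add_mul, Complex.exp_add]

theorem cis_zero : cis 0 = 1 := by simp [cis]

theorem cis_pi : cis Real.pi = -1 := by simp [cis, Complex.exp_pi_mul_I]

theorem cis_two_pi : cis (2 * Real.pi) = 1 := by
  rw [two_mul, cis_add, cis_pi]; norm_num

theorem cis_sub (s t : ℝ) : cis (s - t) = cis s * (cis t)⁻¹ := by
  rw [eq_mul_inv_iff_mul_eq₀ (cis_ne_zero t), ← cis_add, sub_add_cancel]

theorem cis_re (t : ℝ) : (cis t).re = Real.cos t := Complex.exp_ofReal_mul_I_re t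

theorem cis_im (t : ℝ) : (cis t).im = Real.sin t := Complex.exp_ofReal_mul_I_im t

/-- The argument of a complex number in `[0, 2π)`. -/
def arg2 (u : ℂ) : ℝ := if 0 ≤ u.arg then u.arg else u.arg + 2 * Real.pi

theorem arg2_nonneg (u : ℂ) : 0 ≤ arg2 u := by
  unfold arg2
  split_ifs with h
  · exact h
  · linarith [Complex.neg_pi_lt_arg u, Real.pi_pos]

theorem arg2_lt (u : ℂ) : arg2 u < 2 * Real.pi := by
  unfold arg2
  split_ifs with h
  · linarith [Complex.arg_le_pi u, Real.pi_pos]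
  · linarith

theorem norm_mul_cis_arg2 (u : ℂ) : ‖u‖ * cis (arg2 u) = u := by
  have h := Complex.norm_mul_exp_arg_mul_I u
  unfold arg2
  split_ifs
  · exact h
  · rw [cis_add, cis_two_pi, mul_one]
    exact h

namespace FlatSphere

/-- A cyclically ordered family of sectors around a point with total angle `Θ`, which parametrizes
a neighbourhood of this point. -/
structure Fan (T : FlatSphere) (p : Sphere2) (Θ : ℝ) where
  k : ℕ
  pos : 0 < k
  τ : ℕ → Fin T.n
  x : ℕ → ℂ
  d : ℕ → ℂ
  θ : ℕ → ℝ
  ρ : ℝ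
  ρ_pos : 0 < ρ
  period : ∀ j, τ (j + k) = τ j ∧ x (j + k) = x j ∧ d (j + k) = d j ∧ θ (j + k) = θ j
  θ_pos : ∀ j, 0 < θ j
  sum : ∑ j ∈ Finset.range k, θ j = Θ
  unit : ∀ j, ‖d j‖ = 1
  base_mem : ∀ j, x j ∈ T.tri (τ j)
  base : ∀ j, T.param (τ j) (x j) = p
  inside : ∀ j r ψ, 0 ≤ r → r < ρ → 0 ≤ ψ → ψ ≤ θ j → x j + r * d j * cis ψ ∈ T.tri (τ j)
  sector : ∀ j, ∀ y ∈ T.tri (τ j), ∃ r ψ : ℝ, 0 ≤ r ∧ 0 ≤ ψ ∧ ψ ≤ θ j ∧ y = x j + r * d j * cis ψ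
  glue : ∀ j r, 0 ≤ r → r < ρ → T.param (τ j) (x j + r * d j * cis (θ j))
    = T.param (τ (j + 1)) (x (j + 1) + r * d (j + 1))
  disj : ∀ j l r s ψ χ, j < k → l < k → 0 < r → r < ρ → 0 < s → s < ρ → 0 ≤ ψ → ψ < θ j →
    0 ≤ χ → χ < θ l →
    T.param (τ j) (x j + r * d j * cis ψ) = T.param (τ l) (x l + s * d l * cis χ) → j = l
  complete : ∀ α, ∀ y ∈ T.tri α, T.param α y = p → ∃ j < k, τ j = α ∧ x j = y

namespace Fan

variable {T : FlatSphere} {p : Sphere2} {Θ : ℝ} (F : Fan T p Θ)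

/-- The angle at which a sector begins. -/
def start (j : ℕ) : ℝ := ∑ i ∈ Finset.range j, F.θ i

theorem start_succ (j : ℕ) : F.start (j + 1) = F.start j + F.θ j := Finset.sum_range_succ _ _

theorem start_zero : F.start 0 = 0 := Finset.sum_range_zero _

theorem start_strictMono : StrictMono F.start :=
  strictMono_nat_of_lt_succ fun j => by rw [start_succ]; linarith [F.θ_pos j]

theorem start_k : F.start F.k = Θ := F.sum

theorem start_add_k (j : ℕ) : F.start (j + F.k) = F.start j + Θ := by
  induction j with
  | zero => rw [zero_add, start_zero, start_k, zero_add]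
  | succ j ih => rw [add_right_comm, start_succ, ih, start_succ, (F.period j).2.2.2]; ring

theorem start_nonneg (j : ℕ) : 0 ≤ F.start j := by
  rw [← F.start_zero]
  exact F.start_strictMono.monotone (Nat.zero_le j)

theorem total_pos {T : FlatSphere} {p : Sphere2} {Θ : ℝ} (F : Fan T p Θ) : 0 < Θ := by
  rw [← F.start_k, ← F.start_zero]
  exact F.start_strictMono F.pos

/-- The sectors are indexed by all natural numbers, periodically, so the starting angles are
unbounded: the one with index `m * k` is `m Θ`. -/
theorem exists_index {φ : ℝ} (hφ : 0 ≤ φ) : ∃ j, F.start j ≤ φ ∧ φ < F.start (j + 1) := by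
  have hmul : ∀ m : ℕ, F.start (m * F.k) = m * Θ := by
    intro m
    induction m with
    | zero => simp [start_zero]
    | succ m ih => rw [add_mul, one_mul, start_add_k, ih]; push_cast; ring
  obtain ⟨m, hm⟩ := exists_nat_gt (φ / Θ)
  rw [div_lt_iff₀ F.total_pos] at hm
  have hex : ∃ j, φ < F.start (j + 1) := by
    refine ⟨m * F.k, ?_⟩
    rw [start_succ, hmul]
    linarith [F.θ_pos (m * F.k)]
  classical
  refine ⟨Nat.find hex, ?_, Nat.find_spec hex⟩
  rcases h : Nat.find hex with _ | j
  · rwa [start_zero]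
  · have := Nat.find_min hex (m := j) (by omega)
    exact not_lt.1 this

/-- The index of the sector which contains a given angle. -/
def index (φ : ℝ) : ℕ := if h : 0 ≤ φ then (F.exists_index h).choose else 0

theorem index_spec {φ : ℝ} (hφ : 0 ≤ φ) :
    F.start (F.index φ) ≤ φ ∧ φ < F.start (F.index φ + 1) := by
  unfold index
  rw [dif_pos hφ]
  exact (F.exists_index hφ).choose_spec

theorem index_eq {φ : ℝ} {j : ℕ} (h : F.start j ≤ φ) (h' : φ < F.start (j + 1)) :
    F.index φ = j := by
  have h1 := F.index_spec ((F.start_nonneg j).trans h)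
  have h2 := F.start_strictMono.lt_iff_lt.1 (h1.1.trans_lt h')
  have h3 := F.start_strictMono.lt_iff_lt.1 (h.trans_lt h1.2)
  omega

/-- Polar coordinates around the point. -/
def polar (r φ : ℝ) : Sphere2 :=
  T.param (F.τ (F.index φ))
    (F.x (F.index φ) + r * F.d (F.index φ) * cis (φ - F.start (F.index φ)))

/-- The closing ray of a sector is glued to the opening ray of the next one, so the formula for
sector `j` remains valid at its right end. -/
theorem polar_eq {r φ : ℝ} {j : ℕ} (hr : 0 ≤ r) (hr' : r < F.ρ) (h : F.start j ≤ φ)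
    (h' : φ ≤ F.start (j + 1)) :
    F.polar r φ = T.param (F.τ j) (F.x j + r * F.d j * cis (φ - F.start j)) := by
  rcases h'.lt_or_eq with h1 | rfl
  · rw [polar, F.index_eq h h1]
  · rw [polar, F.index_eq le_rfl (F.start_strictMono (Nat.lt_succ_self (j + 1)))]
    rw [sub_self, cis_zero, mul_one, ← F.glue j r hr hr', start_succ, add_sub_cancel_left]

theorem polar_add_total {r φ : ℝ} (hφ : 0 ≤ φ) (hr : 0 ≤ r) (hr' : r < F.ρ) :
    F.polar r (φ + Θ) = F.polar r φ := by
  have h := F.index_spec hφ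
  rw [F.polar_eq (j := F.index φ + F.k) hr hr' (by rw [start_add_k]; linarith)
    (by rw [add_right_comm, start_add_k]; linarith)]
  rw [polar, start_add_k, (F.period _).1, (F.period _).2.1, (F.period _).2.2.1,
    add_sub_add_right_eq_sub]

/-- The chart around the point. -/
def chart (u : ℂ) : Sphere2 := F.polar ‖u‖ (arg2 u)

theorem polar_zero (φ : ℝ) : F.polar 0 φ = p := by
  simp [polar, F.base]

/-- A full turn in the plane is one turn or two turns of the fan. This is where the cone angles are
restricted: it makes the polar coordinates descend to the plane. -/
theorem polar_add_two_pi (hΘ : Θ = Real.pi ∨ Θ = 2 * Real.pi) {r φ : ℝ} (hφ : 0 ≤ φ) (hr : 0 ≤ r) (hr' : r < F.ρ) :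
    F.polar r (φ + 2 * Real.pi) = F.polar r φ := by
  rcases hΘ with rfl | rfl
  · rw [two_mul, ← add_assoc, F.polar_add_total (by linarith [Real.pi_pos]) hr hr',
      F.polar_add_total hφ hr hr']
  · exact F.polar_add_total hφ hr hr'

theorem polar_add_nat_mul (hΘ : Θ = Real.pi ∨ Θ = 2 * Real.pi) {r φ : ℝ} (hφ : 0 ≤ φ) (hr : 0 ≤ r) (hr' : r < F.ρ) (m : ℕ) :
    F.polar r (φ + m * (2 * Real.pi)) = F.polar r φ := by
  induction m with
  | zero => simp
  | succ m ih =>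
    rw [Nat.cast_succ, add_mul, one_mul, ← add_assoc, F.polar_add_two_pi hΘ (by
      have := Real.pi_pos; positivity) hr hr', ih]

theorem chart_mul_cis (hΘ : Θ = Real.pi ∨ Θ = 2 * Real.pi) {r φ : ℝ} (hφ : 0 ≤ φ) (hr : 0 ≤ r) (hr' : r < F.ρ) :
    F.chart (r * cis φ) = F.polar r φ := by
  have hn : ‖(r : ℂ) * cis φ‖ = r := by
    rw [norm_mul, norm_cis, mul_one, Complex.norm_real, Real.norm_of_nonneg hr]
  rcases hr.eq_or_lt with rfl | hpos
  · rw [chart, hn, polar_zero, polar_zero]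
  have h1 := norm_mul_cis_arg2 (r * cis φ)
  rw [hn] at h1
  have h2 := mul_left_cancel₀ (by exact_mod_cast hpos.ne') h1
  rw [chart, hn]
  set χ := arg2 (r * cis φ) with hχ
  have h3 := arg2_nonneg (r * cis φ)
  have h4 := arg2_lt (r * cis φ)
  rw [← hχ] at h3 h4
  rw [cis, cis, Complex.exp_eq_exp_iff_exists_int] at h2
  obtain ⟨n, hn⟩ := h2
  have h5 : φ = χ + (-n : ℤ) * (2 * Real.pi) := by
    have := congrArg Complex.im hn
    have h6 : χ = φ + n * (2 * Real.pi) := by simpa using this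
    push_cast
    linarith
  have hpi := Real.pi_pos
  -- `χ < 2π` and `0 ≤ φ`, so `φ` arises from `χ` by adding a nonnegative number of full turns.
  have h6 : -1 < -n := by
    have : (-1 : ℝ) < (-n : ℤ) := by
      by_contra h
      nlinarith [not_lt.1 h]
    exact_mod_cast this
  obtain ⟨m, hm⟩ := Int.eq_ofNat_of_zero_le (show 0 ≤ -n by omega)
  rw [hm] at h5
  rw [h5, Int.cast_natCast, F.polar_add_nat_mul hΘ h3 hr hr']

/-- The rotation which maps directions at the point to directions in a sector. -/
theorem chart_eq_param (hΘ : Θ = Real.pi ∨ Θ = 2 * Real.pi) {j : ℕ} {u : ℂ} (hu : ‖u‖ < F.ρ)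
    (h : F.x j + F.d j * (cis (F.start j))⁻¹ * u ∈ T.tri (F.τ j)) :
    F.chart u = T.param (F.τ j) (F.x j + F.d j * (cis (F.start j))⁻¹ * u) := by
  obtain ⟨r, ψ, hr, hψ, hψ', heq⟩ := F.sector j _ h
  have hd0 : F.d j ≠ 0 := by
    intro h0
    have := F.unit j
    rw [h0] at this
    simp at this
  have h1 : u = r * cis (F.start j + ψ) := by
    have h2 := add_left_cancel heq
    rw [cis_add]
    have hc := cis_ne_zero (F.start j)
    field_simp at h2
    rw [h2]
    ring
  have hur : ‖u‖ = r := by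
    rw [h1, norm_mul, norm_cis, mul_one, Complex.norm_real, Real.norm_of_nonneg hr]
  rw [hur] at hu
  rw [heq, h1, F.chart_mul_cis hΘ (by linarith [F.start_nonneg j]) hr hu,
    F.polar_eq (j := j) hr hu (by linarith) (by rw [start_succ]; linarith), add_sub_cancel_left]

/-- The directions in `[0, 2π)` take at most two turns of the fan, hence the bound `k + k` on the
index. -/
theorem exists_sector (hΘ : Θ = Real.pi ∨ Θ = 2 * Real.pi) {u : ℂ} (hu : ‖u‖ < F.ρ) :
    ∃ j < F.k + F.k, F.x j + F.d j * (cis (F.start j))⁻¹ * u ∈ T.tri (F.τ j) := by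
  have h0 := arg2_nonneg u
  have h := F.index_spec h0
  refine ⟨F.index (arg2 u), ?_, ?_⟩
  · rw [← F.start_strictMono.lt_iff_lt, start_add_k, start_k]
    have := arg2_lt u
    rcases hΘ with rfl | rfl <;> linarith [Real.pi_pos]
  have h1 := F.inside (F.index (arg2 u)) ‖u‖ (arg2 u - F.start (F.index (arg2 u))) (norm_nonneg u) hu
    (by linarith) (by rw [start_succ] at h; linarith)
  convert h1 using 2
  rw [cis_sub]
  have h2 := norm_mul_cis_arg2 u
  linear_combination (-F.d (F.index (arg2 u)) * (cis (F.start (F.index (arg2 u))))⁻¹) * h2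

theorem chart_neg (hΘ : Θ = Real.pi ∨ Θ = 2 * Real.pi) (hΘ' : Θ = Real.pi) {u : ℂ} (hu : ‖u‖ < F.ρ) : F.chart (-u) = F.chart u := by
  have h0 := arg2_nonneg u
  have h1 : -u = ‖u‖ * cis (arg2 u + Real.pi) := by
    rw [cis_add, cis_pi, mul_neg_one, mul_neg, norm_mul_cis_arg2]
  rw [h1, F.chart_mul_cis hΘ (by linarith [Real.pi_pos]) (norm_nonneg u) hu, ← hΘ',
    F.polar_add_total h0 (norm_nonneg u) hu, chart]

/-- Within a single turn each direction belongs to exactly one half-open sector. By `disj` equal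
points lie in the same sector, where the coordinate map is injective; radius `0` is treated apart
because there the direction is lost. -/
theorem eq_of_polar_eq {r s φ χ : ℝ} (hr : 0 ≤ r) (hr' : r < F.ρ) (hs : 0 ≤ s) (hs' : s < F.ρ)
    (hφ : 0 ≤ φ) (hφ' : φ < Θ) (hχ : 0 ≤ χ) (hχ' : χ < Θ) (h : F.polar r φ = F.polar s χ) :
    (r : ℂ) * cis φ = s * cis χ := by
  have hin : ∀ {r φ : ℝ}, 0 ≤ r → r < F.ρ → 0 ≤ φ →
      F.x (F.index φ) + r * F.d (F.index φ) * cis (φ - F.start (F.index φ))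
        ∈ T.tri (F.τ (F.index φ)) := by
    intro r φ hr hr' hφ
    have h1 := F.index_spec hφ
    rw [start_succ] at h1
    exact F.inside _ _ _ hr hr' (by linarith) (by linarith)
  have hd0 : ∀ j, F.d j ≠ 0 := by
    intro j h0
    have := F.unit j
    rw [h0] at this
    simp at this
  have hzero : ∀ {r φ : ℝ}, 0 ≤ r → r < F.ρ → 0 ≤ φ → F.polar r φ = p → r = 0 := by
    intro r φ hr hr' hφ h
    replace h := h.trans (F.base (F.index φ)).symm
    have h1 := T.injOn _ (hin hr hr' hφ) (F.base_mem _) h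
    rw [add_eq_left] at h1
    rcases mul_eq_zero.1 h1 with h2 | h2
    · rcases mul_eq_zero.1 h2 with h3 | h3
      · exact_mod_cast h3
      · exact absurd h3 (hd0 _)
    · exact absurd h2 (cis_ne_zero _)
  rcases hr.eq_or_lt with rfl | hr0
  · rw [polar_zero] at h
    rw [hzero hs hs' hχ h.symm]
    simp
  rcases hs.eq_or_lt with rfl | hs0
  · rw [polar_zero] at h
    rw [hzero hr hr' hφ h]
    simp
  have i1 := F.index_spec hφ
  have i2 := F.index_spec hχ
  have l1 : F.index φ < F.k := by
    rw [← F.start_strictMono.lt_iff_lt, start_k]; linarith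
  have l2 : F.index χ < F.k := by
    rw [← F.start_strictMono.lt_iff_lt, start_k]; linarith
  have m1 := i1.2
  have m2 := i2.2
  rw [start_succ] at m1 m2
  have hidx := F.disj _ _ r s _ _ l1 l2 hr0 hr' hs0 hs' (by linarith [i1.1]) (by linarith)
    (by linarith [i2.1]) (by linarith) h
  have hin1 := hin hr hr' hφ
  have hin2 := hin hs hs' hχ
  rw [polar, polar, ← hidx] at h
  rw [← hidx] at hin2
  have h1 := add_left_cancel (T.injOn _ hin1 hin2 h)
  rw [cis_sub, cis_sub] at h1
  have hc := cis_ne_zero (F.start (F.index φ))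
  have hd := hd0 (F.index φ)
  field_simp at h1
  exact h1

/-- For `Θ = π` the argument is first brought into `[0, π)`, which may change the sign of the vector
and accounts for the second alternative. -/
theorem eq_or_eq_neg (hΘ : Θ = Real.pi ∨ Θ = 2 * Real.pi) {u v : ℂ} (hu : ‖u‖ < F.ρ) (hv : ‖v‖ < F.ρ) (h : F.chart u = F.chart v) :
    u = v ∨ (u = -v ∧ Θ = Real.pi) := by
  have hu2 := norm_mul_cis_arg2 u
  have hv2 := norm_mul_cis_arg2 v
  rcases hΘ with hpi | h2pi
  · have key : ∀ u : ℂ, ‖u‖ < F.ρ → ∃ φ, 0 ≤ φ ∧ φ < Real.pi ∧ F.chart u = F.polar ‖u‖ φ ∧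
        (u = ‖u‖ * cis φ ∨ u = -(‖u‖ * cis φ)) := by
      intro u hu
      have h2 := norm_mul_cis_arg2 u
      have h3 := arg2_nonneg u
      have h4 := arg2_lt u
      by_cases hlt : arg2 u < Real.pi
      · exact ⟨_, h3, hlt, rfl, Or.inl h2.symm⟩
      · refine ⟨arg2 u - Real.pi, by linarith, by linarith, ?_, Or.inr ?_⟩
        · rw [chart, ← F.polar_add_total (φ := arg2 u - Real.pi) (by linarith) (norm_nonneg u) hu]
          congr 1
          linarith
        · rw [cis_sub, cis_pi]
          nth_rewrite 1 [← h2]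
          norm_num
    obtain ⟨φ, f1, f2, f3, f4⟩ := key u hu
    obtain ⟨χ, g1, g2, g3, g4⟩ := key v hv
    rw [f3, g3] at h
    have h5 := F.eq_of_polar_eq (norm_nonneg u) hu (norm_nonneg v) hv f1 (hpi ▸ f2) g1
      (hpi ▸ g2) h
    rw [← h5] at g4
    rcases f4 with f4 | f4 <;> rcases g4 with g4 | g4
    · exact Or.inl (f4.trans g4.symm)
    · exact Or.inr ⟨by rw [g4, neg_neg]; exact f4, hpi⟩
    · exact Or.inr ⟨by rw [g4]; exact f4, hpi⟩
    · exact Or.inl (f4.trans g4.symm)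
  · left
    have h5 := F.eq_of_polar_eq (norm_nonneg u) hu (norm_nonneg v) hv (arg2_nonneg u)
      (h2pi ▸ arg2_lt u) (arg2_nonneg v) (h2pi ▸ arg2_lt v) h
    rwa [hu2, hv2] at h5

end Fan

end FlatSphere

/-! ### Sectors in the plane -/

theorem exists_pos_le_of_finite {ι : Type*} [Finite ι] (f : ι → ℝ) (h : ∀ i, 0 < f i) :
    ∃ r : ℝ, 0 < r ∧ ∀ i, r ≤ f i := by
  rcases isEmpty_or_nonempty ι with he | hne
  · exact ⟨1, one_pos, fun i => he.elim i⟩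
  · obtain ⟨i, hi⟩ := Finite.exists_min f
    exact ⟨f i, h i, hi⟩

theorem exists_polar {d w : ℂ} (hd : ‖d‖ = 1) (hw : 0 ≤ cross d w) :
    ∃ r ψ : ℝ, 0 ≤ r ∧ 0 ≤ ψ ∧ ψ ≤ Real.pi ∧ w = r * d * cis ψ := by
  have hd0 : d ≠ 0 := by rintro rfl; simp at hd
  refine ⟨‖w / d‖, (w / d).arg, norm_nonneg _, ?_, Complex.arg_le_pi _, ?_⟩
  · rw [Complex.arg_nonneg_iff, Complex.div_im, ← sub_div]
    refine div_nonneg ?_ (Complex.normSq_nonneg d)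
    unfold cross at hw
    linarith
  · have h := Complex.norm_mul_exp_arg_mul_I (w / d)
    rw [mul_right_comm, cis, h, div_mul_cancel₀ _ hd0]

theorem cross_mul_cis {d : ℂ} (hd : ‖d‖ = 1) (r ψ : ℝ) : cross d (r * d * cis ψ) = r * Real.sin ψ := by
  have h : d.re * d.re + d.im * d.im = 1 := by
    rw [← Complex.normSq_apply, Complex.normSq_eq_norm_sq, hd, one_pow]
  simp only [cross, Complex.mul_re, Complex.mul_im, Complex.ofReal_re, Complex.ofReal_im, cis_re,
    cis_im]
  linear_combination r * Real.sin ψ * h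

theorem cross_add_right (a b c : ℂ) : cross a (b + c) = cross a b + cross a c := by
  simp [cross]; ring

theorem cross_smul_right (a b : ℂ) (t : ℝ) : cross a (t • b) = t * cross a b := by
  simp [cross]; ring

theorem cross_smul_left (a b : ℂ) (t : ℝ) : cross (t • a) b = t * cross a b := by
  simp [cross]; ring

theorem cross_self_eq_zero (a : ℂ) : cross a a = 0 := by
  simp [cross]; ring

theorem cross_neg_swap (a b : ℂ) : cross a b = -cross b a := by
  simp [cross]; ring

/-- The unit vector in the direction of a vector. -/
def dir (a : ℂ) : ℂ := (‖a‖⁻¹ : ℝ) • a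

theorem norm_dir {a : ℂ} (ha : a ≠ 0) : ‖dir a‖ = 1 := by
  rw [dir, norm_smul, norm_inv, norm_norm, inv_mul_cancel₀ (norm_ne_zero_iff.2 ha)]

theorem norm_smul_dir {a : ℂ} (ha : a ≠ 0) : ‖a‖ • dir a = a := by
  rw [dir, smul_smul, mul_inv_cancel₀ (norm_ne_zero_iff.2 ha), one_smul]

theorem ne_zero_of_cross_pos {a b : ℂ} (h : 0 < cross a b) : a ≠ 0 ∧ b ≠ 0 := by
  constructor <;> rintro rfl <;> simp [cross] at h

/-- The angle from `a` to `b`. -/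
theorem angle_spec {a b : ℂ} (h : 0 < cross a b) :
    0 < InnerProductGeometry.angle a b ∧ InnerProductGeometry.angle a b < Real.pi ∧
      dir b = dir a * cis (InnerProductGeometry.angle a b) := by
  obtain ⟨ha, hb⟩ := ne_zero_of_cross_pos h
  have hda := norm_dir ha
  obtain ⟨r, ψ, hr, h0, h1, h2⟩ := exists_polar (d := dir a) (w := dir b) hda (by
    rw [dir, dir, cross_smul_left, cross_smul_right]
    have := norm_pos_iff.2 ha
    have := norm_pos_iff.2 hb
    positivity)
  have hr1 : r = 1 := by
    have := congrArg norm h2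
    rw [norm_dir hb, norm_mul, norm_mul, hda, norm_cis, Complex.norm_real,
      Real.norm_of_nonneg hr] at this
    linarith
  rw [hr1, Complex.ofReal_one, one_mul] at h2
  have hsin : 0 < Real.sin ψ := by
    have h3 := cross_mul_cis hda 1 ψ
    rw [Complex.ofReal_one, one_mul, ← h2, one_mul] at h3
    rw [← h3, dir, dir, cross_smul_left, cross_smul_right]
    have := norm_pos_iff.2 ha
    have := norm_pos_iff.2 hb
    positivity
  have hψ0 : ψ ≠ 0 := by rintro rfl; simp at hsin
  have hψ1 : ψ ≠ Real.pi := by rintro rfl; simp at hsin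
  have hang : InnerProductGeometry.angle a b = ψ := by
    have h3 : InnerProductGeometry.angle a b = InnerProductGeometry.angle (dir a) (dir b) := by
      rw [dir, dir, InnerProductGeometry.angle_smul_left_of_pos _ _ (inv_pos.2 (norm_pos_iff.2 ha)),
        InnerProductGeometry.angle_smul_right_of_pos _ _ (inv_pos.2 (norm_pos_iff.2 hb))]
    have hd0 : dir a ≠ 0 := by
      intro h0
      rw [h0] at hda
      simp at hda
    rw [h3, InnerProductGeometry.angle_comm, Complex.angle_eq_abs_arg (by
      rw [h2]; exact mul_ne_zero hd0 (cis_ne_zero _)) hd0, h2, mul_div_cancel_left₀ _ hd0, cis,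
      Complex.arg_exp_mul_I, toIocMod_eq_self _ |>.2 ⟨by linarith [Real.pi_pos], by linarith⟩,
      abs_of_nonneg h0]
  rw [hang]
  exact ⟨lt_of_le_of_ne h0 hψ0.symm, lt_of_le_of_ne h1 hψ1, h2⟩

/-- Vectors in the cone spanned by `a` and `b`, in polar coordinates. -/
theorem exists_polar_of_cone {a b : ℂ} (h : 0 < cross a b) {s t : ℝ} (hs : 0 ≤ s) (ht : 0 ≤ t) :
    ∃ r ψ : ℝ, 0 ≤ r ∧ 0 ≤ ψ ∧ ψ ≤ InnerProductGeometry.angle a b ∧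
      s • a + t • b = r * dir a * cis ψ := by
  obtain ⟨ha, hb⟩ := ne_zero_of_cross_pos h
  obtain ⟨h1, h2, h3⟩ := angle_spec h
  set θ := InnerProductGeometry.angle a b
  have hda := norm_dir ha
  have hdb := norm_dir hb
  have hna := norm_pos_iff.2 ha
  have hnb := norm_pos_iff.2 hb
  have hc1 : 0 ≤ cross (dir a) (s • a + t • b) := by
    rw [cross_add_right, cross_smul_right, cross_smul_right, dir, cross_smul_left, cross_smul_left,
      cross_self_eq_zero, mul_zero, mul_zero, zero_add]
    positivity
  obtain ⟨r, ψ, hr, hψ, hψ', heq⟩ := exists_polar hda hc1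
  rcases hr.eq_or_lt with rfl | hr0
  · exact ⟨0, 0, le_rfl, le_rfl, h1.le, by rw [heq]; simp⟩
  refine ⟨r, ψ, hr, hψ, ?_, heq⟩
  by_contra hlt
  rw [not_le] at hlt
  -- With an angle `ψ` beyond `θ` the vector would lie strictly to the left of `b`, but a
  -- combination of `a` and `b` with nonnegative coefficients does not.
  have hc2 : cross (dir b) (s • a + t • b) ≤ 0 := by
    rw [cross_add_right, cross_smul_right, cross_smul_right, dir, cross_smul_left, cross_smul_left,
      cross_self_eq_zero, mul_zero, mul_zero, add_zero, cross_neg_swap]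
    have : 0 ≤ s * (‖b‖⁻¹ * cross a b) := by positivity
    linarith
  have h4 : (r : ℂ) * dir a * cis ψ = r * dir b * cis (ψ - θ) := by
    rw [h3, cis_sub]
    have := cis_ne_zero θ
    field_simp
  rw [heq, h4, cross_mul_cis hdb] at hc2
  have := Real.sin_pos_of_pos_of_lt_pi (x := ψ - θ) (by linarith) (by linarith)
  nlinarith

/-- Rests on `sin θ · e^{iψ} = sin (θ - ψ) + sin ψ · e^{iθ}`. It exhibits the barycentric
coordinates of points given in polar form, whose signs are then those of two sines. -/
theorem cone_of_polar {a b : ℂ} (h : 0 < cross a b) {r ψ : ℝ} :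
    r * dir a * cis ψ
      = (r * Real.sin (InnerProductGeometry.angle a b - ψ)
          / (‖a‖ * Real.sin (InnerProductGeometry.angle a b))) • a
        + (r * Real.sin ψ / (‖b‖ * Real.sin (InnerProductGeometry.angle a b))) • b := by
  obtain ⟨ha, hb⟩ := ne_zero_of_cross_pos h
  obtain ⟨h1, h2, h3⟩ := angle_spec h
  set θ := InnerProductGeometry.angle a b
  have hsin := Real.sin_pos_of_pos_of_lt_pi h1 h2
  have hna := norm_pos_iff.2 ha
  have hnb := norm_pos_iff.2 hb
  have ea : a = ‖a‖ * dir a := by rw [← Complex.real_smul, norm_smul_dir ha]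
  have eb : b = ‖b‖ * (dir a * cis θ) := by rw [← h3, ← Complex.real_smul, norm_smul_dir hb]
  have hid : Real.sin θ * cis ψ = Real.sin (θ - ψ) + Real.sin ψ * cis θ := by
    apply Complex.ext
    · simp only [Complex.mul_re, Complex.add_re, Complex.ofReal_re, Complex.ofReal_im, cis_re,
        cis_im, Real.sin_sub]
      ring
    · simp only [Complex.mul_im, Complex.add_im, Complex.ofReal_re, Complex.ofReal_im, cis_re,
        cis_im]
      ring
  have hsin' : (Real.sin θ : ℂ) ≠ 0 := by exact_mod_cast hsin.ne'
  have hna' : (‖a‖ : ℂ) ≠ 0 := by exact_mod_cast hna.ne'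
  have hnb' : (‖b‖ : ℂ) ≠ 0 := by exact_mod_cast hnb.ne'
  have e1 : ((r * Real.sin (θ - ψ) / (‖a‖ * Real.sin θ) : ℝ) : ℂ) * a
      = r * Real.sin (θ - ψ) / Real.sin θ * dir a := by
    conv_lhs => rw [ea]
    push_cast
    have : (‖a‖ : ℂ) ≠ 0 := hna'
    rw [← ea]
    field_simp
    conv_lhs => rw [ea]
    ring
  have e2 : ((r * Real.sin ψ / (‖b‖ * Real.sin θ) : ℝ) : ℂ) * b
      = r * Real.sin ψ / Real.sin θ * (dir a * cis θ) := by
    push_cast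
    field_simp
    conv_lhs => rw [eb]
    ring
  rw [Complex.real_smul, Complex.real_smul, e1, e2]
  field_simp
  linear_combination (r * dir a) * hid

/-! ### Punctured neighbourhoods in the sphere -/

/-- The ball is the image of the plane under `univBall`, which sends `0` to the centre, and a plane
without a point is connected. -/
theorem isPreconnected_ball_diff_center (c : EuclideanSpace ℝ (Fin 2)) {r : ℝ} (hr : 0 < r) :
    IsPreconnected (Metric.ball c r \ {c}) := by
  have h1 : IsPreconnected ({0}ᶜ : Set (EuclideanSpace ℝ (Fin 2))) := by
    refine (isConnected_compl_singleton_of_one_lt_rank ?_ 0).isPreconnected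
    rw [← Module.finrank_eq_rank, finrank_euclideanSpace_fin]
    norm_num
  set e := OpenPartialHomeomorph.univBall c r
  have hsrc : e.source = Set.univ := OpenPartialHomeomorph.univBall_source c r
  have htgt : e.target = Metric.ball c r := OpenPartialHomeomorph.univBall_target c hr
  have h0 : e 0 = c := OpenPartialHomeomorph.univBall_apply_zero c r
  have himg : e '' {0}ᶜ = Metric.ball c r \ {c} := by
    ext y
    constructor
    · rintro ⟨x, hx, rfl⟩
      refine ⟨htgt ▸ e.map_source (hsrc ▸ Set.mem_univ x), fun h => hx ?_⟩
      exact e.injOn (hsrc ▸ Set.mem_univ x) (hsrc ▸ Set.mem_univ 0) (h.trans h0.symm)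
    · rintro ⟨hy, hyc⟩
      refine ⟨e.symm y, fun h => hyc ?_, e.right_inv (htgt ▸ hy)⟩
      rw [Set.mem_singleton_iff, ← h0, ← (h : e.symm y = 0), e.right_inv (htgt ▸ hy)]
  rw [← himg]
  exact h1.image _ (e.continuousOn.mono (by rw [hsrc]; exact Set.subset_univ _))

/-- The only local topology of the sphere that is needed: small discs stay connected after removal
of the centre. It forces the triangles at a vertex into one cycle. -/
theorem exists_punctured_nhd (p : Sphere2) {U : Set Sphere2} (hU : U ∈ 𝓝 p) :
    ∃ N ⊆ U, N ∈ 𝓝 p ∧ IsPreconnected (N \ {p}) := by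
  set e := chartAt (EuclideanSpace ℝ (Fin 2)) p
  have hp : p ∈ e.source := mem_chart_source _ p
  have hpt : e p ∈ e.target := e.map_source hp
  have hc : ContinuousAt e.symm (e p) := e.continuousAt_symm hpt
  have h1 : e.symm ⁻¹' U ∈ 𝓝 (e p) := by
    refine hc ?_
    rwa [e.left_inv hp]
  obtain ⟨ε, hε, hball⟩ := Metric.mem_nhds_iff.1 (Filter.inter_mem h1 (e.open_target.mem_nhds hpt))
  refine ⟨e.symm '' Metric.ball (e p) ε, ?_, ?_, ?_⟩
  · rintro _ ⟨x, hx, rfl⟩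
    exact (hball hx).1
  · have := e.symm.image_mem_nhds (x := e p) hpt (Metric.ball_mem_nhds _ hε)
    rwa [e.left_inv hp] at this
  · have himg : e.symm '' Metric.ball (e p) ε \ {p} = e.symm '' (Metric.ball (e p) ε \ {e p}) := by
      ext y
      constructor
      · rintro ⟨⟨x, hx, rfl⟩, hne⟩
        refine ⟨x, ⟨hx, fun h => hne ?_⟩, rfl⟩
        rw [Set.mem_singleton_iff] at h ⊢
        rw [h, e.left_inv hp]
      · rintro ⟨x, ⟨hx, hne⟩, rfl⟩
        refine ⟨⟨x, hx, rfl⟩, fun h => hne ?_⟩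
        rw [Set.mem_singleton_iff] at h ⊢
        rw [← h, e.right_inv (hball hx).2]
    rw [himg]
    refine (isPreconnected_ball_diff_center _ hε).image _ (e.continuousOn_symm.mono ?_)
    exact fun x hx => (hball hx.1).2

/-! ### Polar coordinates at a vertex or at an inner edge point of a triangle -/

section Triangle

variable {v : Fin 3 → ℂ}

theorem bary_add (i : Fin 3) (x w : ℂ) :
    bary v i (x + w) = bary v i x + cross (v (i + 2) - v (i + 1)) w / area2 v := by
  simp only [bary]
  rw [← add_div]
  congr 1
  simp [cross]
  ring

theorem norm_mul_dir_mul_cis {a : ℂ} (ha : a ≠ 0) {r : ℝ} (hr : 0 ≤ r) (ψ : ℝ) :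
    ‖(r : ℂ) * dir a * cis ψ‖ = r := by
  rw [norm_mul, norm_mul, norm_dir ha, norm_cis, mul_one, mul_one, Complex.norm_real,
    Real.norm_of_nonneg hr]

theorem vertex_sub_ne_zero (hv : 0 < area2 v) {i j : Fin 3} (h : i ≠ j) : v i - v j ≠ 0 :=
  sub_ne_zero.2 fun h' => h (vertex_injective hv.ne' h')

/-- Polar coordinates at a vertex. -/
theorem exists_polar_of_mem_triangle (hv : 0 < area2 v) (i : Fin 3) {y : ℂ} (hy : y ∈ triangle v) :
    ∃ r ψ : ℝ, 0 ≤ r ∧ 0 ≤ ψ ∧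
      ψ ≤ InnerProductGeometry.angle (v (i + 1) - v i) (v (i + 2) - v i) ∧
      y = v i + r * dir (v (i + 1) - v i) * cis ψ := by
  have h := (mem_triangle_iff hv.ne').1 hy
  obtain ⟨r, ψ, h1, h2, h3, h4⟩ := exists_polar_of_cone
    (by rwa [area2_eq v i] at hv) (h (i + 1)) (h (i + 2))
  refine ⟨r, ψ, h1, h2, h3, ?_⟩
  rw [← h4, ← sub_eq_bary hv.ne' i y]
  ring

theorem bary_polar_vertex (hv : 0 < area2 v) (i : Fin 3) (r ψ : ℝ) :
    bary v (i + 1) (v i + r * dir (v (i + 1) - v i) * cis ψ)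
      = r * Real.sin (InnerProductGeometry.angle (v (i + 1) - v i) (v (i + 2) - v i) - ψ) /
        (‖v (i + 1) - v i‖
          * Real.sin (InnerProductGeometry.angle (v (i + 1) - v i) (v (i + 2) - v i))) ∧
    bary v (i + 2) (v i + r * dir (v (i + 1) - v i) * cis ψ)
      = r * Real.sin ψ / (‖v (i + 2) - v i‖
          * Real.sin (InnerProductGeometry.angle (v (i + 1) - v i) (v (i + 2) - v i))) := by
  have h := cone_of_polar (a := v (i + 1) - v i) (b := v (i + 2) - v i)
    (by rwa [area2_eq v i] at hv) (r := r) (ψ := ψ)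
  rw [h, ← add_assoc]
  exact ⟨(bary_add_combo hv.ne' i _ _).1, (bary_add_combo hv.ne' i _ _).2.1⟩

/-- Coordinate `i` stays positive by continuity and the other two are nonnegative by the sine
formulas. The bound by the length of the second edge keeps the closing ray on that edge, as needed
for gluing. -/
theorem exists_radius_vertex (hv : 0 < area2 v) (i : Fin 3) :
    ∃ ρ : ℝ, 0 < ρ ∧ ρ ≤ ‖v (i + 2) - v i‖ ∧ ∀ r ψ : ℝ, 0 ≤ r → r < ρ → 0 ≤ ψ →
      ψ ≤ InnerProductGeometry.angle (v (i + 1) - v i) (v (i + 2) - v i) →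
      v i + r * dir (v (i + 1) - v i) * cis ψ ∈ triangle v := by
  obtain ⟨h1, h2, -⟩ := angle_spec (a := v (i + 1) - v i) (b := v (i + 2) - v i)
    (by rwa [area2_eq v i] at hv)
  have hA0 := vertex_sub_ne_zero hv (fin3_add_one_ne i)
  have hA := norm_pos_iff.2 hA0
  have hB := norm_pos_iff.2 (vertex_sub_ne_zero hv (fin3_add_two_ne i))
  have hin : v i ∈ {x | 0 < bary v i x} := by
    rw [Set.mem_ofPred_eq, bary_self hv.ne']; exact one_pos
  obtain ⟨ε, hε, hball⟩ := Metric.isOpen_iff.1 (isOpen_lt continuous_const (continuous_bary i)) _ hin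
  refine ⟨min ε ‖v (i + 2) - v i‖, lt_min hε hB, min_le_right _ _, fun r ψ hr hr' hψ hψ' => ?_⟩
  rw [mem_triangle_iff hv.ne']
  have hb := bary_polar_vertex hv i r ψ
  set θ := InnerProductGeometry.angle (v (i + 1) - v i) (v (i + 2) - v i)
  have hs := Real.sin_pos_of_pos_of_lt_pi h1 h2
  have hs1 := Real.sin_nonneg_of_nonneg_of_le_pi hψ (by linarith)
  have hs2 := Real.sin_nonneg_of_nonneg_of_le_pi (x := θ - ψ) (by linarith) (by linarith)
  intro m
  rcases fin3_cases i m with rfl | rfl | rfl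
  · refine le_of_lt (hball ?_ : 0 < bary v m _)
    rw [Metric.mem_ball, dist_eq_norm, add_sub_cancel_left, norm_mul_dir_mul_cis hA0 hr]
    exact hr'.trans_le (min_le_left _ _)
  · rw [hb.1]; positivity
  · rw [hb.2]; positivity

theorem eq_lineMap_of_bary (hv : 0 < area2 v) {i : Fin 3} {x : ℂ} (h : bary v (i + 2) x = 0) :
    x = AffineMap.lineMap (v i) (v (i + 1)) (bary v (i + 1) x) := by
  have := sub_eq_bary hv.ne' i x
  rw [h, zero_smul, add_zero] at this
  rw [AffineMap.lineMap_apply, vsub_eq_sub, vadd_eq_add, ← this, sub_add_cancel]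

theorem bary_polar_edge (hv : 0 < area2 v) {i : Fin 3} {x : ℂ} (h : bary v (i + 2) x = 0) (r ψ : ℝ) :
    bary v (i + 2) (x + r * dir (v (i + 1) - v i) * cis ψ)
      = ‖v (i + 1) - v i‖ * (r * Real.sin ψ) / area2 v := by
  have hA0 := vertex_sub_ne_zero hv (fin3_add_one_ne i)
  rw [bary_add, h, zero_add, fin3_add_two_add_two, fin3_add_two_add_one,
    ← cross_mul_cis (norm_dir hA0), ← cross_smul_left, norm_smul_dir hA0]

theorem exists_polar_of_mem_triangle_edge (hv : 0 < area2 v) {i : Fin 3} {x y : ℂ}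
    (h : bary v (i + 2) x = 0) (hy : y ∈ triangle v) :
    ∃ r ψ : ℝ, 0 ≤ r ∧ 0 ≤ ψ ∧ ψ ≤ Real.pi ∧ y = x + r * dir (v (i + 1) - v i) * cis ψ := by
  have hA0 := vertex_sub_ne_zero hv (fin3_add_one_ne i)
  have hc : 0 ≤ cross (dir (v (i + 1) - v i)) (y - x) := by
    have h1 := bary_add (v := v) (i + 2) x (y - x)
    have h2 := (mem_triangle_iff hv.ne').1 hy (i + 2)
    rw [add_sub_cancel, h, zero_add, fin3_add_two_add_two, fin3_add_two_add_one] at h1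
    rw [h1] at h2
    rw [dir, cross_smul_left]
    have h3 : 0 ≤ cross (v (i + 1) - v i) (y - x) := by
      by_contra hneg
      exact absurd h2 (not_le.2 (div_neg_of_neg_of_pos (not_le.1 hneg) hv))
    positivity
  obtain ⟨r, ψ, h1, h2, h3, h4⟩ := exists_polar (norm_dir hA0) hc
  exact ⟨r, ψ, h1, h2, h3, by rw [← h4]; ring⟩

/-- The bound by `bary v (i + 1) x * ‖v (i + 1) - v i‖` is the distance from `x` back to `v i`, so
that the ray at angle `π` does not run past this vertex. -/
theorem exists_radius_edge (hv : 0 < area2 v) {i : Fin 3} {x : ℂ} (h : bary v (i + 2) x = 0)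
    (hi : 0 < bary v i x) (hi1 : 0 < bary v (i + 1) x) :
    ∃ ρ : ℝ, 0 < ρ ∧ ρ ≤ bary v (i + 1) x * ‖v (i + 1) - v i‖ ∧
      ∀ r ψ : ℝ, 0 ≤ r → r < ρ → 0 ≤ ψ → ψ ≤ Real.pi →
      x + r * dir (v (i + 1) - v i) * cis ψ ∈ triangle v := by
  have hA0 := vertex_sub_ne_zero hv (fin3_add_one_ne i)
  have hA := norm_pos_iff.2 hA0
  have hin : x ∈ {x | 0 < bary v i x} ∩ {x | 0 < bary v (i + 1) x} := ⟨hi, hi1⟩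
  obtain ⟨ε, hε, hball⟩ := Metric.isOpen_iff.1 ((isOpen_lt continuous_const (continuous_bary i)).inter
    (isOpen_lt continuous_const (continuous_bary (i + 1)))) _ hin
  refine ⟨min ε (bary v (i + 1) x * ‖v (i + 1) - v i‖), lt_min hε (by positivity), min_le_right _ _,
    fun r ψ hr hr' hψ hψ' => ?_⟩
  rw [mem_triangle_iff hv.ne']
  have hmem : x + r * dir (v (i + 1) - v i) * cis ψ ∈
      {x | 0 < bary v i x} ∩ {x | 0 < bary v (i + 1) x} := hball (by
    rw [Metric.mem_ball, dist_eq_norm, add_sub_cancel_left, norm_mul_dir_mul_cis hA0 hr]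
    exact hr'.trans_le (min_le_left _ _))
  have hs1 := Real.sin_nonneg_of_nonneg_of_le_pi hψ hψ'
  intro m
  rcases fin3_cases i m with rfl | rfl | rfl
  · exact hmem.1.le
  · exact hmem.2.le
  · rw [bary_polar_edge hv h]; positivity

end Triangle

/-! ### Fans at inner points of triangles and of edges -/

namespace FlatSphere

variable {T : FlatSphere}

/-- The fan at an inner point of a triangle. -/
theorem nonempty_fan_of_interior {α : Fin T.n} {x : ℂ} (hx : ∀ i, 0 < bary (T.vert α) i x) :
    Nonempty (Fan T (T.param α x) (2 * Real.pi)) := by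
  have hint := (mem_interior_triangle_iff (T.area2_ne α)).2 hx
  obtain ⟨ρ, hρ, hball⟩ := Metric.mem_nhds_iff.1 (mem_interior_iff_mem_nhds.1 hint)
  refine ⟨{ k := 1, pos := one_pos, τ := fun _ => α, x := fun _ => x, d := fun _ => 1,
            θ := fun _ => 2 * Real.pi, ρ := ρ, ρ_pos := hρ, period := fun _ => ⟨rfl, rfl, rfl, rfl⟩,
            θ_pos := fun _ => Real.two_pi_pos, sum := by simp, unit := fun _ => norm_one,
            base_mem := fun _ => interior_subset hint, base := fun _ => rfl,
            inside := ?_, sector := ?_, glue := ?_, disj := ?_, complete := ?_ }⟩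
  · intro j r ψ hr hr' _ _
    refine hball ?_
    rw [Metric.mem_ball, dist_eq_norm, add_sub_cancel_left, mul_one, norm_mul, norm_cis, mul_one,
      Complex.norm_real, Real.norm_of_nonneg hr]
    exact hr'
  · intro j y _
    refine ⟨‖y - x‖, arg2 (y - x), norm_nonneg _, arg2_nonneg _, (arg2_lt _).le, ?_⟩
    rw [mul_one, norm_mul_cis_arg2]
    ring
  · intro j r _ _
    simp only [cis_two_pi, mul_one]
  · intro j l r s ψ χ hj hl _ _ _ _ _ _ _ _ _
    omega
  · intro β y hy h
    obtain ⟨rfl, rfl⟩ := eq_of_param_eq_of_pos hx hy h.symm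
    exact ⟨0, one_pos, rfl, rfl⟩

/-- The common face contains the vertices `i` and `i + 1` and has at most two vertices, so it is
exactly this edge. -/
theorem bary_eq_zero_of_opposite {α β : Fin T.n} {i j : Fin 3}
    (h : T.param α (T.vert α i) = T.param β (T.vert β (j + 1)))
    (h' : T.param α (T.vert α (i + 1)) = T.param β (T.vert β j)) {x y : ℂ} (hx : x ∈ T.tri α)
    (hy : y ∈ T.tri β) (hxy : T.param α x = T.param β y) : bary (T.vert α) (i + 2) x = 0 := by
  obtain ⟨I, J, hI, hJ, h1, h2⟩ := T.exists_faces (ne_of_opposite h h')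
  have hmem : ∀ m, (∃ y ∈ T.tri β, T.param α (T.vert α m) = T.param β y) → m ∈ I := by
    intro m hm
    by_contra hmI
    have := (h1 _ (T.vert_mem α m)).1 hm m hmI
    rw [bary_self (T.area2_ne α)] at this
    exact one_ne_zero this
  have hi := hmem i ⟨_, T.vert_mem β _, h⟩
  have hi1 := hmem (i + 1) ⟨_, T.vert_mem β _, h'⟩
  refine (h1 x hx).1 ⟨y, hy, hxy⟩ _ fun hi2 => ?_
  have : I = Finset.univ := Finset.eq_univ_of_forall fun m => by
    rcases fin3_cases i m with rfl | rfl | rfl <;> assumption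
  rw [this] at hI
  simp at hI

theorem norm_edge_eq {α β : Fin T.n} {i j : Fin 3}
    (h : T.param α (T.vert α i) = T.param β (T.vert β (j + 1)))
    (h' : T.param α (T.vert α (i + 1)) = T.param β (T.vert β j)) :
    ‖T.vert α (i + 1) - T.vert α i‖ = ‖T.vert β (j + 1) - T.vert β j‖ := by
  have := dist_eq_of_param_eq (T.vert_mem α i) (T.vert_mem α (i + 1)) (T.vert_mem β _)
    (T.vert_mem β _) h h'
  rw [dist_comm, dist_eq_norm, dist_eq_norm] at this
  exact this

theorem lineMap_sub_mul_dir {a b : ℂ} (t r : ℝ) :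
    AffineMap.lineMap a b t - r * dir (b - a) = AffineMap.lineMap a b (t - r / ‖b - a‖) := by
  rw [AffineMap.lineMap_apply, AffineMap.lineMap_apply, vsub_eq_sub, vadd_eq_add, vadd_eq_add, dir,
    sub_smul, div_eq_mul_inv, mul_smul]
  simp only [Complex.real_smul]
  ring

/-- Passing through an edge. -/
theorem param_edge_glue {α β : Fin T.n} {i j : Fin 3}
    (h : T.param α (T.vert α i) = T.param β (T.vert β (j + 1)))
    (h' : T.param α (T.vert α (i + 1)) = T.param β (T.vert β j)) {t r : ℝ}
    (ht : t ≤ 1) (hr : 0 ≤ r) (hr' : r ≤ t * ‖T.vert α (i + 1) - T.vert α i‖) :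
    T.param α (AffineMap.lineMap (T.vert α i) (T.vert α (i + 1)) t
        - r * dir (T.vert α (i + 1) - T.vert α i))
      = T.param β (AffineMap.lineMap (T.vert β j) (T.vert β (j + 1)) (1 - t)
        + r * dir (T.vert β (j + 1) - T.vert β j)) := by
  have hn := norm_edge_eq h h'
  have hA0 := vertex_sub_ne_zero (T.area2_pos α) (fin3_add_one_ne i)
  have hA := norm_pos_iff.2 hA0
  rw [lineMap_sub_mul_dir, param_edge_eq h h' ⟨by
    rw [sub_nonneg, div_le_iff₀ hA]; exact hr', by
    have : 0 ≤ r / ‖T.vert α (i + 1) - T.vert α i‖ := by positivity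
    linarith⟩]
  congr 1
  have := lineMap_sub_mul_dir (a := T.vert β j) (b := T.vert β (j + 1)) (1 - t) (-r)
  rw [Complex.ofReal_neg, neg_mul, sub_neg_eq_add] at this
  rw [this, ← AffineMap.lineMap_apply_one_sub, hn]
  congr 1
  ring

/-- The fan at an inner point of an edge. -/
theorem nonempty_fan_of_edge {α : Fin T.n} {i : Fin 3} {x : ℂ} (hi2 : bary (T.vert α) (i + 2) x = 0)
    (hi : 0 < bary (T.vert α) i x) (hi1 : 0 < bary (T.vert α) (i + 1) x) :
    Nonempty (Fan T (T.param α x) (2 * Real.pi)) := by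
  obtain ⟨β, j, h, h'⟩ := T.closed α i
  have hαβ := ne_of_opposite h h'
  have hα := T.area2_pos α
  have hβ := T.area2_pos β
  have hsum := sum_bary' hα.ne' i x
  set t := bary (T.vert α) (i + 1) x with ht
  have hx := eq_lineMap_of_bary hα hi2
  rw [← ht] at hx
  -- The same point seen from the neighbouring triangle, which runs through the edge backwards;
  -- hence the parameter `1 - t`.
  set y := AffineMap.lineMap (T.vert β j) (T.vert β (j + 1)) (1 - t) with hy
  have hyc : y = T.vert β j + (1 - t) • (T.vert β (j + 1) - T.vert β j)
      + (0 : ℝ) • (T.vert β (j + 2) - T.vert β j) := by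
    rw [hy, AffineMap.lineMap_apply, vsub_eq_sub, vadd_eq_add, zero_smul, add_zero, add_comm]
  have hyb := bary_add_combo hβ.ne' j (1 - t) 0
  rw [← hyc] at hyb
  obtain ⟨hy1, hy2, hy0⟩ := hyb
  have hxm : x ∈ T.tri α := T.mem_tri_iff.2 fun m => by
    rcases fin3_cases i m with rfl | rfl | rfl
    · exact hi.le
    · exact hi1.le
    · exact hi2.ge
  have hym : y ∈ T.tri β := T.mem_tri_iff.2 fun m => by
    rcases fin3_cases j m with rfl | rfl | rfl
    · rw [hy0]; linarith
    · rw [hy1]; linarith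
    · exact hy2.ge
  have hxy : T.param α x = T.param β y := by
    rw [hx, param_edge_eq h h' ⟨hi1.le, by linarith⟩, hy, AffineMap.lineMap_apply_one_sub]
  obtain ⟨ρ₁, hρ₁, hle₁, hin₁⟩ := exists_radius_edge hα hi2 hi hi1
  obtain ⟨ρ₂, hρ₂, hle₂, hin₂⟩ := exists_radius_edge hβ hy2 (by rw [hy0]; linarith)
    (by rw [hy1]; linarith)
  have hA0 := vertex_sub_ne_zero hα (fin3_add_one_ne i)
  have hB0 := vertex_sub_ne_zero hβ (fin3_add_one_ne j)
  have hAB := norm_edge_eq h h'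
  rw [hy1] at hle₂
  have glue₁ : ∀ r : ℝ, 0 ≤ r → r < min ρ₁ ρ₂ → T.param α (x + r * dir (T.vert α (i + 1) - T.vert α i) *
      cis Real.pi) = T.param β (y + r * dir (T.vert β (j + 1) - T.vert β j)) := by
    intro r hr hr'
    have := param_edge_glue h h' (t := t) (r := r) (by linarith) hr
      (hr'.le.trans ((min_le_left _ _).trans hle₁))
    rw [← hx] at this
    rw [cis_pi, mul_neg_one, ← sub_eq_add_neg, this]
  have glue₂ : ∀ r : ℝ, 0 ≤ r → r < min ρ₁ ρ₂ → T.param β (y + r * dir (T.vert β (j + 1) - T.vert β j) *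
      cis Real.pi) = T.param α (x + r * dir (T.vert α (i + 1) - T.vert α i)) := by
    intro r hr hr'
    have := param_edge_glue h'.symm h.symm (t := 1 - t) (r := r) (by linarith) hr
      (hr'.le.trans ((min_le_right _ _).trans hle₂))
    rw [sub_sub_cancel, ← hx] at this
    rw [cis_pi, mul_neg_one, ← sub_eq_add_neg, this]
  have hzero : ∀ {v : Fin 3 → ℂ} (_ : 0 < area2 v) (i : Fin 3) {x : ℂ} (_ : bary v (i + 2) x = 0)
      {r ψ : ℝ}, 0 < r → 0 ≤ ψ → ψ < Real.pi →
      bary v (i + 2) (x + r * dir (v (i + 1) - v i) * cis ψ) = 0 → ψ = 0 := by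
    intro v hv i x hx r ψ hr hψ hψ' h0
    rw [bary_polar_edge hv hx] at h0
    have hA := norm_pos_iff.2 (vertex_sub_ne_zero hv (fin3_add_one_ne i))
    by_contra hne
    have := Real.sin_pos_of_pos_of_lt_pi (lt_of_le_of_ne hψ (Ne.symm hne)) hψ'
    have h1 : 0 < ‖v (i + 1) - v i‖ * (r * Real.sin ψ) / area2 v := by positivity
    exact h1.ne' h0
  have hdisj : ∀ r s ψ χ : ℝ, 0 < r → r < min ρ₁ ρ₂ → 0 < s → s < min ρ₁ ρ₂ → 0 ≤ ψ → ψ < Real.pi →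
      0 ≤ χ → χ < Real.pi → T.param α (x + r * dir (T.vert α (i + 1) - T.vert α i) * cis ψ)
        = T.param β (y + s * dir (T.vert β (j + 1) - T.vert β j) * cis χ) → False := by
    intro r s ψ χ hr hr' hs hs' hψ hψ' hχ hχ' heq
    have hX := hin₁ r ψ hr.le (hr'.trans_le (min_le_left _ _)) hψ hψ'.le
    have hY := hin₂ s χ hs.le (hs'.trans_le (min_le_right _ _)) hχ hχ'.le
    have hψ0 := hzero hα i hi2 hr hψ hψ' (bary_eq_zero_of_opposite h h' hX hY heq)
    have hχ0 := hzero hβ j hy2 hs hχ hχ' (bary_eq_zero_of_opposite h'.symm h.symm hY hX heq.symm)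
    subst hψ0 hχ0
    rw [cis_zero, mul_one] at hX
    rw [cis_zero, mul_one] at hY
    simp only [cis_zero, mul_one] at heq
    -- Only the two opening rays are left. The opening ray of `β` is the closing ray of `α`, which
    -- points in the direction opposite to the opening ray of `α`, so the two meet at no positive
    -- distance.
    have hX' := hin₁ s Real.pi hs.le (hs'.trans_le (min_le_left _ _)) Real.pi_pos.le le_rfl
    have h3 := glue₁ s hs.le hs'
    have h4 := T.injOn α hX hX' (heq.trans h3.symm)
    rw [cis_pi, add_right_inj, mul_neg_one, ← sub_eq_zero, sub_neg_eq_add, ← add_mul] at h4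
    have hd0 : dir (T.vert α (i + 1) - T.vert α i) ≠ 0 := by
      rw [← norm_ne_zero_iff, norm_dir hA0]; exact one_ne_zero
    rcases mul_eq_zero.1 h4 with h5 | h5
    · have : r + s = 0 := by exact_mod_cast h5
      linarith
    · exact hd0 h5
  have hpar : ∀ l, (Even (l + 2) ↔ Even l) := fun l => by simp [Nat.even_add]
  have hpar1 : ∀ l, (Even (l + 1) ↔ ¬ Even l) := fun l => Nat.even_add_one
  -- Two half discs, one in each triangle, alternating with the parity of the index.
  refine ⟨{ k := 2, pos := two_pos, τ := fun l => if Even l then α else β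
            x := fun l => if Even l then x else y
            d := fun l => if Even l then dir (T.vert α (i + 1) - T.vert α i)
              else dir (T.vert β (j + 1) - T.vert β j)
            θ := fun _ => Real.pi, ρ := min ρ₁ ρ₂, ρ_pos := lt_min hρ₁ hρ₂
            period := fun l => by simp [hpar]
            θ_pos := fun _ => Real.pi_pos, sum := by simp
            unit := fun l => ?_, base_mem := fun l => ?_, base := fun l => ?_,
            inside := ?_, sector := ?_, glue := ?_, disj := ?_, complete := ?_ }⟩
  · by_cases hl : Even l
    · simp only [hl, if_true]; exact norm_dir hA0
    · simp only [hl, if_false]; exact norm_dir hB0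
  · by_cases hl : Even l
    · simp only [hl, if_true]; exact hxm
    · simp only [hl, if_false]; exact hym
  · by_cases hl : Even l
    · simp only [hl, if_true]
    · simp only [hl, if_false]; exact hxy.symm
  · intro l r ψ hr hr' hψ hψ'
    by_cases hl : Even l
    · simp only [hl, if_true]; exact hin₁ r ψ hr (hr'.trans_le (min_le_left _ _)) hψ hψ'
    · simp only [hl, if_false]; exact hin₂ r ψ hr (hr'.trans_le (min_le_right _ _)) hψ hψ'
  · intro l q hq
    by_cases hl : Even l
    · simp only [hl, if_true] at hq ⊢; exact exists_polar_of_mem_triangle_edge hα hi2 hq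
    · simp only [hl, if_false] at hq ⊢; exact exists_polar_of_mem_triangle_edge hβ hy2 hq
  · intro l r hr hr'
    by_cases hl : Even l
    · simp only [hl, hpar1, if_true, not_true, if_false]; exact glue₁ r hr hr'
    · simp only [hl, hpar1, if_false, not_false_eq_true, if_true]; exact glue₂ r hr hr'
  · intro l m r s ψ χ hl hm hr hr' hs hs' hψ hψ' hχ hχ' heq
    interval_cases l <;> interval_cases m
    · rfl
    · exact (hdisj r s ψ χ hr hr' hs hs' hψ hψ' hχ hχ' (by simpa using heq)).elim
    · exact (hdisj s r χ ψ hs hs' hr hr' hχ hχ' hψ hψ' (by simpa using heq.symm)).elim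
    · rfl
  · intro γ q hq hqx
    by_cases hγ : γ = α
    · subst hγ
      exact ⟨0, two_pos, by simp, by simpa using T.injOn γ hxm hq hqx.symm⟩
    · obtain ⟨l, h1, h2⟩ := exists_opposite_edge (Ne.symm hγ) hxm hi hi1 hq hqx.symm
      obtain rfl := T.coherent β γ j l (h'.symm.trans h2) (h.symm.trans h1)
      exact ⟨1, one_lt_two, by simp, by simpa using T.injOn β hym hq (hxy.symm.trans hqx.symm)⟩

end FlatSphere

/-! ### Fans at vertices: the cycle of corners -/

namespace FlatSphere

variable {T : FlatSphere}

/-- Two distinct triangles with a common vertex and another common point share an edge at this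
vertex. -/
theorem shared_edge_of_vertex {α β : Fin T.n} (hαβ : α ≠ β) {i j : Fin 3}
    (h : T.param α (T.vert α i) = T.param β (T.vert β j)) {x y : ℂ} (hx : x ∈ T.tri α)
    (hy : y ∈ T.tri β) (hxy : T.param α x = T.param β y) (hne : x ≠ T.vert α i) :
    (T.param α (T.vert α (i + 1)) = T.param β (T.vert β (j + 2)) ∧
      bary (T.vert α) (i + 2) x = 0 ∧ bary (T.vert β) (j + 1) y = 0) ∨
    (T.param α (T.vert α (i + 2)) = T.param β (T.vert β (j + 1)) ∧
      bary (T.vert α) (i + 1) x = 0 ∧ bary (T.vert β) (j + 2) y = 0) := by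
  obtain ⟨I, J, hI, hJ, h1, h2⟩ := T.exists_faces hαβ
  have hxI := (h1 x hx).1 ⟨y, hy, hxy⟩
  have hα := T.area2_ne α
  have hex : i + 1 ∈ I ∨ i + 2 ∈ I := by
    by_contra! hcon
    refine hne ?_
    have := sub_eq_bary hα i x
    rw [hxI _ hcon.1, hxI _ hcon.2, zero_smul, zero_smul, add_zero, sub_eq_zero] at this
    exact this
  have hmem : ∀ m, (∃ y ∈ T.tri β, T.param α (T.vert α m) = T.param β y) → m ∈ I := by
    intro m hm
    by_contra hmI
    have := (h1 _ (T.vert_mem α m)).1 hm m hmI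
    rw [bary_self hα] at this
    exact one_ne_zero this
  have hpre : ∀ m ∈ I, ∃ l, T.param α (T.vert α m) = T.param β (T.vert β l) := by
    intro m hm
    obtain ⟨y', hy', h3⟩ := (h1 _ (T.vert_mem α m)).2 fun k hk => bary_of_ne (by
      rintro rfl
      exact hk hm)
    obtain ⟨l, rfl⟩ := exists_vert_eq hy' h3
    exact ⟨l, h3⟩
  have hinj : ∀ {m l : Fin 3}, T.param α (T.vert α m) = T.param β (T.vert β j) → m ≠ i → False := by
    intro m l h3 hmi
    exact hmi (vertex_injective hα (T.injOn α (T.vert_mem α _) (T.vert_mem α _) (h3.trans h.symm)))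
  rcases hex with hk | hk
  · left
    obtain ⟨l, hl⟩ := hpre _ hk
    rcases fin3_cases j l with rfl | rfl | rfl
    · exact (hinj (l := 0) hl (fin3_add_one_ne i)).elim
    · exact absurd (T.coherent α β i j h hl) hαβ
    · have e := bary_eq_zero_of_opposite (i := i) (j := j + 2)
        (by rw [fin3_add_two_add_one]; exact h) hl hx hy hxy
      have e' := bary_eq_zero_of_opposite (i := j + 2) (j := i) hl.symm
        (by rw [fin3_add_two_add_one]; exact h.symm) hy hx hxy.symm
      rw [fin3_add_two_add_two] at e'
      exact ⟨hl, e, e'⟩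
  · right
    obtain ⟨l, hl⟩ := hpre _ hk
    rcases fin3_cases j l with rfl | rfl | rfl
    · exact (hinj (l := 0) hl (fin3_add_two_ne i)).elim
    · have e := bary_eq_zero_of_opposite (i := i + 2) (j := j) hl
        (by rw [fin3_add_two_add_one]; exact h) hx hy hxy
      have e' := bary_eq_zero_of_opposite (i := j) (j := i + 2)
        (by rw [fin3_add_two_add_one]; exact h.symm) hl.symm hy hx hxy.symm
      rw [fin3_add_two_add_two] at e
      exact ⟨hl, e, e'⟩
    · exact absurd (T.coherent α β (i + 2) (j + 2) hl
        (by rw [fin3_add_two_add_one, fin3_add_two_add_one]; exact h)) hαβ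

/-- The corners of triangles at a point. -/
abbrev Corner (T : FlatSphere) (p : Sphere2) : Type :=
  {c : Fin T.n × Fin 3 // T.param c.1 (T.vert c.1 c.2) = p}

variable {p : Sphere2}

/-- A triangle is embedded in the sphere, so at most one of its vertices is at `p` and a corner is
determined by its triangle. -/
theorem Corner.ext_of_fst {c c' : Corner T p} (h : c.1.1 = c'.1.1) : c = c' := by
  obtain ⟨⟨α, i⟩, hc⟩ := c
  obtain ⟨⟨β, j⟩, hc'⟩ := c'
  obtain rfl : α = β := h
  have := vertex_injective (T.area2_ne α)
    (T.injOn α (T.vert_mem α i) (T.vert_mem α j) (hc.trans hc'.symm))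
  subst this
  rfl

theorem exists_next_corner (c : Corner T p) : ∃ c' : Corner T p,
    T.param c.1.1 (T.vert c.1.1 (c.1.2 + 2)) = T.param c'.1.1 (T.vert c'.1.1 (c'.1.2 + 1)) := by
  obtain ⟨β, j, h, h'⟩ := T.closed c.1.1 (c.1.2 + 2)
  rw [fin3_add_two_add_one] at h'
  exact ⟨⟨(β, j), h'.symm.trans c.2⟩, h⟩

/-- The next corner in counterclockwise order. -/
def nextCorner (c : Corner T p) : Corner T p := (exists_next_corner c).choose

theorem nextCorner_spec (c : Corner T p) : T.param c.1.1 (T.vert c.1.1 (c.1.2 + 2))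
    = T.param (nextCorner c).1.1 (T.vert (nextCorner c).1.1 ((nextCorner c).1.2 + 1)) :=
  (exists_next_corner c).choose_spec

theorem eq_nextCorner {c c' : Corner T p}
    (h : T.param c.1.1 (T.vert c.1.1 (c.1.2 + 2)) = T.param c'.1.1 (T.vert c'.1.1 (c'.1.2 + 1))) :
    c' = nextCorner c :=
  Corner.ext_of_fst (T.coherent _ _ c'.1.2 (nextCorner c).1.2 (c'.2.trans (nextCorner c).2.symm)
    (h.symm.trans (nextCorner_spec c)))

/-- Two corners with the same successor would run through the common edge, from `i + 2` to `i`, in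
the same direction. -/
theorem nextCorner_injective : Function.Injective (nextCorner (T := T) (p := p)) := by
  intro c c' h
  refine Corner.ext_of_fst (T.coherent _ _ (c.1.2 + 2) (c'.1.2 + 2) ?_ ?_)
  · rw [nextCorner_spec c, nextCorner_spec c', h]
  · rw [fin3_add_two_add_one, fin3_add_two_add_one, c.2, c'.2]

/-- The triangles around a point form a single cycle. -/
theorem corner_mem_of_invariant (O : Set (Corner T p)) (hO : ∀ c, nextCorner c ∈ O ↔ c ∈ O)
    {c₀ : Corner T p} (h₀ : c₀ ∈ O) (c : Corner T p) : c ∈ O := by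
  by_contra hc
  -- The triangles at corners in `O` and at the other corners give two closed sets which cover a
  -- punctured neighbourhood of `p`. A common point other than `p` would yield a shared edge at `p`,
  -- hence successive corners on different sides; this contradicts connectedness.
  set A : Set Sphere2 := ⋃ c ∈ O, T.param c.1.1 '' T.tri c.1.1 with hA
  set B : Set Sphere2 := ⋃ c ∈ Oᶜ, T.param c.1.1 '' T.tri c.1.1 with hB
  have hcpt : ∀ α, IsClosed (T.param α '' T.tri α) := fun α =>
    ((T.isCompact_tri α).image_of_continuousOn (T.continuousOn α)).isClosed
  have hAc : IsClosed A := (Set.toFinite O).isClosed_biUnion fun c _ => hcpt _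
  have hBc : IsClosed B := (Set.toFinite Oᶜ).isClosed_biUnion fun c _ => hcpt _
  set R : Set (Fin T.n) := {α | p ∉ T.param α '' T.tri α} with hR
  have hRc : IsClosed (⋃ α ∈ R, T.param α '' T.tri α) :=
    (Set.toFinite R).isClosed_biUnion fun α _ => hcpt α
  have hpR : p ∉ ⋃ α ∈ R, T.param α '' T.tri α := by
    intro hp
    obtain ⟨α, hα, hpα⟩ := Set.mem_iUnion₂.1 hp
    exact hα hpα
  obtain ⟨N, hNR, hN, hconn⟩ := exists_punctured_nhd p (hRc.isOpen_compl.mem_nhds hpR)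
  have hcover : N \ {p} ⊆ A ∪ B := by
    intro q hq
    obtain ⟨α, x, hx, rfl⟩ := T.exists_param_eq q
    have hα : α ∉ R := fun hα => hNR hq.1 (Set.mem_iUnion₂.2 ⟨α, hα, x, hx, rfl⟩)
    obtain ⟨y, hy, hyp⟩ := not_not.1 hα
    obtain ⟨i, rfl⟩ := exists_vert_eq (α := c₀.1.1) (i := c₀.1.2) hy (c₀.2.trans hyp.symm)
    by_cases hO' : (⟨(α, i), hyp⟩ : Corner T p) ∈ O
    · exact Or.inl (Set.mem_iUnion₂.2 ⟨_, hO', x, hx, rfl⟩)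
    · exact Or.inr (Set.mem_iUnion₂.2 ⟨_, hO', x, hx, rfl⟩)
  have hAB : ∀ q ∈ A, q ∈ B → q = p := by
    intro q hqA hqB
    obtain ⟨c, hcO, x, hx, rfl⟩ := Set.mem_iUnion₂.1 hqA
    obtain ⟨c', hcO', y, hy, hxy⟩ := Set.mem_iUnion₂.1 hqB
    have hne : c.1.1 ≠ c'.1.1 := fun h => hcO' (Corner.ext_of_fst h ▸ hcO)
    by_cases hxi : x = T.vert c.1.1 c.1.2
    · rw [hxi, c.2]
    · exfalso
      rcases shared_edge_of_vertex hne (c.2.trans c'.2.symm) hx hy hxy.symm hxi with h | h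
      · have := eq_nextCorner (c := c') (c' := c) h.1.symm
        exact hcO' ((hO c').1 (this ▸ hcO))
      · have := eq_nextCorner (c := c) (c' := c') h.1
        exact hcO' (this ▸ (hO c).2 hcO)
  -- Points on the first edge of a corner come arbitrarily close to `p`, so neither closed set
  -- misses the punctured neighbourhood.
  have hnear : ∀ c : Corner T p, ∃ q ∈ N \ {p}, q ∈ T.param c.1.1 '' T.tri c.1.1 := by
    intro c
    set v := T.vert c.1.1
    set w := v (c.1.2 + 1) with hw
    have hcont : ContinuousWithinAt (T.param c.1.1) (T.tri c.1.1) (v c.1.2) :=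
      T.continuousOn _ _ (T.vert_mem _ _)
    have hN' : N ∈ 𝓝 (T.param c.1.1 (v c.1.2)) := by rw [c.2]; exact hN
    have ht : Filter.Tendsto (fun s : ℝ => AffineMap.lineMap (v c.1.2) w s) (𝓝[>] 0)
        (𝓝[T.tri c.1.1] (v c.1.2)) := by
      refine tendsto_nhdsWithin_iff.2 ⟨?_, ?_⟩
      · have : ContinuousAt (fun s : ℝ => AffineMap.lineMap (v c.1.2) w s) 0 :=
          AffineMap.lineMap_continuous.continuousAt
        have h2 := this.tendsto
        rw [AffineMap.lineMap_apply_zero] at h2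
        exact h2.mono_left nhdsWithin_le_nhds
      · filter_upwards [Ioo_mem_nhdsGT one_pos] with s hs
        rw [AffineMap.lineMap_apply_module]
        exact convex_triangle (T.vert_mem _ _) (T.vert_mem _ _) (by linarith [hs.2]) hs.1.le (by ring)
    have hev := (hcont.tendsto.comp ht).eventually hN'
    have hmem := ht.eventually self_mem_nhdsWithin
    obtain ⟨s, h1, h2, h3⟩ := (hev.and (hmem.and self_mem_nhdsWithin)).exists
    refine ⟨_, ⟨h1, fun h => ?_⟩, _, h2, rfl⟩
    have h4 := T.injOn _ h2 (T.vert_mem _ _) (h.trans c.2.symm)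
    have h5 : v c.1.2 ≠ w := fun h => fin3_add_one_ne _ (vertex_injective (T.area2_ne _) h).symm
    have h6 : (0 : ℝ) < s := h3
    rcases AffineMap.lineMap_eq_left_iff.1 h4 with h7 | h7
    · exact h5 h7
    · exact h6.ne' h7
  obtain ⟨q, hq, hqA⟩ := hnear c₀
  obtain ⟨q', hq', hqB⟩ := hnear c
  obtain ⟨z, hz, hzA, hzB⟩ := isPreconnected_closed_iff.1 hconn A B hAc hBc hcover
    ⟨q, hq, Set.mem_iUnion₂.2 ⟨c₀, h₀, hqA⟩⟩ ⟨q', hq', Set.mem_iUnion₂.2 ⟨c, hc, hqB⟩⟩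
  exact hz.2 (hAB z hzA hzB)

/-- The angle at a corner. -/
def cornerAngle (c : Corner T p) : ℝ :=
  InnerProductGeometry.angle (T.vert c.1.1 (c.1.2 + 1) - T.vert c.1.1 c.1.2)
    (T.vert c.1.1 (c.1.2 + 2) - T.vert c.1.1 c.1.2)

open Classical in
theorem coneAngle_eq_sum (c₀ : Corner T p) : T.coneAngle p = ∑ c : Corner T p, cornerAngle c := by
  rw [coneAngle, if_pos ⟨c₀.1.1, c₀.1.2, c₀.2⟩, ← Fintype.sum_prod_type', ← Finset.sum_filter,
    ← Finset.sum_subtype_eq_sum_filter]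
  refine Finset.sum_bij' (fun c _ => ⟨c.1, by simpa using c.2⟩) (fun c _ => ⟨c.1, by simpa using c.2⟩)
    ?_ ?_ ?_ ?_ ?_ <;> simp [cornerAngle, EuclideanGeometry.angle]

theorem nextCorner_glue (c : Corner T p) {r : ℝ} (hr : 0 ≤ r)
    (hr' : r ≤ ‖T.vert c.1.1 (c.1.2 + 2) - T.vert c.1.1 c.1.2‖) :
    T.param c.1.1 (T.vert c.1.1 c.1.2
        + r * dir (T.vert c.1.1 (c.1.2 + 1) - T.vert c.1.1 c.1.2) * cis (cornerAngle c))
      = T.param (nextCorner c).1.1 (T.vert (nextCorner c).1.1 (nextCorner c).1.2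
        + r * dir (T.vert (nextCorner c).1.1 ((nextCorner c).1.2 + 1)
          - T.vert (nextCorner c).1.1 (nextCorner c).1.2)) := by
  have hα := T.area2_pos c.1.1
  have hang := angle_spec (a := T.vert c.1.1 (c.1.2 + 1) - T.vert c.1.1 c.1.2)
    (b := T.vert c.1.1 (c.1.2 + 2) - T.vert c.1.1 c.1.2) (by rwa [area2_eq _ c.1.2] at hα)
  have h := nextCorner_spec c
  have h' : T.param c.1.1 (T.vert c.1.1 (c.1.2 + 2 + 1))
      = T.param (nextCorner c).1.1 (T.vert (nextCorner c).1.1 (nextCorner c).1.2) := by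
    rw [fin3_add_two_add_one, c.2, (nextCorner c).2]
  have hg := param_edge_glue h h' (t := 1) (r := r) le_rfl hr (by
    rw [fin3_add_two_add_one, one_mul, norm_sub_rev]; exact hr')
  rw [AffineMap.lineMap_apply_one, sub_self, AffineMap.lineMap_apply_zero,
    fin3_add_two_add_one] at hg
  rw [← hg, cornerAngle, mul_assoc, ← hang.2.2]
  congr 1
  rw [dir, dir, norm_sub_rev, Complex.real_smul, Complex.real_smul]
  ring

theorem cornerAngle_pos (c : Corner T p) : 0 < cornerAngle c ∧ cornerAngle c < Real.pi := by
  have hα := T.area2_pos c.1.1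
  have := angle_spec (a := T.vert c.1.1 (c.1.2 + 1) - T.vert c.1.1 c.1.2)
    (b := T.vert c.1.1 (c.1.2 + 2) - T.vert c.1.1 c.1.2) (by rwa [area2_eq _ c.1.2] at hα)
  exact ⟨this.1, this.2.1⟩

/-- The fan at a vertex. -/
theorem nonempty_fan_of_vertex (c₀ : Corner T p) : Nonempty (Fan T p (T.coneAngle p)) := by
  classical
  have hper : c₀ ∈ Function.periodicPts (nextCorner (T := T) (p := p)) :=
    nextCorner_injective.mem_periodicPts c₀
  -- The successor map is an injection of a finite set, so the orbit of `c₀` is a cycle; its minimal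
  -- period is the number of sectors.
  set k := Function.minimalPeriod nextCorner c₀ with hk
  have hkpos : 0 < k := Function.minimalPeriod_pos_of_mem_periodicPts hper
  set c : ℕ → Corner T p := fun j => nextCorner^[j] c₀ with hc
  have hck : ∀ j, c (j + k) = c j := fun j => by
    simp only [hc]
    rw [Function.iterate_add_apply, hk, Function.iterate_minimalPeriod]
  have hcs : ∀ j, c (j + 1) = nextCorner (c j) := fun j => Function.iterate_succ_apply' _ _ _
  have hinj : ∀ j l, j < k → l < k → c j = c l → j = l := fun j l hj hl h =>
    Function.iterate_injOn_Iio_minimalPeriod hj hl h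
  have hsurj : ∀ d, ∃ j < k, c j = d := by
    have hmod : ∀ m, ∃ j < k, c j = c m := by
      intro m
      refine ⟨m % k, Nat.mod_lt _ hkpos, ?_⟩
      simp only [hc, hk]
      exact Function.iterate_mod_minimalPeriod_eq
    refine corner_mem_of_invariant {d | ∃ j < k, c j = d} ?_ (c₀ := c₀) ⟨0, hkpos, rfl⟩
    intro d
    constructor
    · rintro ⟨j, hj, hjd⟩
      have h1 : c (j + k) = nextCorner d := (hck j).trans hjd
      rw [show j + k = (j + k - 1) + 1 by omega, hcs] at h1
      obtain ⟨l, hl, hl'⟩ := hmod (j + k - 1)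
      exact ⟨l, hl, hl'.trans (nextCorner_injective h1)⟩
    · rintro ⟨j, hj, rfl⟩
      obtain ⟨l, hl, hl'⟩ := hmod (j + 1)
      exact ⟨l, hl, hl'.trans (hcs j)⟩
  choose ρ hρ hle hin using fun d : Corner T p =>
    exists_radius_vertex (T.area2_pos d.1.1) d.1.2
  obtain ⟨ρ₀, hρ₀, hmin⟩ := exists_pos_le_of_finite ρ hρ
  have hA0 : ∀ d : Corner T p, T.vert d.1.1 (d.1.2 + 1) - T.vert d.1.1 d.1.2 ≠ 0 := fun d =>
    vertex_sub_ne_zero (T.area2_pos _) (fin3_add_one_ne _)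
  refine ⟨{ k := k, pos := hkpos, τ := fun j => (c j).1.1, x := fun j => T.vert (c j).1.1 (c j).1.2
            d := fun j => dir (T.vert (c j).1.1 ((c j).1.2 + 1) - T.vert (c j).1.1 (c j).1.2)
            θ := fun j => cornerAngle (c j), ρ := ρ₀, ρ_pos := hρ₀
            period := fun j => by simp only [hck, and_self]
            θ_pos := fun j => (cornerAngle_pos (c j)).1
            sum := ?_
            unit := fun j => norm_dir (hA0 _)
            base_mem := fun j => T.vert_mem _ _
            base := fun j => (c j).2
            inside := fun j r ψ h1 h2 h3 h4 => hin (c j) r ψ h1 (h2.trans_le (hmin _)) h3 h4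
            sector := fun j y hy => exists_polar_of_mem_triangle (T.area2_pos _) _ hy
            glue := ?_, disj := ?_, complete := ?_ }⟩
  · rw [coneAngle_eq_sum c₀]
    refine Finset.sum_bij (fun j _ => c j) (fun _ _ => Finset.mem_univ _) ?_ ?_ (fun _ _ => rfl)
    · intro j hj l hl h
      exact hinj j l (Finset.mem_range.1 hj) (Finset.mem_range.1 hl) h
    · intro d _
      obtain ⟨j, hj, h⟩ := hsurj d
      exact ⟨j, Finset.mem_range.2 hj, h⟩
  · intro j r hr hr'
    rw [hcs]
    exact nextCorner_glue (c j) hr (hr'.le.trans ((hmin _).trans (hle _)))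
  · intro j l r s ψ χ hj hl hr hr' hs hs' hψ hψ' hχ hχ' heq
    by_contra hjl
    have hne : (c j).1.1 ≠ (c l).1.1 := fun h => hjl (hinj j l hj hl (Corner.ext_of_fst h))
    have hx := hin (c j) r ψ hr.le (hr'.trans_le (hmin _)) hψ hψ'.le
    have hy := hin (c l) s χ hs.le (hs'.trans_le (hmin _)) hχ hχ'.le
    -- In a half-open sector the closing edge, on which coordinate `i + 1` vanishes, is excluded. An
    -- edge at `p` shared by two triangles is the closing edge of one of them.
    have key : ∀ (d : Corner T p) (r ψ : ℝ), 0 < r → 0 ≤ ψ → ψ < cornerAngle d →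
        bary (T.vert d.1.1) (d.1.2 + 1) (T.vert d.1.1 d.1.2
          + r * dir (T.vert d.1.1 (d.1.2 + 1) - T.vert d.1.1 d.1.2) * cis ψ) ≠ 0 := by
      intro d r ψ hr hψ hψ'
      have hc := cornerAngle_pos d
      rw [(bary_polar_vertex (T.area2_pos _) _ r ψ).1]
      have h1 := Real.sin_pos_of_pos_of_lt_pi (x := cornerAngle d - ψ) (by linarith) (by linarith)
      have h2 := Real.sin_pos_of_pos_of_lt_pi hc.1 hc.2
      have h3 := norm_pos_iff.2 (hA0 d)
      unfold cornerAngle at h1 h2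
      positivity
    have hxne : T.vert (c j).1.1 (c j).1.2
        + r * dir (T.vert (c j).1.1 ((c j).1.2 + 1) - T.vert (c j).1.1 (c j).1.2) * cis ψ
        ≠ T.vert (c j).1.1 (c j).1.2 := by
      intro h
      rw [add_eq_left, ← norm_eq_zero, norm_mul_dir_mul_cis (hA0 _) hr.le] at h
      exact hr.ne' h
    rcases shared_edge_of_vertex hne ((c j).2.trans (c l).2.symm) hx hy heq hxne with h | h
    · exact key (c l) s χ hs hχ hχ' h.2.2
    · exact key (c j) r ψ hr hψ hψ' h.2.1
  · intro α y hy hyp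
    obtain ⟨i, rfl⟩ := exists_vert_eq (α := c₀.1.1) (i := c₀.1.2) hy (c₀.2.trans hyp.symm)
    obtain ⟨j, hj, h⟩ := hsurj ⟨(α, i), hyp⟩
    refine ⟨j, hj, ?_⟩
    simp [h]

/-- Every point has a fan. -/
theorem nonempty_fan (T : FlatSphere) (p : Sphere2) : Nonempty (Fan T p (T.coneAngle p)) := by
  by_cases hv : ∃ α i, T.param α (T.vert α i) = p
  · obtain ⟨α, i, h⟩ := hv
    exact nonempty_fan_of_vertex ⟨(α, i), h⟩
  have hang : T.coneAngle p = 2 * Real.pi := if_neg hv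
  rw [hang]
  obtain ⟨α, x, hx, rfl⟩ := T.exists_param_eq p
  have hx' := T.mem_tri_iff.1 hx
  by_cases hpos : ∀ i, 0 < bary (T.vert α) i x
  · exact nonempty_fan_of_interior hpos
  push Not at hpos
  obtain ⟨l, hl⟩ := hpos
  have hl0 : bary (T.vert α) l x = 0 := le_antisymm hl (hx' l)
  have hpos : ∀ m, m ≠ l → 0 < bary (T.vert α) m x := by
    intro m hm
    refine lt_of_le_of_ne (hx' m) fun h0 => hv ?_
    obtain ⟨q, hq1, hq2, hq3⟩ := fin3_exists_third l m hm
    refine ⟨α, q, ?_⟩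
    congr 1
    have hone : bary (T.vert α) q x = 1 := by
      have hsum : ∑ m', bary (T.vert α) m' x = bary (T.vert α) q x := by
        refine Finset.sum_eq_single q (fun m' _ hm' => ?_) fun h => absurd (Finset.mem_univ q) h
        rcases hq3 m' with rfl | rfl | rfl
        · exact hl0
        · exact h0.symm
        · exact absurd rfl hm'
      rw [← hsum]
      exact sum_bary (T.area2_ne α) x
    refine eq_of_bary_eq (T.area2_ne α) fun m' => ?_
    rcases hq3 m' with rfl | rfl | rfl
    · rw [hl0, bary_of_ne hq1]
    · rw [← h0, bary_of_ne hq2]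
    · rw [hone, bary_self (T.area2_ne α)]
  refine nonempty_fan_of_edge (i := l + 1) ?_ (hpos _ (fin3_add_one_ne l)) ?_
  · rw [fin3_add_one_add_two]; exact hl0
  · rw [fin3_add_one_add_one]; exact hpos _ (fin3_add_two_ne l)

end FlatSphere

/-! ### The atlas of a cone metric with cone angles `π` and `2π` -/

namespace FlatSphere

/-- There are finitely many triangles, and by injectivity each of them contains at most one point
over `p`. -/
theorem exists_uniform_radius (T : FlatSphere) (p : Sphere2) {P : Fin T.n → ℂ → ℝ → Prop}
    (hmono : ∀ α x δ ε, δ ≤ ε → P α x ε → P α x δ)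
    (h : ∀ α, ∀ x ∈ T.tri α, T.param α x = p → ∃ δ > 0, P α x δ) :
    ∃ δ : ℝ, 0 < δ ∧ ∀ α, ∀ x ∈ T.tri α, T.param α x = p → P α x δ := by
  have key : ∀ α, ∃ δ : ℝ, 0 < δ ∧ ∀ x ∈ T.tri α, T.param α x = p → P α x δ := by
    intro α
    by_cases hx : ∃ x ∈ T.tri α, T.param α x = p
    · obtain ⟨x, hx, hxp⟩ := hx
      obtain ⟨δ, hδ, hP⟩ := h α x hx hxp
      refine ⟨δ, hδ, fun y hy hyp => ?_⟩
      rwa [T.injOn α hy hx (hyp.trans hxp.symm)]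
    · exact ⟨1, one_pos, fun x hx' hxp => absurd ⟨x, hx', hxp⟩ hx⟩
  choose δ hδ hP using key
  obtain ⟨ε, hε, hle⟩ := exists_pos_le_of_finite δ hδ
  exact ⟨ε, hε, fun α x hx hxp => hmono α x ε (δ α) (hle α) (hP α x hx hxp)⟩

variable (T : FlatSphere)

/-- A chosen fan at each point. -/
def fan (p : Sphere2) : Fan T p (T.coneAngle p) := (T.nonempty_fan p).some

/-- Ensures that a chart disc contains no vertex besides possibly its centre, so that all its other
points have cone angle `2π`. -/
theorem exists_vertexFree_radius (p : Sphere2) : ∃ δ : ℝ, 0 < δ ∧ ∀ α, ∀ x ∈ T.tri α,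
    T.param α x = p → ∀ i, T.vert α i ≠ x → δ ≤ ‖T.vert α i - x‖ := by
  refine T.exists_uniform_radius p (P := fun α x δ => ∀ i, T.vert α i ≠ x → δ ≤ ‖T.vert α i - x‖)
    (fun α x δ ε hle h i hi => hle.trans (h i hi)) fun α x _ _ => ?_
  have := exists_pos_le_of_finite (fun i : {i // T.vert α i ≠ x} => ‖T.vert α i - x‖)
    fun i => norm_pos_iff.2 (sub_ne_zero.2 i.2)
  obtain ⟨δ, hδ, h⟩ := this
  exact ⟨δ, hδ, fun i hi => h ⟨i, hi⟩⟩

/-- The radius of the chart at a point. -/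
def chartRadius (p : Sphere2) : ℝ := min (T.fan p).ρ (T.exists_vertexFree_radius p).choose

theorem chartRadius_pos (p : Sphere2) : 0 < T.chartRadius p :=
  lt_min (T.fan p).ρ_pos (T.exists_vertexFree_radius p).choose_spec.1

theorem chartRadius_le (p : Sphere2) : T.chartRadius p ≤ (T.fan p).ρ := min_le_left _ _

variable {T}

/-- Every piece around a point is a rotated part of the chart at this point. -/
theorem fan_chart_eq_param (hT : ∀ p, T.coneAngle p = Real.pi ∨ T.coneAngle p = 2 * Real.pi)
    {α : Fin T.n} {x : ℂ} (hx : x ∈ T.tri α) : ∃ c : ℂ, ‖c‖ = 1 ∧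
    ∀ u, ‖u‖ < (T.fan (T.param α x)).ρ → x + c * u ∈ T.tri α →
      (T.fan (T.param α x)).chart u = T.param α (x + c * u) := by
  obtain ⟨p, hp⟩ : ∃ p, T.param α x = p := ⟨_, rfl⟩
  rw [hp]
  set F := T.fan p with hF
  obtain ⟨j, hj, hjα, hjx⟩ := F.complete α x hx hp
  refine ⟨F.d j * (cis (F.start j))⁻¹, by rw [norm_mul, norm_inv, norm_cis, F.unit]; norm_num,
    fun u hu hmem => ?_⟩
  rw [← hjx] at hmem ⊢
  rw [← hjα] at hmem ⊢
  exact F.chart_eq_param (hT _) hu hmem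

theorem fan_exists_sector (hT : ∀ p, T.coneAngle p = Real.pi ∨ T.coneAngle p = 2 * Real.pi)
    (p : Sphere2) : ∃ (k : ℕ) (α : ℕ → Fin T.n) (x c : ℕ → ℂ),
      (∀ j, x j ∈ T.tri (α j) ∧ T.param (α j) (x j) = p ∧ ‖c j‖ = 1 ∧
        ∀ u, ‖u‖ < (T.fan p).ρ → x j + c j * u ∈ T.tri (α j) →
          (T.fan p).chart u = T.param (α j) (x j + c j * u)) ∧
      ∀ u, ‖u‖ < (T.fan p).ρ → ∃ j < k, x j + c j * u ∈ T.tri (α j) := by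
  set F := T.fan p
  refine ⟨F.k + F.k, F.τ, F.x, fun j => F.d j * (cis (F.start j))⁻¹, fun j => ⟨F.base_mem j, F.base j,
    by rw [norm_mul, norm_inv, norm_cis, F.unit]; norm_num, fun u hu h =>
      F.chart_eq_param (hT p) hu h⟩, fun u hu => F.exists_sector (hT p) hu⟩

theorem fan_chart_zero (p : Sphere2) : (T.fan p).chart 0 = p := by
  rw [Fan.chart, norm_zero, Fan.polar_zero]

theorem fan_eventually_param (hT : ∀ p, T.coneAngle p = Real.pi ∨ T.coneAngle p = 2 * Real.pi)
    {α : Fin T.n} {x : ℂ} (hx : x ∈ T.tri α) : ∃ b : ℂ, ‖b‖ = 1 ∧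
    ∀ᶠ v in 𝓝[T.tri α] x, T.param α v = (T.fan (T.param α x)).chart (b * (v - x)) := by
  obtain ⟨c, hc, h⟩ := fan_chart_eq_param hT hx
  have hc0 : c ≠ 0 := by rintro rfl; simp at hc
  refine ⟨c⁻¹, by rw [norm_inv, hc, inv_one], ?_⟩
  filter_upwards [ConeAtlas.eventually_norm_mul_sub_lt c⁻¹ x (T.tri α)
    (T.fan (T.param α x)).ρ_pos, self_mem_nhdsWithin] with v hv hvt
  have hform : x + c * (c⁻¹ * (v - x)) = v := by field_simp; ring
  have := h (c⁻¹ * (v - x)) hv (by rwa [hform])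
  rw [this, hform]

/-- The parts of the triangles at distance at least `s'` from the points over `p` have compact
images, whose union omits `p`. Its complement is covered by the chart. A triangle without a point
over `p` belongs entirely to the removed set. -/
theorem fan_image_mem_nhds (hT : ∀ p, T.coneAngle p = Real.pi ∨ T.coneAngle p = 2 * Real.pi)
    (p : Sphere2) {s : ℝ} (hs : 0 < s) : (T.fan p).chart '' Metric.ball 0 s ∈ 𝓝 p := by
  set s' := min s (T.fan p).ρ with hs'
  have hs'0 : 0 < s' := lt_min hs (T.fan p).ρ_pos
  set K : Fin T.n → Set ℂ := fun α => {v | ∀ x ∈ T.tri α, T.param α x = p → s' ≤ ‖v - x‖} with hK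
  have hKc : ∀ α, IsClosed (K α) := by
    intro α
    simp only [hK, Set.ofPred_forall]
    refine isClosed_iInter fun x => isClosed_iInter fun _ => isClosed_iInter fun _ => ?_
    exact isClosed_le continuous_const (by fun_prop)
  have hcl : IsClosed (⋃ α, T.param α '' (T.tri α ∩ K α)) := by
    refine isClosed_iUnion_of_finite fun α => ?_
    exact (((T.isCompact_tri α).inter_right (hKc α)).image_of_continuousOn
      ((T.continuousOn α).mono Set.inter_subset_left)).isClosed
  have hp : p ∉ ⋃ α, T.param α '' (T.tri α ∩ K α) := by
    intro hp
    obtain ⟨α, x, ⟨hx, hxK⟩, hxp⟩ := Set.mem_iUnion.1 hp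
    have := hxK x hx hxp
    rw [sub_self, norm_zero] at this
    linarith
  refine Filter.mem_of_superset (hcl.isOpen_compl.mem_nhds hp) fun q hq => ?_
  obtain ⟨α, v, hv, rfl⟩ := T.exists_param_eq q
  have hvK : v ∉ K α := fun h => hq (Set.mem_iUnion.2 ⟨α, v, ⟨hv, h⟩, rfl⟩)
  simp only [hK, Set.mem_ofPred_eq, not_forall, not_le] at hvK
  obtain ⟨x, hx, rfl, hxs⟩ := hvK
  obtain ⟨c, hc, h⟩ := fan_chart_eq_param hT hx
  have hc0 : c ≠ 0 := by rintro rfl; simp at hc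
  have hn : ‖c⁻¹ * (v - x)‖ = ‖v - x‖ := by rw [norm_mul, norm_inv, hc, inv_one, one_mul]
  have hform : x + c * (c⁻¹ * (v - x)) = v := by field_simp; ring
  refine ⟨c⁻¹ * (v - x), ?_, ?_⟩
  · rw [mem_ball_zero_iff, hn]
    exact hxs.trans_le (min_le_left _ _)
  · rw [h _ (by rw [hn]; exact hxs.trans_le (min_le_right _ _)) (by rwa [hform]), hform]

theorem fan_continuousAt_zero (hT : ∀ p, T.coneAngle p = Real.pi ∨ T.coneAngle p = 2 * Real.pi)
    (p : Sphere2) : ContinuousAt (T.fan p).chart 0 := by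
  intro U hU
  rw [fan_chart_zero] at hU
  obtain ⟨δ, hδ, h⟩ := T.exists_uniform_radius p
    (P := fun α x δ => ∀ y ∈ T.tri α, ‖y - x‖ < δ → T.param α y ∈ U)
    (fun α x δ ε hle h y hy hyx => h y hy (hyx.trans_le hle)) (fun α x hx hxp => by
      have hc := T.continuousOn α x hx
      rw [ContinuousWithinAt, hxp] at hc
      obtain ⟨δ, hδ, h⟩ := Metric.mem_nhdsWithin_iff.1 (hc hU)
      exact ⟨δ, hδ, fun y hy hyx => h ⟨by rwa [Metric.mem_ball, dist_eq_norm], hy⟩⟩)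
  obtain ⟨k, α, x, c, h1, h2⟩ := fan_exists_sector hT p
  rw [Filter.mem_map]
  refine Metric.mem_nhds_iff.2 ⟨min δ (T.fan p).ρ, lt_min hδ (T.fan p).ρ_pos, fun u hu => ?_⟩
  rw [mem_ball_zero_iff] at hu
  have hu' := hu.trans_le (min_le_right _ _)
  obtain ⟨j, -, hj⟩ := h2 u hu'
  obtain ⟨h3, h4, h5, h6⟩ := h1 j
  rw [Set.mem_preimage, h6 u hu' hj]
  refine h _ _ h3 h4 _ hj ?_
  rw [add_sub_cancel_left, norm_mul, h5, one_mul]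
  exact hu.trans_le (min_le_left _ _)

theorem not_vertex_of_chart {p : Sphere2}
    (hT : ∀ p, T.coneAngle p = Real.pi ∨ T.coneAngle p = 2 * Real.pi) {u : ℂ}
    (hu : ‖u‖ < T.chartRadius p) (hu0 : u ≠ 0) :
    T.coneAngle ((T.fan p).chart u) = 2 * Real.pi := by
  refine if_neg ?_
  rintro ⟨α, i, h⟩
  have hu' := hu.trans_le (T.chartRadius_le p)
  obtain ⟨k, β, x, c, h1, h2⟩ := fan_exists_sector hT p
  obtain ⟨j, -, hj⟩ := h2 u hu'
  obtain ⟨h3, h4, h5, h6⟩ := h1 j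
  rw [h6 u hu' hj] at h
  obtain ⟨m, hm⟩ := exists_vert_eq hj h
  have h7 := (T.exists_vertexFree_radius p).choose_spec.2 (β j) (x j) h3 h4 m
  rw [hm] at h7
  have hc0 : c j ≠ 0 := by
    intro h0
    rw [h0] at h5
    simp at h5
  have h8 := h7 (by rw [Ne, add_eq_left]; exact mul_ne_zero hc0 hu0)
  rw [add_sub_cancel_left, norm_mul, h5, one_mul] at h8
  exact absurd (hu.trans_le (min_le_right _ _)) (not_lt.2 h8)

/-- Near `u ≠ 0` only the finitely many sectors through `u` matter. Each is developed at the new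
centre by some rotation, and these rotations coincide because the sectors have a segment in common
and the chart there, having angle `2π`, is injective. -/
theorem fan_transition (hT : ∀ p, T.coneAngle p = Real.pi ∨ T.coneAngle p = 2 * Real.pi)
    (p : Sphere2) {u : ℂ} (hu : ‖u‖ < T.chartRadius p) : ∃ a : ℂ, ‖a‖ = 1 ∧
      ∀ᶠ v in 𝓝 u, (T.fan p).chart v = (T.fan ((T.fan p).chart u)).chart (a * (v - u)) := by
  by_cases hu0 : u = 0
  · subst hu0
    refine ⟨1, norm_one, Filter.Eventually.of_forall fun v => ?_⟩
    rw [fan_chart_zero, sub_zero, one_mul]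
  have hq2π := not_vertex_of_chart hT hu hu0
  have hu' := hu.trans_le (T.chartRadius_le p)
  obtain ⟨k, α, x, c, h1, h2⟩ := fan_exists_sector hT p
  set q := (T.fan p).chart u with hq
  -- each sector through `u` is developed by a rotation
  have hsec : ∀ j, x j + c j * u ∈ T.tri (α j) → ∃ b : ℂ, ‖b‖ = 1 ∧
      ∀ᶠ v in 𝓝 u, x j + c j * v ∈ T.tri (α j) →
        (T.fan p).chart v = (T.fan q).chart (b * (v - u)) := by
    intro j hj
    obtain ⟨h3, h4, h5, h6⟩ := h1 j
    obtain ⟨b, hb, h7⟩ := fan_eventually_param hT hj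
    rw [← h6 u hu' hj, ← hq, eventually_nhdsWithin_iff] at h7
    refine ⟨b * c j, by rw [norm_mul, hb, h5, one_mul], ?_⟩
    have ht : Filter.Tendsto (fun v => x j + c j * v) (𝓝 u) (𝓝 (x j + c j * u)) := by
      have : ContinuousAt (fun v => x j + c j * v) u := by fun_prop
      exact this.tendsto
    have hnear : ∀ᶠ v in 𝓝 u, ‖v‖ < (T.fan p).ρ := continuousAt_id.norm.eventually_lt_const hu'
    filter_upwards [ht.eventually h7, hnear] with v h8 h9 h10
    rw [h6 v h9 h10, h8 h10]
    congr 1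
    ring
  -- the rotations agree
  have huniq : ∀ j l b d, x j + c j * u ∈ T.tri (α j) → x l + c l * u ∈ T.tri (α l) → ‖b‖ = 1 →
      ‖d‖ = 1 → (∀ᶠ v in 𝓝 u, x j + c j * v ∈ T.tri (α j) →
        (T.fan p).chart v = (T.fan q).chart (b * (v - u))) → (∀ᶠ v in 𝓝 u, x l + c l * v ∈ T.tri (α l) →
        (T.fan p).chart v = (T.fan q).chart (d * (v - u))) → b = d := by
    intro j l b d hj hl hb hd h3 h4
    -- Test points on the segment from `u` towards the centre: by convexity they lie in every sector
    -- through `u`.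
    have ht : Filter.Tendsto (fun s : ℝ => (1 - s : ℂ) * u) (𝓝[>] 0) (𝓝 u) := by
      have : ContinuousAt (fun s : ℝ => (1 - s : ℂ) * u) 0 := by fun_prop
      have h5 := this.tendsto
      simp only [Complex.ofReal_zero, sub_zero, one_mul] at h5
      exact h5.mono_left nhdsWithin_le_nhds
    have hsmall : ∀ᶠ v in 𝓝 u, ‖v - u‖ < (T.fan q).ρ := by
      have : ContinuousAt (fun v => ‖v - u‖) u := by fun_prop
      refine this.eventually_lt_const ?_
      change ‖u - u‖ < _
      rw [sub_self, norm_zero]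
      exact (T.fan q).ρ_pos
    obtain ⟨s, ⟨h5, h6, h7⟩, hs⟩ := ((ht.eventually (h3.and (h4.and hsmall))).and
      (Ioo_mem_nhdsGT one_pos)).exists
    have hmem : ∀ m, x m + c m * u ∈ T.tri (α m) → x m + c m * ((1 - s : ℂ) * u) ∈ T.tri (α m) := by
      intro m hm
      have heq : x m + c m * ((1 - s : ℂ) * u) = s • x m + (1 - s) • (x m + c m * u) := by
        rw [Complex.real_smul, Complex.real_smul]
        push_cast
        ring
      rw [heq]
      exact convex_triangle (h1 m).1 hm hs.1.le (by linarith [hs.2]) (by ring)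
    have h8 := (h5 (hmem j hj)).symm.trans (h6 (hmem l hl))
    have hne : (1 - s : ℂ) * u - u ≠ 0 := by
      have : (1 - s : ℂ) * u - u = -(s * u) := by ring
      rw [this, neg_ne_zero]
      exact mul_ne_zero (by exact_mod_cast hs.1.ne') hu0
    rcases (T.fan q).eq_or_eq_neg (hT q) (by rw [norm_mul, hb, one_mul]; exact h7)
      (by rw [norm_mul, hd, one_mul]; exact h7) h8 with h9 | ⟨-, h9⟩
    · exact mul_right_cancel₀ hne h9
    · rw [hq2π] at h9
      linarith [Real.pi_pos]
  obtain ⟨j₀, hj₀k, hj₀⟩ := h2 u hu'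
  obtain ⟨a, ha, hdev⟩ := hsec j₀ hj₀
  refine ⟨a, ha, ?_⟩
  have hall : ∀ᶠ v in 𝓝 u, ∀ j ∈ Finset.range k, x j + c j * v ∈ T.tri (α j) →
      (T.fan p).chart v = (T.fan q).chart (a * (v - u)) := by
    refine (Filter.eventually_all_finset _).2 fun j _ => ?_
    by_cases hj : x j + c j * u ∈ T.tri (α j)
    · obtain ⟨b, hb, h3⟩ := hsec j hj
      rwa [huniq j₀ j a b hj₀ hj ha hb hdev h3]
    · have ht : ContinuousAt (fun v => x j + c j * v) u := by fun_prop
      filter_upwards [ht.eventually ((T.isCompact_tri (α j)).isClosed.isOpen_compl.mem_nhds hj)]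
        with v hv hv'
      exact absurd hv' hv
  have hnear : ∀ᶠ v in 𝓝 u, ‖v‖ < (T.fan p).ρ := continuousAt_id.norm.eventually_lt_const hu'
  filter_upwards [hall, hnear] with v h3 h4
  obtain ⟨j, hj, hmem⟩ := h2 v h4
  exact h3 j (Finset.mem_range.2 hj) hmem

/-- The atlas of a cone metric all of whose cone angles are `π` or `2π`. -/
def atlas (T : FlatSphere) (hT : ∀ p, T.coneAngle p = Real.pi ∨ T.coneAngle p = 2 * Real.pi) :
    ConeAtlas Sphere2 where
  radius := T.chartRadius
  chart p := (T.fan p).chart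
  conic := {p | T.coneAngle p = Real.pi}
  radius_pos := T.chartRadius_pos
  chart_zero := fan_chart_zero
  continuousAt_zero := fan_continuousAt_zero hT
  image_mem_nhds p _ hs := fan_image_mem_nhds hT p hs
  eq_or_eq_neg p _ _ hu hv h := (T.fan p).eq_or_eq_neg (hT p)
    (hu.trans_le (T.chartRadius_le p)) (hv.trans_le (T.chartRadius_le p)) h
  chart_neg p hp _ hu := (T.fan p).chart_neg (hT p) hp (hu.trans_le (T.chartRadius_le p))
  transition p _ hu := fan_transition hT p hu

theorem developsAt_param (hT : ∀ p, T.coneAngle p = Real.pi ∨ T.coneAngle p = 2 * Real.pi)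
    {α : Fin T.n} {x : ℂ} (hx : x ∈ T.tri α) :
    (T.atlas hT).DevelopsAt (T.param α) (T.tri α) x :=
  fan_eventually_param hT hx

/-- A radius of a chart disc runs inside one sector and is therefore a straight segment in one
triangle. This supplies the local chains for the length metric. -/
theorem exists_segment_of_chart (hT : ∀ p, T.coneAngle p = Real.pi ∨ T.coneAngle p = 2 * Real.pi)
    {p : Sphere2} {u : ℂ} (hu : ‖u‖ < T.chartRadius p) : ∃ α, ∃ x ∈ T.tri α, ∃ y ∈ T.tri α,
      T.param α x = p ∧ T.param α y = (T.atlas hT).chart p u ∧ ‖x - y‖ = ‖u‖ := by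
  have hu' := hu.trans_le (T.chartRadius_le p)
  obtain ⟨k, α, x, c, h1, h2⟩ := fan_exists_sector hT p
  obtain ⟨j, -, hj⟩ := h2 u hu'
  obtain ⟨h3, h4, h5, h6⟩ := h1 j
  refine ⟨α j, x j, h3, _, hj, h4, (h6 u hu' hj).symm, ?_⟩
  rw [sub_add_cancel_left, norm_neg, norm_mul, h5, one_mul]

theorem IsPiPiPiPi.coneAngle_eq (h : T.IsPiPiPiPi) (p : Sphere2) :
    T.coneAngle p = Real.pi ∨ T.coneAngle p = 2 * Real.pi := by
  by_cases hp : T.coneAngle p = 2 * Real.pi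
  · exact Or.inr hp
  · exact Or.inl (h.2 p hp)

theorem IsPiPiPiPi.exists_coneAngle_eq_pi (h : T.IsPiPiPiPi) : ∃ p, T.coneAngle p = Real.pi := by
  have hne : T.singularSet.Nonempty := by
    rw [Set.nonempty_iff_ne_empty]
    intro h0
    have := h.1
    rw [h0, Set.ncard_empty] at this
    norm_num at this
  obtain ⟨p, hp⟩ := hne
  exact ⟨p, h.2 p hp⟩

end FlatSphere

/-! ### Uniformization of cone metrics with four cone angles `π` -/

/-- The lattice spanned by two complex numbers. -/
def lattice (z : Fin 2 → ℂ) : AddSubgroup ℂ where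
  carrier := {b | ∃ m n : ℤ, b = m * z 0 + n * z 1}
  add_mem' := by
    rintro _ _ ⟨m, n, rfl⟩ ⟨k, l, rfl⟩
    exact ⟨m + k, n + l, by push_cast; ring⟩
  zero_mem' := ⟨0, 0, by simp⟩
  neg_mem' := by
    rintro _ ⟨m, n, rfl⟩
    exact ⟨-m, -n, by push_cast; ring⟩

theorem mem_lattice {z : Fin 2 → ℂ} {b : ℂ} :
    b ∈ lattice z ↔ ∃ m n : ℤ, b = m * z 0 + n * z 1 := Iff.rfl

theorem countable_lattice (z : Fin 2 → ℂ) : (lattice z : Set ℂ).Countable := by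
  refine (Set.countable_range fun p : ℤ × ℤ => (p.1 * z 0 + p.2 * z 1 : ℂ)).mono ?_
  rintro b ⟨m, n, rfl⟩
  exact ⟨(m, n), rfl⟩

instance : PreconnectedSpace Sphere2 := by
  refine isPreconnected_iff_preconnectedSpace.1 (isPreconnected_sphere ?_ 0 1)
  rw [rank_eq_card_basis (EuclideanSpace.basisFun (Fin 3) ℝ).toBasis]
  norm_num

namespace FlatSphere

/-- The atlas of a cone metric with four cone angles `π`. -/
def IsPiPiPiPi.atlas {T : FlatSphere} (hT : T.IsPiPiPiPi) : ConeAtlas Sphere2 :=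
  T.atlas hT.coneAngle_eq

/-- `E` identifies the cone metric with the quotient of the plane by the group generated by the
translations by the lattice of `z` and the half turn about `0`. -/
structure IsUniformized {T : FlatSphere} (hT : T.IsPiPiPiPi) (z : Fin 2 → ℂ) (E : ℂ → Sphere2) :
    Prop where
  developsAt : ∀ x, hT.atlas.DevelopsAt E Set.univ x
  apply_eq_iff : ∀ x y, E x = E y ↔ x - y ∈ lattice z ∨ x + y ∈ lattice z

/-- The development is based at a singular point, so that `E` is even and its fibres are described
by periods alone. -/
theorem IsPiPiPiPi.exists_isUniformized {T : FlatSphere} (hT : T.IsPiPiPiPi) :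
    ∃ z ∈ Hplus, ∃ E, IsUniformized hT z E := by
  obtain ⟨p, hp⟩ := hT.exists_coneAngle_eq_pi
  obtain ⟨E, hE, h0⟩ := ConeAtlas.exists_developing hT.atlas p
  have h0' : E 0 ∈ hT.atlas.conic := by rw [h0]; exact hp
  obtain ⟨z, hz, h⟩ := ConeAtlas.exists_lattice hE h0'
  refine ⟨z, hz, E, hE, fun x y => ?_⟩
  rw [ConeAtlas.apply_eq_iff_periods hE h0', h, h]
  rfl

/-- Every triangle is developed by a direct isometry. -/
theorem IsPiPiPiPi.exists_param_eq {T : FlatSphere} (hT : T.IsPiPiPiPi) {E : ℂ → Sphere2}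
    (hE : ∀ x, hT.atlas.DevelopsAt E Set.univ x) (α : Fin T.n) :
    ∃ a b : ℂ, ‖a‖ = 1 ∧ ∀ v ∈ T.tri α, T.param α v = E (a * v + b) := by
  have hx := T.vert_mem α 0
  set x := T.vert α 0
  obtain ⟨y, hy⟩ := ConeAtlas.surjective_of_developsAt hE (T.param α x)
  obtain ⟨a, ha, h1⟩ := developsAt_param hT.coneAngle_eq hx
  obtain ⟨c, hc, h2⟩ := hE y
  rw [nhdsWithin_univ, hy] at h2
  have hc0 : c ≠ 0 := by rintro rfl; simp at hc
  have hn : ‖c⁻¹ * a‖ = 1 := by rw [norm_mul, norm_inv, hc, ha]; norm_num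
  refine ⟨c⁻¹ * a, y - c⁻¹ * a * x, hn, fun v hv => ?_⟩
  refine ConeAtlas.eqOn_of_developsAt (A := hT.atlas)
    (G := fun v => E (c⁻¹ * a * v + (y - c⁻¹ * a * x)))
    (convex_triangle : Convex ℝ (T.tri α)).isPreconnected
    (fun u hu => developsAt_param hT.coneAngle_eq hu)
    (fun u _ => ((hE _).comp_affine hn).mono (by simp)) hx ?_ hv
  have ht : Filter.Tendsto (fun v => c⁻¹ * a * v + (y - c⁻¹ * a * x)) (𝓝[T.tri α] x) (𝓝 y) := by
    have : ContinuousAt (fun v => c⁻¹ * a * v + (y - c⁻¹ * a * x)) x := by fun_prop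
    have h3 := this.tendsto
    rw [add_sub_cancel] at h3
    exact h3.mono_left nhdsWithin_le_nhds
  filter_upwards [h1, ht.eventually h2] with v h3 h4
  rw [h3, h4]
  congr 1
  field_simp
  ring

namespace IsUniformized

variable {T : FlatSphere} {hT : T.IsPiPiPiPi} {z : Fin 2 → ℂ} {E : ℂ → Sphere2}

theorem continuous (h : IsUniformized hT z E) : Continuous E :=
  ConeAtlas.continuous_of_developsAt h.developsAt

theorem isOpenMap (h : IsUniformized hT z E) : IsOpenMap E :=
  ConeAtlas.isOpenMap_of_developsAt h.developsAt

theorem surjective (h : IsUniformized hT z E) : Function.Surjective E :=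
  ConeAtlas.surjective_of_developsAt h.developsAt

theorem mem_lattice_iff (h : IsUniformized hT z E) {b : ℂ} :
    b ∈ lattice z ↔ ∀ v, E (v + b) = E v := by
  refine ⟨fun hb v => (h.apply_eq_iff _ _).2 (Or.inl (by rwa [add_sub_cancel_left])), fun hb => ?_⟩
  have := (h.apply_eq_iff _ _).1 (hb 0)
  simpa using this

theorem mem_conic_iff (h : IsUniformized hT z E) {w : ℂ} :
    E w ∈ hT.atlas.conic ↔ 2 * w ∈ lattice z := by
  rw [ConeAtlas.mem_conic_iff h.developsAt]
  constructor
  · intro h1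
    have := (h.apply_eq_iff _ _).1 (h1 0)
    simpa using this
  · intro hw v
    exact (h.apply_eq_iff _ _).2 (Or.inr (by rwa [sub_add_cancel]))

/-- The general description of the length metric by nearest lifts applies, as the triangles are
developed by direct isometries and short radii are segments of triangles. -/
theorem isLeast_dist (h : IsUniformized hT z E) (x y : ℂ) :
    IsLeast {d | ∃ y', E y' = E y ∧ d = ‖x - y'‖} (T.dist (E x) (E y)) := by
  refine isLeast_gluedDist h.continuous (hT.exists_param_eq h.developsAt)
    (fun z w hzw => ConeAtlas.exists_deck h.developsAt hzw) (fun w => ?_) x y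
  obtain ⟨a, ha, h1⟩ := h.developsAt w
  rw [nhdsWithin_univ] at h1
  have hr := ConeAtlas.eventually_norm_mul_sub_lt a w Set.univ (T.chartRadius_pos (E w))
  rw [nhdsWithin_univ] at hr
  filter_upwards [h1, hr] with u h2 h3
  obtain ⟨α, x, hx, y, hy, h4, h5, h6⟩ := exists_segment_of_chart hT.coneAngle_eq h3
  refine ⟨α, x, hx, y, hy, h4, h5.trans h2.symm, ?_⟩
  rw [h6, norm_mul, ha, one_mul, norm_sub_rev]

theorem exists_param_eq_near (h : IsUniformized hT z E) {α : Fin T.n} {v x : ℂ}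
    (hv : v ∈ interior (T.tri α)) (hx : E x = T.param α v) :
    ∃ a : ℂ, ∀ᶠ u in 𝓝 x, E u = T.param α (v + a * (u - x)) := by
  obtain ⟨a, b, ha, h1⟩ := hT.exists_param_eq h.developsAt α
  have ha0 : a ≠ 0 := by rintro rfl; simp at ha
  rw [h1 v (interior_subset hv)] at hx
  obtain ⟨c, hc, h2⟩ := ConeAtlas.exists_deck h.developsAt hx
  refine ⟨a⁻¹ * c, ?_⟩
  have ht : Filter.Tendsto (fun u => v + a⁻¹ * c * (u - x)) (𝓝 x) (𝓝 v) := by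
    have : ContinuousAt (fun u => v + a⁻¹ * c * (u - x)) x := by fun_prop
    have h3 := this.tendsto
    rwa [sub_self, mul_zero, add_zero] at h3
  filter_upwards [ht.eventually (isOpen_interior.mem_nhds hv)] with u hu
  rw [h1 _ (interior_subset hu), ← h2 u]
  congr 1
  field_simp
  ring

theorem exists_eventually_param_eq (h : IsUniformized hT z E) {α : Fin T.n} {v : ℂ}
    (hv : v ∈ interior (T.tri α)) :
    ∃ a b : ℂ, T.param α v = E (a * v + b) ∧ ∀ᶠ u in 𝓝 v, T.param α u = E (a * u + b) := by
  obtain ⟨a, b, -, h1⟩ := hT.exists_param_eq h.developsAt α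
  refine ⟨a, b, h1 v (interior_subset hv), ?_⟩
  filter_upwards [isOpen_interior.mem_nhds hv] with u hu
  exact h1 u (interior_subset hu)

/-- The distance is realized by a lift `y'` of `E y` no farther from `x` than `y` is. So `y'` stays
near `w`, where it can only be `y` or its image under the half turn about `w`. -/
theorem dist_eq_or (h : IsUniformized hT z E) (w : ℂ) : ∃ ε > 0, ∀ x y, ‖x - w‖ < ε →
    ‖y - w‖ < ε → T.dist (E x) (E y) = ‖x - y‖ ∨
      (T.dist (E x) (E y) = ‖(x - w) + (y - w)‖ ∧ E w ∈ hT.atlas.conic) := by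
  obtain ⟨ε, hε, h1⟩ := ConeAtlas.exists_injOn_or h.developsAt w
  -- `‖y' - w‖ ≤ 2 ‖x - w‖ + ‖y - w‖`, which explains the third of `ε`.
  refine ⟨ε / 3, by positivity, fun x y hx hy => ?_⟩
  obtain ⟨⟨y', hy', h2⟩, h3⟩ := h.isLeast_dist x y
  have h4 := h3 ⟨y, rfl, rfl⟩
  have h5 : ‖x - y‖ ≤ ‖x - w‖ + ‖y - w‖ := by
    calc ‖x - y‖ = ‖(x - w) - (y - w)‖ := by congr 1; ring
      _ ≤ _ := norm_sub_le _ _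
  have h6 : ‖y' - w‖ ≤ ‖x - w‖ + ‖x - y'‖ := by
    calc ‖y' - w‖ = ‖(x - w) - (x - y')‖ := by congr 1; ring
      _ ≤ _ := norm_sub_le _ _
  rcases h1 y' y (by linarith) (by linarith) hy' with rfl | ⟨h7, h8⟩
  · exact Or.inl h2
  · refine Or.inr ⟨?_, h8⟩
    rw [h2]
    congr 1
    linear_combination -h7

theorem dist_le_add (h : IsUniformized hT z E) {w : ℂ} (hw : E w ∈ hT.atlas.conic) (x y : ℂ) :
    T.dist (E x) (E y) ≤ ‖(x - w) + (y - w)‖ := by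
  refine (h.isLeast_dist x y).2 ⟨2 * w - y, (ConeAtlas.mem_conic_iff h.developsAt).1 hw y, ?_⟩
  congr 1
  ring

theorem dist_le (h : IsUniformized hT z E) (x y : ℂ) : T.dist (E x) (E y) ≤ ‖x - y‖ :=
  (h.isLeast_dist x y).2 ⟨y, rfl, rfl⟩

end IsUniformized

end FlatSphere

/-! ### Rigidity of local isometries -/

theorem norm_sq_sub_eq (x y : ℂ) :
    ‖x - y‖ ^ 2 = ‖x‖ ^ 2 + ‖y‖ ^ 2 - 2 * (x.re * y.re + x.im * y.im) := by
  simp only [← Complex.normSq_eq_norm_sq, Complex.normSq_apply, Complex.sub_re, Complex.sub_im]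
  ring

/-- An isometric map of a disc is a direct or an opposite isometry of the plane. -/
theorem eq_rotation_or_reflection_of_isometry {h : ℂ → ℂ} {x : ℂ} {δ : ℝ} (hδ : 0 < δ)
    (hh : ∀ u v, ‖u - x‖ < δ → ‖v - x‖ < δ → ‖h u - h v‖ = ‖u - v‖) :
    ∃ a : ℂ, ‖a‖ = 1 ∧ ((∀ u, ‖u - x‖ < δ → h u = h x + a * (u - x)) ∨
      (∀ u, ‖u - x‖ < δ → h u = h x + a * star (u - x))) := by
  have hxx : ‖x - x‖ < δ := by simpa
  set e : ℝ := δ / 2 with he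
  have he0 : 0 < e := half_pos hδ
  have heC : (e : ℂ) ≠ 0 := by exact_mod_cast he0.ne'
  have hne : ‖(e : ℂ)‖ = e := by rw [Complex.norm_real, Real.norm_of_nonneg he0.le]
  have hxe : ‖x + e - x‖ < δ := by rw [add_sub_cancel_left, hne]; linarith
  have hxi : ‖x + e * Complex.I - x‖ < δ := by
    rw [add_sub_cancel_left, norm_mul, hne, Complex.norm_I]; linarith
  set a : ℂ := (h (x + e) - h x) / e with ha
  have ha1 : ‖a‖ = 1 := by
    rw [ha, norm_div, hh _ _ hxe hxx, add_sub_cancel_left, div_self]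
    rw [hne]; exact he0.ne'
  have ha0 : a ≠ 0 := by intro h0; rw [h0] at ha1; simp at ha1
  -- Normalized so that `x` goes to `0` and `x + e` to `e`. Polarization shows that inner products
  -- are preserved, so real parts are kept, and the sign of the image of `x + e i` decides between
  -- rotation and reflection.
  set g : ℂ → ℂ := fun u => (h u - h x) / a with hg
  have hgn : ∀ u v, ‖u - x‖ < δ → ‖v - x‖ < δ → ‖g u - g v‖ = ‖u - v‖ := by
    intro u v hu hv
    rw [hg]
    simp only
    rw [← sub_div, sub_sub_sub_cancel_right, norm_div, ha1, div_one, hh u v hu hv]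
  have hgx : g x = 0 := by simp [hg]
  have hgN : ∀ u, ‖u - x‖ < δ → ‖g u‖ = ‖u - x‖ := by
    intro u hu
    have := hgn u x hu hxx
    rwa [hgx, sub_zero] at this
  have hinner : ∀ u v, ‖u - x‖ < δ → ‖v - x‖ < δ →
      (g u).re * (g v).re + (g u).im * (g v).im
        = (u - x).re * (v - x).re + (u - x).im * (v - x).im := by
    intro u v hu hv
    have h1 := norm_sq_sub_eq (g u) (g v)
    have h2 := norm_sq_sub_eq (u - x) (v - x)
    rw [hgn u v hu hv, hgN u hu, hgN v hv] at h1
    rw [sub_sub_sub_cancel_right] at h2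
    linarith
  have hge : g (x + e) = e := by
    simp only [hg]
    have hd : h (x + e) - h x = a * e := by rw [ha]; field_simp
    rw [hd, mul_div_cancel_left₀ _ ha0]
  have hre : ∀ u, ‖u - x‖ < δ → (g u).re = (u - x).re := by
    intro u hu
    have := hinner u _ hu hxe
    rw [hge, add_sub_cancel_left] at this
    simp only [Complex.ofReal_re, Complex.ofReal_im, mul_zero, add_zero] at this
    exact mul_right_cancel₀ he0.ne' this
  have hi := hinner _ _ hxi hxi
  rw [hre _ hxi, add_sub_cancel_left] at hi
  have hire : (e * Complex.I).re = 0 := by simp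
  have hiim : (e * Complex.I).im = e := by simp
  rw [hire, hiim] at hi
  have hi' : (g (x + e * Complex.I)).im = e ∨ (g (x + e * Complex.I)).im = -e := by
    have : (g (x + e * Complex.I)).im ^ 2 = e ^ 2 := by linarith
    exact sq_eq_sq_iff_eq_or_eq_neg.1 this
  have him : ∀ u, ‖u - x‖ < δ → (g u).im * (g (x + e * Complex.I)).im = (u - x).im * e := by
    intro u hu
    have := hinner u _ hu hxi
    rw [hre _ hxi, add_sub_cancel_left, hire, hiim] at this
    linarith
  have hform : ∀ u, h u = h x + a * g u := by
    intro u
    simp only [hg]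
    field_simp
    ring
  refine ⟨a, ha1, ?_⟩
  rcases hi' with hi' | hi'
  · left
    intro u hu
    have h1 := him u hu
    rw [hi'] at h1
    rw [hform u, show g u = u - x from Complex.ext (hre u hu) (mul_right_cancel₀ he0.ne' h1)]
  · right
    intro u hu
    have h1 := him u hu
    rw [hi', mul_neg, ← neg_mul] at h1
    have h2 := mul_right_cancel₀ he0.ne' h1
    rw [hform u, show g u = star (u - x) from Complex.ext
      (by rw [hre u hu]; simp) (by simp only [Complex.star_def, Complex.conj_im]; linarith)]

namespace FlatSphere.IsUniformized

variable {T : FlatSphere} {hT : T.IsPiPiPiPi} {z : Fin 2 → ℂ} {E : ℂ → Sphere2}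

/-- A local isometry of a disc in the plane to a cone metric lifts to the plane. -/
theorem exists_lift_of_isometry (h : IsUniformized hT z E) {G : ℂ → Sphere2} {x w : ℂ}
    (hw : E w = G x) (hc : ContinuousAt G x) {δ : ℝ} (hδ : 0 < δ)
    (hG : ∀ u v, ‖u - x‖ < δ → ‖v - x‖ < δ → T.dist (G u) (G v) = ‖u - v‖) :
    E w ∉ hT.atlas.conic ∧ ∃ a : ℂ, ‖a‖ = 1 ∧ ((∀ᶠ u in 𝓝 x, G u = E (w + a * (u - x))) ∨
      (∀ᶠ u in 𝓝 x, G u = E (w + a * star (u - x)))) := by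
  obtain ⟨ε, hε, h1⟩ := h.dist_eq_or w
  have hnear : ∀ᶠ u in 𝓝 x, ∃ y, ‖y - w‖ < ε ∧ E y = G u := by
    have hopen : E '' Metric.ball w ε ∈ 𝓝 (G x) := by
      rw [← hw]
      exact h.isOpenMap.image_mem_nhds (Metric.ball_mem_nhds w hε)
    filter_upwards [hc hopen] with u hu
    obtain ⟨y, hy, hyu⟩ := hu
    exact ⟨y, by rwa [Metric.mem_ball, dist_eq_norm] at hy, hyu⟩
  obtain ⟨η, hη, h2⟩ := Metric.eventually_nhds_iff.1 hnear
  set r := min η δ with hr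
  have hr0 : 0 < r := lt_min hη hδ
  have h3 : ∀ u, ∃ y, ‖u - x‖ < r → ‖y - w‖ < ε ∧ E y = G u := by
    intro u
    by_cases hu : ‖u - x‖ < r
    · obtain ⟨y, hy⟩ := h2 (y := u) (by rw [dist_eq_norm]; exact hu.trans_le (min_le_left _ _))
      exact ⟨y, fun _ => hy⟩
    · exact ⟨0, fun h => absurd h hu⟩
  choose f hf using h3
  have hd : ∀ u v, ‖u - x‖ < r → ‖v - x‖ < r → T.dist (E (f u)) (E (f v)) = ‖u - v‖ := by
    intro u v hu hv
    rw [(hf u hu).2, (hf v hv).2, hG u v (hu.trans_le (min_le_right _ _))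
      (hv.trans_le (min_le_right _ _))]
  have hxr : ‖x - x‖ < r := by simpa
  have hww : ‖w - w‖ < ε := by simpa
  -- At a conic point two opposite points at distance `r / 2` would have lifts with offsets `p`, `q`
  -- of norm `r / 2` and with both `‖p + q‖` and `‖p - q‖` at least `r`. The parallelogram law gives
  -- `r² ≥ 2 r²`.
  have hnc : E w ∉ hT.atlas.conic := by
    intro hcon
    have hn : ∀ u, ‖u - x‖ < r → ‖f u - w‖ = ‖u - x‖ := by
      intro u hu
      have h4 := h1 (f u) w (hf u hu).1 hww
      rw [sub_self, add_zero] at h4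
      rw [(hf u hu).2, hw, hG u x (hu.trans_le (min_le_right _ _))
        (hxr.trans_le (min_le_right _ _))] at h4
      rcases h4 with h4 | ⟨h4, -⟩ <;> exact h4.symm
    have hsn : ‖((r / 2 : ℝ) : ℂ)‖ = r / 2 := by
      rw [Complex.norm_real, Real.norm_of_nonneg (by linarith)]
    have hu : ‖x + ((r / 2 : ℝ) : ℂ) - x‖ < r := by rw [add_sub_cancel_left, hsn]; linarith
    have hv : ‖x - ((r / 2 : ℝ) : ℂ) - x‖ < r := by
      rw [sub_sub_cancel_left, norm_neg, hsn]; linarith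
    have h4 := hn _ hu
    have h5 := hn _ hv
    rw [add_sub_cancel_left, hsn] at h4
    rw [sub_sub_cancel_left, norm_neg, hsn] at h5
    have h6 := hd _ _ hu hv
    have h7 : ‖x + ((r / 2 : ℝ) : ℂ) - (x - ((r / 2 : ℝ) : ℂ))‖ = r := by
      rw [add_sub_sub_cancel, ← Complex.ofReal_add, Complex.norm_real,
        Real.norm_of_nonneg (by linarith)]
      ring
    rw [h7] at h6
    have h8 := h.dist_le (f (x + ((r / 2 : ℝ) : ℂ))) (f (x - ((r / 2 : ℝ) : ℂ)))
    have h9 := h.dist_le_add hcon (f (x + ((r / 2 : ℝ) : ℂ))) (f (x - ((r / 2 : ℝ) : ℂ)))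
    rw [h6] at h8 h9
    set p := f (x + ((r / 2 : ℝ) : ℂ)) - w with hp
    set q := f (x - ((r / 2 : ℝ) : ℂ)) - w with hq
    rw [show f (x + ((r / 2 : ℝ) : ℂ)) - f (x - ((r / 2 : ℝ) : ℂ)) = p - q by
      rw [hp, hq]; ring] at h8
    have h10 := parallelogram_law_with_norm ℝ p q
    rw [h4, h5] at h10
    nlinarith [mul_self_le_mul_self hr0.le h8, mul_self_le_mul_self hr0.le h9]
  refine ⟨hnc, ?_⟩
  have hiso : ∀ u v, ‖u - x‖ < r → ‖v - x‖ < r → ‖f u - f v‖ = ‖u - v‖ := by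
    intro u v hu hv
    rcases h1 _ _ (hf u hu).1 (hf v hv).1 with h4 | ⟨-, h4⟩
    · rw [← h4, hd u v hu hv]
    · exact absurd h4 hnc
  have hfx : f x = w := by
    have h4 : T.dist (E (f x)) (E w) = 0 := by
      rw [(hf x hxr).2, hw, hG x x (hxr.trans_le (min_le_right _ _))
        (hxr.trans_le (min_le_right _ _)), sub_self, norm_zero]
    rcases h1 _ _ (hf x hxr).1 hww with h5 | ⟨-, h5⟩
    · rw [h4] at h5
      exact sub_eq_zero.1 (norm_eq_zero.1 h5.symm)
    · exact absurd h5 hnc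
  obtain ⟨a, ha, h4⟩ := eq_rotation_or_reflection_of_isometry hr0 hiso
  rw [hfx] at h4
  have hev : ∀ᶠ u in 𝓝 x, ‖u - x‖ < r := by
    filter_upwards [Metric.ball_mem_nhds x hr0] with u hu
    rwa [Metric.mem_ball, dist_eq_norm] at hu
  refine ⟨a, ha, ?_⟩
  rcases h4 with h4 | h4
  · left
    filter_upwards [hev] with u hu
    rw [← (hf u hu).2, h4 u hu]
  · right
    filter_upwards [hev] with u hu
    rw [← (hf u hu).2, h4 u hu]

/-- A rotation of the plane and a reflection do not agree after projection, even locally. -/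
theorem not_eventually_reflection_eq (h : IsUniformized hT z E) {G : ℂ → Sphere2} {x w a b c : ℂ}
    (ha : ‖a‖ = 1) (h1 : ∀ᶠ u in 𝓝 x, G u = E (w + a * star (u - x)))
    (h2 : ∀ᶠ u in 𝓝 x, G u = E (b * u + c)) : False := by
  have h3 : E w = E (b * x + c) := by
    have h4 := h1.self_of_nhds
    rw [sub_self, star_zero, mul_zero, add_zero] at h4
    exact h4.symm.trans h2.self_of_nhds
  obtain ⟨d, hd, h4⟩ := ConeAtlas.exists_deck h.developsAt h3
  obtain ⟨ε, hε, h5⟩ := ConeAtlas.exists_injOn_or h.developsAt (b * x + c)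
  have key : ∀ᶠ u in 𝓝 x, d * a * star (u - x) = b * (u - x) ∨
      d * a * star (u - x) = -(b * (u - x)) := by
    have h6 : ∀ᶠ u in 𝓝 x, ‖d * a * star (u - x)‖ < ε := by
      have : ContinuousAt (fun u => ‖d * a * star (u - x)‖) x := by fun_prop
      refine this.eventually_lt_const ?_
      simpa using hε
    have h7 : ∀ᶠ u in 𝓝 x, ‖b * (u - x)‖ < ε := by
      have : ContinuousAt (fun u => ‖b * (u - x)‖) x := by fun_prop
      refine this.eventually_lt_const ?_
      simpa using hε
    filter_upwards [h1, h2, h6, h7] with u h8 h9 h10 h11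
    have h12 := h5 (b * x + c + d * a * star (u - x)) (b * u + c)
      (by rwa [add_sub_cancel_left]) (by convert h11 using 2; ring) (by
        rw [← h9, h8, ← h4 (w + a * star (u - x))]
        congr 1
        ring)
    rcases h12 with h12 | ⟨h12, -⟩
    · left; linear_combination h12
    · right; linear_combination h12
  obtain ⟨δ, hδ, h6⟩ := Metric.eventually_nhds_iff.1 key
  -- Two test vectors suffice: `s` forces `b = ± d a`, and then `s (1 + i)` would be equal or
  -- opposite to its conjugate. The third leaves room since `‖1 + i‖ ≤ 2`.
  set s : ℝ := δ / 3 with hs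
  have hs0 : (s : ℂ) ≠ 0 := by exact_mod_cast (show 0 < s by positivity).ne'
  have hns : ‖(s : ℂ)‖ = s := by rw [Complex.norm_real, Real.norm_of_nonneg (by positivity)]
  have h7 := h6 (y := x + s) (by rw [dist_eq_norm, add_sub_cancel_left, hns]; linarith)
  have h8 := h6 (y := x + s * (1 + Complex.I)) (by
    rw [dist_eq_norm, add_sub_cancel_left, norm_mul, hns]
    have := norm_add_le (1 : ℂ) Complex.I
    rw [norm_one, Complex.norm_I] at this
    nlinarith)
  have hI : (1 + Complex.I) * (1 - Complex.I) = 2 := by ring_nf; simp; norm_num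
  rw [add_sub_cancel_left] at h7 h8
  have hda : d * a ≠ 0 := by
    intro h0
    have : ‖d * a‖ = 1 := by rw [norm_mul, hd, ha, one_mul]
    rw [h0, norm_zero] at this
    exact zero_ne_one this
  have hst1 : star (s : ℂ) = s := by simp
  have hst2 : star ((s : ℂ) * (1 + Complex.I)) = s * (1 - Complex.I) := by
    simp [sub_eq_add_neg]
  rw [hst1] at h7
  rw [hst2] at h8
  have h9 : b = d * a ∨ b = -(d * a) := by
    rcases h7 with h7 | h7
    · left; exact (mul_right_cancel₀ hs0 h7).symm
    · right; exact mul_right_cancel₀ hs0 (by linear_combination h7)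
  have h10 : (1 - Complex.I = 1 + Complex.I) ∨ (1 - Complex.I = -(1 + Complex.I)) := by
    have h11 : d * a * s ≠ 0 := mul_ne_zero hda hs0
    rcases h9 with rfl | rfl <;> rcases h8 with h8 | h8
    · left; exact mul_left_cancel₀ h11 (by linear_combination h8)
    · right; exact mul_left_cancel₀ h11 (by linear_combination h8)
    · right; exact mul_left_cancel₀ h11 (by linear_combination h8)
    · left; exact mul_left_cancel₀ h11 (by linear_combination h8)
  rcases h10 with h10 | h10
  · have := congrArg Complex.im h10
    norm_num at this
  · have := congrArg Complex.re h10
    norm_num at this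

/-- An orientation preserving local isometry from a connected open set in the plane factors
through the uniformization. -/
theorem exists_eqOn_of_isometry (h : IsUniformized hT z E) {G : ℂ → Sphere2} {D : Set ℂ}
    (hD : IsOpen D) (hDc : IsPreconnected D) (hDn : D.Nonempty) (hc : ∀ x ∈ D, ContinuousAt G x)
    (hG : ∀ x ∈ D, ∃ δ > 0, ∀ u v, ‖u - x‖ < δ → ‖v - x‖ < δ → T.dist (G u) (G v) = ‖u - v‖)
    {O : Set Sphere2} (hO : Dense O)
    (hor : ∀ x ∈ D, G x ∈ O → ∃ b c : ℂ, ∀ᶠ v in 𝓝 x, G v = E (b * v + c)) :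
    ∃ a b : ℂ, ‖a‖ = 1 ∧ Set.EqOn G (fun v => E (a * v + b)) D := by
  have key : ∀ x ∈ D, ∃ a b : ℂ, ‖a‖ = 1 ∧ ∀ᶠ v in 𝓝 x, G v = E (a * v + b) := by
    intro x hx
    obtain ⟨w, hw⟩ := h.surjective (G x)
    obtain ⟨δ, hδ, h1⟩ := hG x hx
    obtain ⟨-, a, ha, h2 | h2⟩ := h.exists_lift_of_isometry hw (hc x hx) hδ h1
    · refine ⟨a, w - a * x, ha, ?_⟩
      filter_upwards [h2] with v hv
      rw [hv]
      congr 1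
      ring
    · exfalso
      -- Orientation is only known at points over the dense set `O`. As `G` is a reflected copy of
      -- `E` near `x`, a nearby `x'` has its value in `O`, and there reflection and rotation
      -- contradict each other.
      have h3 := (eventually_eventually_nhds.2 h2).and (hD.mem_nhds hx)
      have hcont : ContinuousAt (fun y => x + star (a⁻¹ * (y - w))) w := by fun_prop
      have ht := hcont.tendsto
      simp only [sub_self, mul_zero, star_zero, add_zero] at ht
      have ha0 : a ≠ 0 := by rintro rfl; simp at ha
      have h4 := ht.eventually h3
      have hd : Dense (E ⁻¹' O) := hO.preimage h.isOpenMap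
      obtain ⟨y, hy, h5, h6⟩ :=
        ((mem_closure_iff_frequently.1 (hd w)).and_eventually h4).exists
      set x' := x + star (a⁻¹ * (y - w)) with hx'
      have h7 : G x' = E y := by
        rw [h5.self_of_nhds, hx', add_sub_cancel_left, star_star]
        congr 1
        field_simp
        ring
      obtain ⟨b, c, h8⟩ := hor x' h6 (by rw [h7]; exact hy)
      refine h.not_eventually_reflection_eq ha (w := y) (x := x') ?_ h8
      filter_upwards [h5] with v hv
      rw [hv]
      congr 1
      have hst : star (v - x') = star (v - x) - a⁻¹ * (y - w) := by
        rw [hx', ← sub_sub, star_sub (v - x), star_star]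
      rw [hst]
      field_simp
      ring
  obtain ⟨x₀, hx₀⟩ := hDn
  obtain ⟨a, b, ha, h0⟩ := key x₀ hx₀
  refine ⟨a, b, ha, ?_⟩
  refine ConeAtlas.eqOn_of_developsAt (A := hT.atlas) hDc (fun x hx => ?_)
    (fun x _ => ((h.developsAt _).comp_affine ha).mono (by simp)) hx₀ (nhdsWithin_le_nhds h0)
  obtain ⟨c, d, hc1, h1⟩ := key x hx
  have h2 : hT.atlas.DevelopsAt (fun v => E (c * v + d)) Set.univ x :=
    ((h.developsAt _).comp_affine hc1).mono (by simp)
  refine (h2.congr ?_ h1.self_of_nhds).mono (Set.subset_univ _)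
  rw [nhdsWithin_univ]
  exact h1

/-- The images of the interiors of the triangles. -/
theorem isOpen_iUnion_image_interior (h : IsUniformized hT z E) :
    IsOpen (⋃ α, T.param α '' interior (T.tri α)) := by
  refine isOpen_iUnion fun α => ?_
  obtain ⟨a, b, ha, h1⟩ := hT.exists_param_eq h.developsAt α
  have ha0 : a ≠ 0 := by rintro rfl; simp at ha
  have h2 : T.param α '' interior (T.tri α) = E '' ((fun v => a * v + b) '' interior (T.tri α)) := by
    rw [Set.image_image]
    exact Set.image_congr fun v hv => h1 v (interior_subset hv)
  rw [h2]
  refine h.isOpenMap _ ?_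
  have h3 : (fun v => a * v + b) = Homeomorph.addRight b ∘ Homeomorph.mulLeft₀ a ha0 := rfl
  rw [h3]
  exact ((Homeomorph.addRight b).isOpenMap.comp (Homeomorph.mulLeft₀ a ha0).isOpenMap) _
    isOpen_interior

end FlatSphere.IsUniformized

theorem FlatSphere.dense_iUnion_image_interior (T : FlatSphere) :
    Dense (⋃ α, T.param α '' interior (T.tri α)) := by
  intro p
  obtain ⟨α, x, hx, rfl⟩ := T.exists_param_eq p
  have h1 : x ∈ closure (interior (T.tri α)) := closure_interior_triangle (T.area2_ne α) hx
  have h2 := ((T.continuousOn α x hx).mono interior_subset).mem_closure_image h1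
  exact closure_mono (Set.subset_iUnion (fun α => T.param α '' interior (T.tri α)) α) h2

/-! ### Similarity of cone metrics in terms of lattices -/

namespace FlatSphere.IsUniformized

variable {T T' : FlatSphere} {hT : T.IsPiPiPiPi} {hT' : T'.IsPiPiPiPi} {z z' : Fin 2 → ℂ}
  {E E' : ℂ → Sphere2}

theorem isQuotientMap (h : IsUniformized hT z E) : Topology.IsQuotientMap E :=
  h.isOpenMap.isQuotientMap h.continuous h.surjective

/-- Multiplication by `κ` carries the fibres of `E` onto those of `E'`, hence nearest lifts to
nearest lifts. -/
theorem dist_mul (h : IsUniformized hT z E) (h' : IsUniformized hT' z' E') {κ : ℂ}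
    (hE : ∀ x y, E x = E y ↔ E' (κ * x) = E' (κ * y)) (hκ : κ ≠ 0) (x y : ℂ) :
    T'.dist (E' (κ * x)) (E' (κ * y)) = ‖κ‖ * T.dist (E x) (E y) := by
  obtain ⟨⟨y₁, h1, h2⟩, h3⟩ := h.isLeast_dist x y
  obtain ⟨⟨y₂, h4, h5⟩, h6⟩ := h'.isLeast_dist (κ * x) (κ * y)
  apply le_antisymm
  · rw [h2, ← norm_mul]
    exact h6 ⟨κ * y₁, (hE _ _).1 h1, by rw [mul_sub]⟩
  · have h7 := h3 ⟨κ⁻¹ * y₂, (hE _ _).2 (by rw [mul_inv_cancel_left₀ hκ, h4]), rfl⟩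
    have h8 : κ * x - y₂ = κ * (x - κ⁻¹ * y₂) := by rw [mul_sub, mul_inv_cancel_left₀ hκ]
    rw [h5, h8, norm_mul]
    exact mul_le_mul_of_nonneg_left h7 (norm_nonneg _)

/-- Cone metrics with homothetic lattices are similar. -/
theorem similar (h : IsUniformized hT z E) (h' : IsUniformized hT' z' E') {κ : ℂ} (hκ : κ ≠ 0)
    (hz : ∀ b, b ∈ lattice z ↔ κ * b ∈ lattice z') : FlatSphere.Similar T T' := by
  have hE : ∀ x y, E x = E y ↔ E' (κ * x) = E' (κ * y) := by
    intro x y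
    rw [h.apply_eq_iff, h'.apply_eq_iff, hz, hz, mul_sub, mul_add]
  set f : Sphere2 → Sphere2 := fun p => E' (κ * Function.surjInv h.surjective p) with hf
  set g : Sphere2 → Sphere2 := fun p => E (κ⁻¹ * Function.surjInv h'.surjective p) with hg
  have hfE : ∀ x, f (E x) = E' (κ * x) := fun x =>
    (hE _ _).1 (Function.surjInv_eq h.surjective (E x))
  have hgE : ∀ x, g (E' x) = E (κ⁻¹ * x) := fun x => by
    rw [hg, hE, mul_inv_cancel_left₀ hκ, mul_inv_cancel_left₀ hκ]
    exact Function.surjInv_eq h'.surjective (E' x)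
  have hfc : Continuous f := by
    rw [h.isQuotientMap.continuous_iff]
    have : f ∘ E = fun x => E' (κ * x) := funext hfE
    rw [this]
    exact h'.continuous.comp (by fun_prop)
  have hgc : Continuous g := by
    rw [h'.isQuotientMap.continuous_iff]
    have : g ∘ E' = fun x => E (κ⁻¹ * x) := funext hgE
    rw [this]
    exact h.continuous.comp (by fun_prop)
  refine ⟨⟨⟨f, g, fun p => ?_, fun p => ?_⟩, hfc, hgc⟩, ‖κ‖, norm_pos_iff.2 hκ,
    fun p q => ?_, ?_⟩
  · obtain ⟨x, rfl⟩ := h.surjective p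
    rw [hfE, hgE, inv_mul_cancel_left₀ hκ]
  · obtain ⟨x, rfl⟩ := h'.surjective p
    rw [hgE, hfE, mul_inv_cancel_left₀ hκ]
  · obtain ⟨x, rfl⟩ := h.surjective p
    obtain ⟨y, rfl⟩ := h.surjective q
    change T'.dist (f (E x)) (f (E y)) = _
    rw [hfE, hfE, h.dist_mul h' hE hκ]
  · intro α β v w hv hw hvw
    change f (T.param α v) = T'.param β w at hvw
    change ∃ a : ℂ, ∀ᶠ u in 𝓝 v, f (T.param α u) = T'.param β (w + a * (u - v))
    obtain ⟨a, b, h1, h2⟩ := h.exists_eventually_param_eq hv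
    rw [h1, hfE] at hvw
    obtain ⟨c, h3⟩ := h'.exists_param_eq_near hw hvw
    refine ⟨c * κ * a, ?_⟩
    have ht : Filter.Tendsto (fun u => κ * (a * u + b)) (𝓝 v) (𝓝 (κ * (a * v + b))) := by
      have : ContinuousAt (fun u => κ * (a * u + b)) v := by fun_prop
      exact this.tendsto
    filter_upwards [h2, ht.eventually h3] with u h4 h5
    rw [h4, hfE, h5]
    congr 1
    ring

theorem isClosed_conic (h : IsUniformized hT z E) : IsClosed {x | E x ∈ hT.atlas.conic} := by
  have h1 : {x | E x ∈ hT.atlas.conic} = ⋂ v, {x | E (2 * x - v) = E v} := by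
    ext x
    simp only [Set.mem_ofPred_eq, Set.mem_iInter]
    exact ConeAtlas.mem_conic_iff h.developsAt
  rw [h1]
  exact isClosed_iInter fun v => isClosed_eq (h.continuous.comp (by fun_prop)) continuous_const

theorem countable_conic (h : IsUniformized hT z E) : {x | E x ∈ hT.atlas.conic}.Countable := by
  refine ((countable_lattice z).preimage (mul_right_injective₀ (two_ne_zero' ℂ))).mono ?_
  intro x hx
  exact h.mem_conic_iff.1 hx

/-- Similar cone metrics have homothetic lattices. -/
theorem exists_of_similar (h : IsUniformized hT z E) (h' : IsUniformized hT' z' E')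
    (hs : FlatSphere.Similar T T') :
    ∃ κ : ℂ, κ ≠ 0 ∧ ∀ b, b ∈ lattice z ↔ κ * b ∈ lattice z' := by
  obtain ⟨f, c, hc, hd, ho⟩ := hs
  have hcC : (c : ℂ) ≠ 0 := by exact_mod_cast hc.ne'
  have hnc : ∀ x : ℂ, ‖x / c‖ = ‖x‖ / c := fun x => by
    rw [norm_div, Complex.norm_real, Real.norm_of_nonneg hc.le]
  -- Dividing by `c` compensates the scale of the similarity, so that `G` is a local isometry away
  -- from the conic points.
  set G : ℂ → Sphere2 := fun x => f (E (x / c)) with hG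
  set D : Set ℂ := {x | E (x / c) ∈ hT.atlas.conic}ᶜ with hD
  have hGc : Continuous G := f.continuous.comp (h.continuous.comp (by fun_prop))
  have hDo : IsOpen D := (h.isClosed_conic.preimage (by fun_prop : Continuous fun x : ℂ =>
    x / (c : ℂ))).isOpen_compl
  have hDcount : {x : ℂ | E (x / c) ∈ hT.atlas.conic}.Countable :=
    h.countable_conic.preimage fun x y hxy => (div_left_inj' hcC).1 hxy
  have hDpc : IsPathConnected D := hDcount.isPathConnected_compl_of_one_lt_rank (by
    rw [Complex.rank_real_complex]; norm_num)
  -- Points which are interior for both triangulations, the only ones at which preservation of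
  -- orientation says something.
  set O : Set Sphere2 := (⋃ β, T'.param β '' interior (T'.tri β)) ∩
    f '' (⋃ α, T.param α '' interior (T.tri α)) with hO
  have hOd : Dense O := Dense.inter_of_isOpen_left T'.dense_iUnion_image_interior
    (f.surjective.denseRange.dense_image f.continuous T.dense_iUnion_image_interior)
    h'.isOpen_iUnion_image_interior
  have hiso : ∀ x ∈ D, ∃ δ > 0, ∀ u v, ‖u - x‖ < δ → ‖v - x‖ < δ →
      T'.dist (G u) (G v) = ‖u - v‖ := by
    intro x hx
    obtain ⟨ε, hε, h1⟩ := h.dist_eq_or (x / c)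
    refine ⟨ε * c, by positivity, fun u v hu hv => ?_⟩
    have hn : ∀ u, ‖u - x‖ < ε * c → ‖u / c - x / c‖ < ε := by
      intro u hu
      rw [← sub_div, hnc, div_lt_iff₀ hc]
      exact hu
    rcases h1 _ _ (hn u hu) (hn v hv) with h2 | ⟨-, h2⟩
    · change T'.dist (f (E (u / c))) (f (E (v / c))) = _
      rw [hd, h2, ← sub_div, hnc]
      field_simp
    · exact absurd h2 hx
  have hor : ∀ x ∈ D, G x ∈ O → ∃ m n : ℂ, ∀ᶠ v in 𝓝 x, G v = E' (m * v + n) := by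
    intro x hx hxO
    obtain ⟨h1, p, hp, hpx⟩ := hxO
    have hpE : p = E (x / c) := f.injective hpx
    rw [hpE] at hp
    obtain ⟨β, w, hw, hwx⟩ := Set.mem_iUnion.1 h1
    obtain ⟨α, v, hv, hvx⟩ := Set.mem_iUnion.1 hp
    obtain ⟨d, h2⟩ := h.exists_param_eq_near hv hvx.symm
    obtain ⟨e, h3⟩ := ho α β v w hv hw (by rw [hvx, hwx])
    obtain ⟨m, n, -, h4⟩ := h'.exists_eventually_param_eq hw
    have t1 : Filter.Tendsto (fun u : ℂ => u / c) (𝓝 x) (𝓝 (x / c)) := by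
      have : ContinuousAt (fun u : ℂ => u / (c : ℂ)) x := by fun_prop
      exact this.tendsto
    have t2 : Filter.Tendsto (fun u : ℂ => v + d * (u / c - x / c)) (𝓝 x) (𝓝 v) := by
      have : ContinuousAt (fun u : ℂ => v + d * (u / c - x / c)) x := by fun_prop
      have := this.tendsto
      rwa [sub_self, mul_zero, add_zero] at this
    have t3 : Filter.Tendsto (fun u : ℂ => w + e * (v + d * (u / c - x / c) - v)) (𝓝 x) (𝓝 w) := by
      have : ContinuousAt (fun u : ℂ => w + e * (v + d * (u / c - x / c) - v)) x := by fun_prop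
      have := this.tendsto
      rwa [sub_self, mul_zero, add_zero, sub_self, mul_zero, add_zero] at this
    refine ⟨m * (e * d / c), m * w - m * (e * d / c) * x + n, ?_⟩
    filter_upwards [t1.eventually h2, t2.eventually h3, t3.eventually h4] with u h5 h6 h7
    change f (E (u / c)) = _
    rw [h5, h6, h7]
    congr 1
    field_simp
    ring
  obtain ⟨a, b, ha, hab⟩ := h'.exists_eqOn_of_isometry hDo hDpc.isConnected.isPreconnected
    hDpc.nonempty (fun x _ => hGc.continuousAt) hiso hOd hor
  -- The excluded conic points are countable, so their complement is dense as well as connected, and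
  -- continuity extends the formula to the plane.
  have hall : ∀ x, G x = E' (a * x + b) := by
    have hdense : Dense D := hDcount.dense_compl ℝ
    have := Continuous.ext_on hdense hGc (h'.continuous.comp
      (by fun_prop : Continuous fun x => a * x + b)) hab
    exact fun x => congrFun this x
  have ha0 : a ≠ 0 := by rintro rfl; simp at ha
  refine ⟨a * c, mul_ne_zero ha0 hcC, fun l => ?_⟩
  rw [h.mem_lattice_iff, h'.mem_lattice_iff]
  have hEx : ∀ x, f (E x) = E' (a * c * x + b) := by
    intro x
    have := hall (c * x)
    rw [hG] at this
    simp only at this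
    rw [mul_div_cancel_left₀ _ hcC] at this
    rw [this]
    congr 1
    ring
  constructor
  · intro h1 v
    have h2 := congrArg f (h1 ((a * c)⁻¹ * (v - b)))
    rw [hEx, hEx] at h2
    convert h2 using 2 <;> field_simp <;> ring
  · intro h1 v
    refine f.injective ?_
    rw [hEx, hEx, ← h1 (a * c * v + b)]
    congr 1
    ring

theorem similar_refl (h : IsUniformized hT z E) : FlatSphere.Similar T T :=
  h.similar h one_ne_zero fun b => by rw [one_mul]

end FlatSphere.IsUniformized

/-! ### Oriented bases of a lattice -/

theorem combo_eq_zero {z : Fin 2 → ℂ} (hz : z ∈ Hplus) {s t : ℝ}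
    (h : (s : ℂ) * z 0 + t * z 1 = 0) : s = 0 ∧ t = 0 := by
  rw [mem_Hplus_iff] at hz
  have h1 := congrArg Complex.re h
  have h2 := congrArg Complex.im h
  simp at h1 h2
  constructor
  · refine (mul_eq_zero.1 (?_ : s * ((z 0).re * (z 1).im - (z 0).im * (z 1).re) = 0)).resolve_right
      hz.ne'
    linear_combination (z 1).im * h1 - (z 1).re * h2
  · refine (mul_eq_zero.1 (?_ : t * ((z 0).re * (z 1).im - (z 0).im * (z 1).re) = 0)).resolve_right
      hz.ne'
    linear_combination (z 0).re * h2 - (z 0).im * h1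

theorem int_combo_inj {z : Fin 2 → ℂ} (hz : z ∈ Hplus) {m n k l : ℤ}
    (h : (m * z 0 + n * z 1 : ℂ) = k * z 0 + l * z 1) : m = k ∧ n = l := by
  have := combo_eq_zero hz (s := m - k) (t := n - l) (by push_cast; linear_combination h)
  exact ⟨by exact_mod_cast sub_eq_zero.1 this.1, by exact_mod_cast sub_eq_zero.1 this.2⟩

theorem sl_smul_apply (A : SL(2, ℤ)) (z : Fin 2 → ℂ) (i : Fin 2) :
    ((A.map (Int.castRingHom ℂ)) • z) i = A i 0 * z 0 + A i 1 * z 1 := by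
  change (((A.map (Int.castRingHom ℂ)).1).mulVec z) i = _
  simp [Matrix.mulVec, dotProduct, Fin.sum_univ_two]

/-- Oriented bases of homothetic lattices. -/
theorem exists_sl_of_lattice {z z' : Fin 2 → ℂ} (hz : z ∈ Hplus) (hz' : z' ∈ Hplus) {κ : ℂ}
    (hκ : κ ≠ 0) (h : ∀ b, b ∈ lattice z ↔ κ * b ∈ lattice z') :
    ∃ A : SL(2, ℤ), κ • z = (A.map (Int.castRingHom ℂ)) • z' := by
  have h0 : z 0 ∈ lattice z := ⟨1, 0, by simp⟩
  have h1 : z 1 ∈ lattice z := ⟨0, 1, by simp⟩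
  have h0' : κ * (κ⁻¹ * z' 0) ∈ lattice z' := ⟨1, 0, by rw [mul_inv_cancel_left₀ hκ]; simp⟩
  have h1' : κ * (κ⁻¹ * z' 1) ∈ lattice z' := ⟨0, 1, by rw [mul_inv_cancel_left₀ hκ]; simp⟩
  obtain ⟨a, b, e0⟩ := (h _).1 h0
  obtain ⟨c, d, e1⟩ := (h _).1 h1
  obtain ⟨a', b', f0⟩ := (h _).2 h0'
  obtain ⟨c', d', f1⟩ := (h _).2 h1'
  have g0 : z' 0 = a' * (κ * z 0) + b' * (κ * z 1) := by
    rw [inv_mul_eq_iff_eq_mul₀ hκ] at f0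
    rw [f0]; ring
  have g1 : z' 1 = c' * (κ * z 0) + d' * (κ * z 1) := by
    rw [inv_mul_eq_iff_eq_mul₀ hκ] at f1
    rw [f1]; ring
  rw [e0, e1] at g0 g1
  have i0 := int_combo_inj hz' (m := 1) (n := 0) (k := a' * a + b' * c) (l := a' * b + b' * d)
    (by push_cast; linear_combination g0)
  have i1 := int_combo_inj hz' (m := 0) (n := 1) (k := c' * a + d' * c) (l := c' * b + d' * d)
    (by push_cast; linear_combination g1)
  have hprod : (a' * d' - b' * c') * (a * d - b * c) = 1 := by
    have : (a' * d' - b' * c') * (a * d - b * c)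
      = (a' * a + b' * c) * (c' * b + d' * d) - (a' * b + b' * d) * (c' * a + d' * c) := by ring
    rw [this, ← i0.1, ← i0.2, ← i1.1, ← i1.2]
    norm_num
  -- Both bases are positively oriented, and this selects the sign: an invertible integral matrix of
  -- positive determinant has determinant `1`.
  have hdet : 0 < a * d - b * c := by
    have hκz : κ • z ∈ Hplus := by
      rw [mem_Hplus_iff] at hz ⊢
      have : ((κ • z) 0).re * ((κ • z) 1).im - ((κ • z) 0).im * ((κ • z) 1).re
        = Complex.normSq κ * ((z 0).re * (z 1).im - (z 0).im * (z 1).re) := by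
        simp [Complex.normSq_apply]; ring
      rw [this]
      exact mul_pos (Complex.normSq_pos.2 hκ) hz
    rw [mem_Hplus_iff] at hκz hz'
    have e2 : ((κ • z) 0).re * ((κ • z) 1).im - ((κ • z) 0).im * ((κ • z) 1).re
        = ((a * d - b * c : ℤ) : ℝ) * ((z' 0).re * (z' 1).im - (z' 0).im * (z' 1).re) := by
      change (κ * z 0).re * (κ * z 1).im - (κ * z 0).im * (κ * z 1).re = _
      rw [e0, e1]
      simp
      ring
    rw [e2] at hκz
    exact_mod_cast pos_of_mul_pos_left hκz hz'.le
  have hdet1 : a * d - b * c = 1 := Int.eq_one_of_mul_eq_one_left hdet.le hprod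
  obtain ⟨A, hA⟩ : ∃ A : SL(2, ℤ), A.1 = !![a, b; c, d] :=
    ⟨⟨!![a, b; c, d], by rw [Matrix.det_fin_two_of]; exact hdet1⟩, rfl⟩
  refine ⟨A, ?_⟩
  funext i
  rw [sl_smul_apply]
  change κ * z i = (A.1 i 0 : ℤ) * z' 0 + (A.1 i 1 : ℤ) * z' 1
  rw [hA]
  fin_cases i
  · exact e0
  · exact e1

/-- One inclusion for all matrices is enough, since it can be applied to the inverse. -/
theorem lattice_sl_smul (A : SL(2, ℤ)) (z : Fin 2 → ℂ) :
    lattice ((A.map (Int.castRingHom ℂ)) • z) = lattice z := by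
  have key : ∀ (A : SL(2, ℤ)) (z : Fin 2 → ℂ),
      lattice ((A.map (Int.castRingHom ℂ)) • z) ≤ lattice z := by
    rintro A z b ⟨m, n, rfl⟩
    rw [sl_smul_apply, sl_smul_apply]
    exact ⟨m * A 0 0 + n * A 1 0, m * A 0 1 + n * A 1 1, by push_cast; ring⟩
  refine le_antisymm (key A z) ?_
  have := key A⁻¹ ((A.map (Int.castRingHom ℂ)) • z)
  rwa [smul_smul, ← map_mul, inv_mul_cancel, map_one, one_smul] at this

theorem orbit_eq_of_lattice {z z' : Hplus} {κ : ℂ}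
    (hκ : κ ≠ 0) (h : ∀ b, b ∈ lattice z.1 ↔ κ * b ∈ lattice z'.1) :
    (Quotient.mk _ (toPHplus z) : MulAction.orbitRel.Quotient PSL(2, ℤ) PHplus)
      = Quotient.mk _ (toPHplus z') := by
  obtain ⟨A, hA⟩ := exists_sl_of_lattice z.2 z'.2 hκ h
  refine Quotient.sound ⟨(A : PSL(2, ℤ)), ?_⟩
  refine Subtype.ext ?_
  change (A.map (Int.castRingHom ℂ)) • Projectivization.mk ℂ z'.1 _ = Projectivization.mk ℂ z.1 _
  rw [Projectivization.smul_mk, Projectivization.mk_eq_mk_iff']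
  exact ⟨κ, hA⟩

theorem lattice_of_orbit_eq {z z' : Hplus}
    (h : (Quotient.mk _ (toPHplus z) : MulAction.orbitRel.Quotient PSL(2, ℤ) PHplus)
      = Quotient.mk _ (toPHplus z')) :
    ∃ κ : ℂ, κ ≠ 0 ∧ ∀ b, b ∈ lattice z.1 ↔ κ * b ∈ lattice z'.1 := by
  obtain ⟨A, hA⟩ := Quotient.exact h
  obtain ⟨A, rfl⟩ := QuotientGroup.mk_surjective A
  have h1 := congrArg Subtype.val hA
  change (A.map (Int.castRingHom ℂ)) • Projectivization.mk ℂ z'.1 _ = Projectivization.mk ℂ z.1 _ at h1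
  rw [Projectivization.smul_mk, Projectivization.mk_eq_mk_iff'] at h1
  obtain ⟨κ, hκ⟩ := h1
  have hκ0 : κ ≠ 0 := by
    rintro rfl
    rw [zero_smul] at hκ
    exact ne_zero_of_mem_Hplus (smul_mem_Hplus A z'.2) hκ.symm
  refine ⟨κ, hκ0, fun b => ?_⟩
  rw [← lattice_sl_smul A z'.1]
  have h2 : (A.map (Int.castRingHom ℂ)) • z'.1 = κ • z.1 := hκ.symm
  rw [h2]
  simp only [mem_lattice, Pi.smul_apply, smul_eq_mul]
  refine exists_congr fun m => exists_congr fun n => ?_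
  rw [← mul_right_inj' hκ0]
  constructor <;> intro h <;> rw [h] <;> ring

/-! ### Gluings of triangles are uniformized -/

section Fold

variable {z : Fin 2 → ℂ}

theorem area2_pos_of_mem_Hplus (hz : z ∈ Hplus) : 0 < area2 ![0, z 0, z 1] := by
  rw [mem_Hplus_iff] at hz
  simpa [area2, cross] using hz

theorem bary_zero_combo (hz : z ∈ Hplus) (s t : ℝ) :
    bary ![0, z 0, z 1] 0 (s * z 0 + t * z 1) = 1 - s - t ∧
    bary ![0, z 0, z 1] 1 (s * z 0 + t * z 1) = s ∧
    bary ![0, z 0, z 1] 2 (s * z 0 + t * z 1) = t := by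
  have h := bary_add_combo (area2_pos_of_mem_Hplus hz).ne' 0 s t
  have e : (![0, z 0, z 1] 0 + s • (![0, z 0, z 1] (0 + 1) - ![0, z 0, z 1] 0)
      + t • (![0, z 0, z 1] (0 + 2) - ![0, z 0, z 1] 0) : ℂ) = s * z 0 + t * z 1 := by
    simp
  rw [e] at h
  exact ⟨h.2.2, h.1, h.2.1⟩

theorem combo_mem_triangle_iff (hz : z ∈ Hplus) {s t : ℝ} :
    (s * z 0 + t * z 1 : ℂ) ∈ triangle ![0, z 0, z 1] ↔ 0 ≤ s ∧ 0 ≤ t ∧ s + t ≤ 1 := by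
  rw [mem_triangle_iff (area2_pos_of_mem_Hplus hz).ne']
  obtain ⟨h0, h1, h2⟩ := bary_zero_combo hz s t
  simp only [Fin.forall_fin_succ, Fin.forall_fin_zero, h0]
  change _ ∧ 0 ≤ bary _ 1 _ ∧ 0 ≤ bary _ 2 _ ∧ _ ↔ _
  rw [h1, h2]
  constructor
  · rintro ⟨h3, h4, h5, -⟩
    exact ⟨h4, h5, by linarith⟩
  · rintro ⟨h3, h4, h5⟩
    exact ⟨by linarith, h3, h4, by simp⟩

theorem combo_mem_interior_iff (hz : z ∈ Hplus) {s t : ℝ} :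
    (s * z 0 + t * z 1 : ℂ) ∈ interior (triangle ![0, z 0, z 1]) ↔ 0 < s ∧ 0 < t ∧ s + t < 1 := by
  rw [mem_interior_triangle_iff (area2_pos_of_mem_Hplus hz).ne']
  obtain ⟨h0, h1, h2⟩ := bary_zero_combo hz s t
  simp only [Fin.forall_fin_succ, Fin.forall_fin_zero, h0]
  change _ ∧ 0 < bary _ 1 _ ∧ 0 < bary _ 2 _ ∧ _ ↔ _
  rw [h1, h2]
  constructor
  · rintro ⟨h3, h4, h5, -⟩
    exact ⟨h4, h5, by linarith⟩
  · rintro ⟨h3, h4, h5⟩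
    exact ⟨by linarith, h3, h4, by simp⟩

theorem exists_combo (hz : z ∈ Hplus) (x : ℂ) : ∃ s t : ℝ, x = s * z 0 + t * z 1 := by
  have h := sum_bary_smul (area2_pos_of_mem_Hplus hz).ne' x
  rw [Fin.sum_univ_three] at h
  refine ⟨bary ![0, z 0, z 1] 1 x, bary ![0, z 0, z 1] 2 x, ?_⟩
  simpa using h.symm

theorem exists_combo_of_mem_segment_left {x : ℂ} (hx : x ∈ segment ℝ 0 (z 0)) :
    ∃ s : ℝ, 0 ≤ s ∧ s ≤ 1 ∧ x = s * z 0 := by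
  obtain ⟨a, b, ha, hb, hab, rfl⟩ := hx
  exact ⟨b, hb, by linarith, by simp⟩

theorem exists_combo_of_mem_segment_right {x : ℂ} (hx : x ∈ segment ℝ 0 (z 1)) :
    ∃ s : ℝ, 0 ≤ s ∧ s ≤ 1 ∧ x = s * z 1 := by
  obtain ⟨a, b, ha, hb, hab, rfl⟩ := hx
  exact ⟨b, hb, by linarith, by simp⟩

theorem exists_combo_of_mem_segment {x : ℂ} (hx : x ∈ segment ℝ (z 0) (z 1)) :
    ∃ s : ℝ, 0 ≤ s ∧ s ≤ 1 ∧ x = s * z 0 + (1 - s : ℝ) * z 1 := by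
  obtain ⟨a, b, ha, hb, hab, rfl⟩ := hx
  obtain rfl : b = 1 - a := by linarith
  exact ⟨a, ha, by linarith, by simp⟩

/-- The two ends of a folding step in coordinates. -/
theorem foldStep_combo {x y : ℂ} (h : FoldStep z x y) : ∃ s : ℝ, 0 ≤ s ∧ s ≤ 1 ∧
    ((x = s * z 0 + (0 : ℝ) * z 1 ∧ y = (1 - s : ℝ) * z 0 + (0 : ℝ) * z 1) ∨
     (x = s * z 0 + (1 - s : ℝ) * z 1 ∧ y = (1 - s : ℝ) * z 0 + s * z 1) ∨
     (x = (0 : ℝ) * z 0 + s * z 1 ∧ y = (0 : ℝ) * z 0 + (1 - s : ℝ) * z 1)) := by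
  rcases h with ⟨h, hxy⟩ | ⟨h, hxy⟩ | ⟨h, hxy⟩
  · obtain ⟨s, h0, h1, rfl⟩ := exists_combo_of_mem_segment_left h
    refine ⟨s, h0, h1, Or.inl ⟨by simp, ?_⟩⟩
    push_cast
    linear_combination hxy
  · obtain ⟨s, h0, h1, rfl⟩ := exists_combo_of_mem_segment h
    refine ⟨s, h0, h1, Or.inr (Or.inl ⟨rfl, ?_⟩)⟩
    push_cast at hxy ⊢
    linear_combination hxy
  · obtain ⟨s, h0, h1, rfl⟩ := exists_combo_of_mem_segment_right h
    refine ⟨s, h0, h1, Or.inr (Or.inr ⟨by simp, ?_⟩)⟩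
    push_cast
    linear_combination hxy

theorem foldStep_not_mem_interior (hz : z ∈ Hplus) {x y : ℂ} (h : FoldStep z x y) :
    x ∉ interior (triangle ![0, z 0, z 1]) ∧ y ∉ interior (triangle ![0, z 0, z 1]) := by
  obtain ⟨s, h0, h1, ⟨rfl, rfl⟩ | ⟨rfl, rfl⟩ | ⟨rfl, rfl⟩⟩ := foldStep_combo h <;>
    rw [combo_mem_interior_iff hz, combo_mem_interior_iff hz] <;>
    constructor <;> rintro ⟨h2, h3, h4⟩ <;> linarith

/-- Interior points are not identified with other points. -/
theorem eq_of_eqvGen_foldStep (hz : z ∈ Hplus) {x y : ℂ} (h : Relation.EqvGen (FoldStep z) x y) :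
    (x ∈ interior (triangle ![0, z 0, z 1]) ∨ y ∈ interior (triangle ![0, z 0, z 1])) → x = y := by
  induction h with
  | rel x y h =>
    have := foldStep_not_mem_interior hz h
    exact fun h' => h'.elim (fun h' => absurd h' this.1) fun h' => absurd h' this.2
  | refl x => exact fun _ => rfl
  | symm x y _ ih => exact fun h' => (ih h'.symm).symm
  | trans x y w _ _ ih1 ih2 =>
    rintro (h' | h')
    · have h1 := ih1 (Or.inl h')
      subst h1
      exact ih2 (Or.inl h')
    · have h1 := ih2 (Or.inr h')
      subst h1
      exact ih1 (Or.inr h')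

theorem combo_mem_lattice_iff (hz : z ∈ Hplus) {s t : ℝ} :
    (s * z 0 + t * z 1 : ℂ) ∈ lattice z ↔ (∃ m : ℤ, s = m) ∧ ∃ n : ℤ, t = n := by
  constructor
  · rintro ⟨m, n, h⟩
    have := combo_eq_zero hz (s := s - m) (t := t - n) (by push_cast; linear_combination h)
    exact ⟨⟨m, sub_eq_zero.1 this.1⟩, n, sub_eq_zero.1 this.2⟩
  · rintro ⟨⟨m, rfl⟩, n, rfl⟩
    exact ⟨m, n, by simp⟩

/-- The triangle is a fundamental domain for the lattice and the half turns. -/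
theorem exists_mem_triangle (hz : z ∈ Hplus) (x : ℂ) :
    ∃ y ∈ triangle ![0, z 0, z 1], x - y ∈ lattice z ∨ x + y ∈ lattice z := by
  obtain ⟨s, t, rfl⟩ := exists_combo hz x
  have hs := Int.fract_add_floor s
  have ht := Int.fract_add_floor t
  have hs0 := Int.fract_nonneg s
  have ht0 := Int.fract_nonneg t
  have hs1 := Int.fract_lt_one s
  have ht1 := Int.fract_lt_one t
  by_cases h : Int.fract s + Int.fract t ≤ 1
  · refine ⟨(Int.fract s : ℝ) * z 0 + (Int.fract t : ℝ) * z 1,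
      (combo_mem_triangle_iff hz).2 ⟨hs0, ht0, h⟩, Or.inl ⟨⌊s⌋, ⌊t⌋, ?_⟩⟩
    have hs' : (s : ℂ) = (Int.fract s : ℝ) + (⌊s⌋ : ℤ) := by exact_mod_cast hs.symm
    have ht' : (t : ℂ) = (Int.fract t : ℝ) + (⌊t⌋ : ℤ) := by exact_mod_cast ht.symm
    linear_combination z 0 * hs' + z 1 * ht'
  -- Beyond the diagonal, the half turn about the centre of the unit parallelogram brings the
  -- fractional part back into the triangle; it contributes the extra `1` to both coefficients.
  · refine ⟨(1 - Int.fract s : ℝ) * z 0 + (1 - Int.fract t : ℝ) * z 1,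
      (combo_mem_triangle_iff hz).2 ⟨by linarith, by linarith, by linarith⟩,
      Or.inr ⟨⌊s⌋ + 1, ⌊t⌋ + 1, ?_⟩⟩
    have hs' : (s : ℂ) = (Int.fract s : ℝ) + (⌊s⌋ : ℤ) := by exact_mod_cast hs.symm
    have ht' : (t : ℂ) = (Int.fract t : ℝ) + (⌊t⌋ : ℤ) := by exact_mod_cast ht.symm
    push_cast
    linear_combination z 0 * hs' + z 1 * ht'

end Fold

namespace ConeAtlas

variable {S : Type*} [TopologicalSpace S] [T2Space S] {A : ConeAtlas S} {E : ℂ → S}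

/-- A developing map which is even along a segment is even. -/
theorem even_of_even_on_segment (hE : ∀ x, A.DevelopsAt E Set.univ x) {m d : ℂ} (hd : d ≠ 0)
    (h : ∀ t : ℝ, 0 ≤ t → t ≤ 1 → E (m + t * d) = E (m - t * d)) (v : ℂ) : E (2 * m - v) = E v := by
  refine (mem_conic_iff hE).1 ?_ v
  obtain ⟨ε, hε, h1⟩ := exists_injOn_or hE m
  have hd' : 0 < ‖d‖ := norm_pos_iff.2 hd
  -- Small enough for `m ± t d` to lie where `E` is injective up to the half turn about `m`. These
  -- points are distinct, so `E m` is conic.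
  set t : ℝ := min 1 (ε / (2 * ‖d‖)) with ht
  have ht0 : 0 < t := lt_min one_pos (by positivity)
  have hn : ‖(t : ℂ) * d‖ < ε := by
    rw [norm_mul, Complex.norm_real, Real.norm_of_nonneg ht0.le]
    calc t * ‖d‖ ≤ ε / (2 * ‖d‖) * ‖d‖ := by gcongr; exact min_le_right _ _
      _ = ε / 2 := by field_simp
      _ < ε := by linarith
  rcases h1 (m + t * d) (m - t * d) (by rwa [add_sub_cancel_left])
    (by rwa [sub_sub_cancel_left, norm_neg]) (h t ht0.le (min_le_left _ _)) with h2 | ⟨-, h2⟩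
  · exfalso
    have h3 : (2 * t : ℂ) * d = 0 := by linear_combination h2
    have h4 : (t : ℂ) ≠ 0 := by exact_mod_cast ht0.ne'
    simp [h4, hd] at h3
  · exact h2

end ConeAtlas

namespace FlatSphere

/-- A gluing of a triangle is uniformized by the lattice spanned by its sides. -/
theorem IsPiPiPiPi.isUniformized_of_isGluing {T : FlatSphere} (hT : T.IsPiPiPiPi) {z : Fin 2 → ℂ}
    (hz : z ∈ Hplus) (hg : IsGluing z T) : ∃ E, IsUniformized hT z E := by
  -- An auxiliary uniformization by an unknown lattice. The quotient map `q` is a direct isometry of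
  -- the plane followed by `E₁`, and the composite `E` is shown to have exactly the lattice of `z`
  -- as periods.
  obtain ⟨z₁, -, E₁, h₁⟩ := hT.exists_isUniformized
  obtain ⟨q, hqc, hqs, hqf, hqd, hqo⟩ := hg
  have harea := (area2_pos_of_mem_Hplus hz).ne'
  set Δ := triangle ![0, z 0, z 1] with hΔ
  have hDn : (interior Δ).Nonempty := by
    refine ⟨((1 / 4 : ℝ) : ℂ) * z 0 + ((1 / 4 : ℝ) : ℂ) * z 1, (combo_mem_interior_iff hz).2 ?_⟩
    norm_num
  have hDc : IsPreconnected (interior Δ) := (convex_triangle.interior).isPreconnected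
  have hiso : ∀ x ∈ interior Δ, ∃ δ > 0, ∀ u v, ‖u - x‖ < δ → ‖v - x‖ < δ →
      T.dist (q u) (q v) = ‖u - v‖ := by
    intro x hx
    obtain ⟨ρ, hρ, hb⟩ := Metric.isOpen_iff.1 isOpen_interior x hx
    refine ⟨ρ / 3, by positivity, fun u v hu hv => ?_⟩
    rw [hqd]
    refine gluedDist_eq_of_ball (i := ()) (hb.trans interior_subset) ?_ hu hv
    intro u hu j a ha hau
    refine ⟨rfl, ?_⟩
    exact eq_of_eqvGen_foldStep hz ((hqf a ha u (interior_subset (hb hu))).1 hau)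
      (Or.inr (hb hu))
  have hor : ∀ x ∈ interior Δ, q x ∈ (⋃ α, T.param α '' interior (T.tri α)) →
      ∃ b c : ℂ, ∀ᶠ v in 𝓝 x, q v = E₁ (b * v + c) := by
    intro x hx hqx
    obtain ⟨α, w, hw, hwx⟩ := Set.mem_iUnion.1 hqx
    obtain ⟨a, h1⟩ := hqo () α x w hx hw hwx.symm
    obtain ⟨m, n, -, h2⟩ := h₁.exists_eventually_param_eq hw
    have ht : Filter.Tendsto (fun u => w + a * (u - x)) (𝓝 x) (𝓝 w) := by
      have : ContinuousAt (fun u => w + a * (u - x)) x := by fun_prop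
      have := this.tendsto
      rwa [sub_self, mul_zero, add_zero] at this
    refine ⟨m * a, m * w - m * a * x + n, ?_⟩
    filter_upwards [h1, ht.eventually h2] with u h3 h4
    change q u = _ at h3
    rw [h3, h4]
    congr 1
    ring
  obtain ⟨a, b, ha, hab⟩ := h₁.exists_eqOn_of_isometry isOpen_interior hDc hDn
    (fun x hx => (hqc x (interior_subset hx)).continuousAt
      (Filter.mem_of_superset (isOpen_interior.mem_nhds hx) interior_subset)) hiso
    T.dense_iUnion_image_interior hor
  set E : ℂ → Sphere2 := fun v => E₁ (a * v + b) with hE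
  have hdev : ∀ x, hT.atlas.DevelopsAt E Set.univ x := fun x =>
    ((h₁.developsAt _).comp_affine ha).mono (by simp)
  have hEc : Continuous E := ConeAtlas.continuous_of_developsAt hdev
  have hqE : Set.EqOn q E Δ := by
    refine hab.of_subset_closure hqc hEc.continuousOn interior_subset ?_
    exact closure_interior_triangle harea
  have hstep : ∀ x y, FoldStep z x y → E x = E y := by
    intro x y hxy
    have hx : x ∈ Δ ∧ y ∈ Δ := by
      obtain ⟨s, h0, h1, ⟨rfl, rfl⟩ | ⟨rfl, rfl⟩ | ⟨rfl, rfl⟩⟩ := foldStep_combo hxy <;>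
        rw [combo_mem_triangle_iff hz, combo_mem_triangle_iff hz] <;>
        refine ⟨⟨?_, ?_, ?_⟩, ?_, ?_, ?_⟩ <;> linarith
    rw [← hqE hx.1, ← hqE hx.2]
    exact (hqf x hx.1 y hx.2).2 (.rel _ _ hxy)
  have hz0 : z 0 ≠ 0 := by
    intro h0
    rw [mem_Hplus_iff, h0] at hz
    simp at hz
  have hz1 : z 1 ≠ 0 := by
    intro h0
    rw [mem_Hplus_iff, h0] at hz
    simp at hz
  have hz01 : z 0 - z 1 ≠ 0 := by
    intro h0
    rw [mem_Hplus_iff, sub_eq_zero.1 h0] at hz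
    nlinarith
  -- The gluing of a side makes `E` even along this side about its midpoint, and hence invariant
  -- under that half turn.
  have e0 : ∀ v, E (z 0 - v) = E v := by
    intro v
    rw [← ConeAtlas.even_of_even_on_segment hdev (m := z 0 / 2) (d := z 0 / 2)
      (div_ne_zero hz0 two_ne_zero) (fun t h0 h1 => hstep _ _ (Or.inl ⟨?_, by ring⟩)) v]
    · congr 1; ring
    · refine ⟨(1 - t) / 2, (1 + t) / 2, by linarith, by linarith, by ring, ?_⟩
      simp; ring
  have e1 : ∀ v, E (z 1 - v) = E v := by
    intro v
    rw [← ConeAtlas.even_of_even_on_segment hdev (m := z 1 / 2) (d := z 1 / 2)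
      (div_ne_zero hz1 two_ne_zero) (fun t h0 h1 => hstep _ _ (Or.inr (Or.inr ⟨?_, by ring⟩))) v]
    · congr 1; ring
    · refine ⟨(1 - t) / 2, (1 + t) / 2, by linarith, by linarith, by ring, ?_⟩
      simp; ring
  have e01 : ∀ v, E (z 0 + z 1 - v) = E v := by
    intro v
    rw [← ConeAtlas.even_of_even_on_segment hdev (m := (z 0 + z 1) / 2) (d := (z 0 - z 1) / 2)
      (div_ne_zero hz01 two_ne_zero)
      (fun t h0 h1 => hstep _ _ (Or.inr (Or.inl ⟨?_, by ring⟩))) v]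
    · congr 1; ring
    · refine ⟨(1 + t) / 2, (1 - t) / 2, by linarith, by linarith, by ring, ?_⟩
      simp; ring
  -- The product of the half turns about the midpoints of two sides is the translation by the third
  -- side.
  have p0 : z 0 ∈ ConeAtlas.periods E := fun v => by
    rw [← e01 (v + z 0), ← e1 v]; congr 1; ring
  have p1 : z 1 ∈ ConeAtlas.periods E := fun v => by
    rw [← e01 (v + z 1), ← e0 v]; congr 1; ring
  have hconic : E 0 ∈ hT.atlas.conic := by
    rw [ConeAtlas.mem_conic_iff hdev]
    intro v
    rw [← p0, ← e0 v]
    congr 1; ring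
  have hle : ∀ l, l ∈ lattice z → l ∈ ConeAtlas.periods E := by
    rintro l ⟨m, n, rfl⟩
    have := add_mem (AddSubgroup.zsmul_mem _ p0 m) (AddSubgroup.zsmul_mem _ p1 n)
    simpa only [zsmul_eq_mul] using this
  have hper : ∀ l, l ∈ ConeAtlas.periods E ↔ l ∈ lattice z := by
    intro l
    refine ⟨fun hl => ?_, hle l⟩
    -- For a period `l`, the point `x + l` is equivalent to some `y` in the triangle with `E x = E
    -- y`. Inner points are not identified with others, so `y = x`.
    have key : ∀ x ∈ interior Δ, l ∈ lattice z ∨ 2 * x + l ∈ lattice z := by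
      intro x hx
      obtain ⟨y, hy, hxy⟩ := exists_mem_triangle hz (x + l)
      have h1 : E x = E y := by
        rw [← hl x]
        exact (ConeAtlas.apply_eq_iff_periods hdev hconic).2 (hxy.imp (hle _) (hle _))
      rw [← hqE (interior_subset hx), ← hqE hy] at h1
      have h2 := eq_of_eqvGen_foldStep hz ((hqf _ (interior_subset hx) _ hy).1 h1) (Or.inl hx)
      rw [← h2] at hxy
      rcases hxy with h3 | h3
      · left
        rwa [add_sub_cancel_left] at h3
      · right
        convert h3 using 1
        ring
    by_contra hl'
    -- The test points differ by `z 0 / 12`; were `l` not in the lattice, twice the difference, `z 0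
    -- / 6`, would be.
    have k1 := (key (((1 / 4 : ℝ) : ℂ) * z 0 + ((1 / 4 : ℝ) : ℂ) * z 1)
      ((combo_mem_interior_iff hz).2 (by norm_num))).resolve_left hl'
    have k2 := (key (((1 / 3 : ℝ) : ℂ) * z 0 + ((1 / 4 : ℝ) : ℂ) * z 1)
      ((combo_mem_interior_iff hz).2 (by norm_num))).resolve_left hl'
    have k3 := sub_mem k2 k1
    have k4 : (2 * (((1 / 3 : ℝ) : ℂ) * z 0 + ((1 / 4 : ℝ) : ℂ) * z 1) + l
        - (2 * (((1 / 4 : ℝ) : ℂ) * z 0 + ((1 / 4 : ℝ) : ℂ) * z 1) + l))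
        = ((1 / 6 : ℝ) : ℂ) * z 0 + ((0 : ℝ) : ℂ) * z 1 := by
      push_cast
      ring
    rw [k4] at k3
    obtain ⟨⟨m, hm⟩, -⟩ := (combo_mem_lattice_iff hz).1 k3
    have h6 : (6 * m : ℝ) = 1 := by rw [← hm]; norm_num
    have h7 : 6 * m = 1 := by exact_mod_cast h6
    omega
  refine ⟨E, hdev, fun x y => ?_⟩
  rw [ConeAtlas.apply_eq_iff_periods hdev hconic, hper, hper]

end FlatSphere

/-! ### The sphere as the boundary of a tetrahedron -/

/-- The boundary of the standard tetrahedron. -/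
def tetraBoundary : Set (Fin 4 → ℝ) := {β | (∀ k, 0 ≤ β k) ∧ ∑ k, β k = 1 ∧ ∃ l, β l = 0}

/-- The tetrahedron in space with the vertices `e₀`, `e₁`, `e₂`, `-e₀ - e₁ - e₂`. -/
def tetraPoint (β : Fin 4 → ℝ) : EuclideanSpace ℝ (Fin 3) :=
  WithLp.toLp 2 fun i => β i.castSucc - β 3

theorem continuous_tetraPoint : Continuous tetraPoint := by
  refine (PiLp.continuous_toLp 2 _).comp ?_
  fun_prop

theorem tetraPoint_ne_zero {β : Fin 4 → ℝ} (h : β ∈ tetraBoundary) : tetraPoint β ≠ 0 := by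
  intro h0
  obtain ⟨-, h1, l, hl⟩ := h
  have h2 : ∀ k, β k = β 3 := by
    intro k
    refine Fin.lastCases rfl (fun i => ?_) k
    have := congrArg (fun w : EuclideanSpace ℝ (Fin 3) => w i) h0
    exact sub_eq_zero.1 this
  have h3 : ∀ k, β k = 0 := fun k => by rw [h2, ← h2 l, hl]
  simp [h3] at h1

open Classical in
/-- The radial projection of the boundary of the tetrahedron to the sphere. -/
def tetraSphere (β : Fin 4 → ℝ) : Sphere2 :=
  if h : ‖tetraPoint β‖⁻¹ • tetraPoint β ∈ Metric.sphere (0 : EuclideanSpace ℝ (Fin 3)) 1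
  then ⟨_, h⟩ else ⟨EuclideanSpace.single 0 1, by simp⟩

theorem coe_tetraSphere {β : Fin 4 → ℝ} (h : tetraPoint β ≠ 0) :
    (tetraSphere β : EuclideanSpace ℝ (Fin 3)) = ‖tetraPoint β‖⁻¹ • tetraPoint β := by
  have h1 : ‖tetraPoint β‖⁻¹ • tetraPoint β ∈ Metric.sphere (0 : EuclideanSpace ℝ (Fin 3)) 1 := by
    rw [mem_sphere_zero_iff_norm, norm_smul, norm_inv, norm_norm,
      inv_mul_cancel₀ (norm_ne_zero_iff.2 h)]
  rw [tetraSphere, dif_pos h1]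

theorem continuousOn_tetraSphere : ContinuousOn tetraSphere tetraBoundary := by
  rw [Topology.IsInducing.subtypeVal.continuousOn_iff]
  have h : ContinuousOn (fun β => ‖tetraPoint β‖⁻¹ • tetraPoint β) tetraBoundary :=
    (continuous_tetraPoint.norm.continuousOn.inv₀ fun β hβ =>
      norm_ne_zero_iff.2 (tetraPoint_ne_zero hβ)).smul continuous_tetraPoint.continuousOn
  exact h.congr fun β hβ => coe_tetraSphere (tetraPoint_ne_zero hβ)

/-- Equal directions mean that the coordinates agree up to a positive factor `t` and a common
summand `c`. Both points have a vanishing coordinate and no negative one, so `c = 0`; the sums then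
give `t = 1`. -/
theorem injOn_tetraSphere : Set.InjOn tetraSphere tetraBoundary := by
  intro β hβ γ hγ h
  have h0 := congrArg (Subtype.val) h
  rw [coe_tetraSphere (tetraPoint_ne_zero hβ), coe_tetraSphere (tetraPoint_ne_zero hγ)] at h0
  have hb := norm_pos_iff.2 (tetraPoint_ne_zero hβ)
  have hc := norm_pos_iff.2 (tetraPoint_ne_zero hγ)
  set t := ‖tetraPoint β‖ * ‖tetraPoint γ‖⁻¹ with ht
  have ht0 : 0 < t := by positivity
  have h1 : tetraPoint β = t • tetraPoint γ := by
    rw [ht, mul_smul, ← h0, smul_inv_smul₀ hb.ne']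
  obtain ⟨c, hc⟩ : ∃ c, c = β 3 - t * γ 3 := ⟨_, rfl⟩
  have h2 : ∀ k, β k = t * γ k + c := by
    intro k
    refine Fin.lastCases ?_ (fun i => ?_) k
    · change β 3 = t * γ 3 + c
      rw [hc]; ring
    · have h3 : β i.castSucc - β 3 = t * (γ i.castSucc - γ 3) :=
        congrArg (fun w : EuclideanSpace ℝ (Fin 3) => w i) h1
      rw [hc]
      linarith
  obtain ⟨hb1, hb2, l, hl⟩ := hβ
  obtain ⟨hc1, hc2, m, hm⟩ := hγ
  have hc0 : c = 0 := by
    apply le_antisymm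
    · have := h2 l
      have h3 := mul_nonneg ht0.le (hc1 l)
      linarith
    · have := h2 m
      rw [hm, mul_zero, zero_add] at this
      rw [← this]
      exact hb1 m
  have ht1 : t = 1 := by
    rw [← hb2]
    simp_rw [h2, hc0, add_zero]
    rw [← Finset.mul_sum, hc2, mul_one]
  funext k
  rw [h2, hc0, ht1, one_mul, add_zero]

/-- The coordinates of `p`, completed by a fourth coordinate `0`, are shifted by their minimum and
divided by their sum; neither operation changes the direction. -/
theorem exists_tetraSphere_eq (p : Sphere2) : ∃ β ∈ tetraBoundary, tetraSphere β = p := by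
  set u : Fin 4 → ℝ := fun k => Fin.lastCases 0 (fun i => (p : EuclideanSpace ℝ (Fin 3)) i) k with hu
  obtain ⟨l, -, hl⟩ := Finset.exists_min_image Finset.univ u Finset.univ_nonempty
  set w : Fin 4 → ℝ := fun k => u k - u l with hw
  have hw0 : ∀ k, 0 ≤ w k := fun k => sub_nonneg.2 (hl k (Finset.mem_univ k))
  have hnorm : ‖(p : EuclideanSpace ℝ (Fin 3))‖ = 1 := mem_sphere_zero_iff_norm.1 p.2
  have hu3 : u 3 = 0 := rfl
  have hui : ∀ i : Fin 3, u i.castSucc = (p : EuclideanSpace ℝ (Fin 3)) i := fun i => by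
    simp [hu]
  have hs : 0 < ∑ k, w k := by
    refine lt_of_le_of_ne (Finset.sum_nonneg fun k _ => hw0 k) fun h0 => ?_
    have h1 : ∀ k, w k = 0 := fun k =>
      (Finset.sum_eq_zero_iff_of_nonneg fun k _ => hw0 k).1 h0.symm k (Finset.mem_univ k)
    have h2 : ∀ k, u k = 0 := fun k => by
      rw [← hu3, sub_eq_zero.1 (h1 k), sub_eq_zero.1 (h1 3)]
    have h3 : (p : EuclideanSpace ℝ (Fin 3)) = 0 := by
      ext i
      rw [← hui, h2]
      rfl
    rw [h3, norm_zero] at hnorm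
    exact zero_ne_one hnorm
  set s := ∑ k, w k with hsdef
  have hβ : (fun k => w k / s) ∈ tetraBoundary :=
    ⟨fun k => div_nonneg (hw0 k) hs.le, by rw [← Finset.sum_div, div_self hs.ne'],
      l, by simp [hw]⟩
  refine ⟨_, hβ, Subtype.ext ?_⟩
  rw [coe_tetraSphere (tetraPoint_ne_zero hβ)]
  have h1 : tetraPoint (fun k => w k / s) = s⁻¹ • (p : EuclideanSpace ℝ (Fin 3)) := by
    ext i
    change w i.castSucc / s - w 3 / s = s⁻¹ * (p : EuclideanSpace ℝ (Fin 3)) i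
    rw [← hui]
    simp only [hw, hu3]
    field_simp
    ring
  rw [h1, norm_smul, hnorm, norm_inv, Real.norm_of_nonneg hs.le, mul_one, inv_inv, smul_smul,
    mul_inv_cancel₀ hs.ne', one_smul]

/-! ### The midpoint subdivision of a triangle folded to a tetrahedron -/

/-- The coordinates on the tetrahedron of the point with the coordinates `s, t` in the piece `k` of
the midpoint subdivision of a triangle. -/
def foldCoord (k : Fin 4) (s t : ℝ) : Fin 4 → ℝ :=
  ![![0, 2 * t, 2 * s, 1 - 2 * s - 2 * t], ![2 * t, 0, 2 - 2 * s - 2 * t, 2 * s - 1],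
    ![2 * s, 2 - 2 * s - 2 * t, 0, 2 * t - 1], ![2 * s + 2 * t - 1, 1 - 2 * s, 1 - 2 * t, 0]] k

/-- The vertex of the tetrahedron at a vertex of a piece. -/
def foldLabel : Fin 4 → Fin 3 → Fin 4 := ![![3, 2, 1], ![3, 0, 2], ![3, 1, 0], ![0, 1, 2]]

/-- The vertex of the whole triangle which corresponds to a vertex of a piece. -/
def foldType : Fin 4 → Fin 3 → Fin 3 := ![![0, 1, 2], ![1, 2, 0], ![2, 0, 1], ![0, 1, 2]]

/-- The vertices of the pieces. -/
def foldVert (z : Fin 2 → ℂ) : Fin 4 → Fin 3 → ℂ :=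
  ![![0, z 0 / 2, z 1 / 2], ![z 0, (z 0 + z 1) / 2, z 0 / 2], ![z 1, z 1 / 2, (z 0 + z 1) / 2],
    ![(z 0 + z 1) / 2, z 1 / 2, z 0 / 2]]

theorem foldLabel_ne (k : Fin 4) (i : Fin 3) : foldLabel k i ≠ k := by
  revert k i; decide

theorem foldLabel_injective (k : Fin 4) : Function.Injective (foldLabel k) := by
  intro i j; revert k i j; decide

theorem exists_foldLabel_eq {k l : Fin 4} (h : l ≠ k) : ∃ i, foldLabel k i = l := by
  revert k l; decide

theorem sum_foldCoord (k : Fin 4) (s t : ℝ) : ∑ l, foldCoord k s t l = 1 := by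
  fin_cases k <;> simp [foldCoord, Fin.sum_univ_four] <;> ring

theorem foldCoord_self (k : Fin 4) (s t : ℝ) : foldCoord k s t k = 0 := by
  fin_cases k <;> rfl

theorem foldCoord_mem {k : Fin 4} {s t : ℝ} (h : ∀ l, 0 ≤ foldCoord k s t l) :
    foldCoord k s t ∈ tetraBoundary :=
  ⟨h, sum_foldCoord k s t, k, foldCoord_self k s t⟩

theorem foldCoord_eq_iff {k l : Fin 4} {s t s' t' : ℝ} :
    foldCoord k s t = foldCoord l s' t' ↔ foldCoord k s t 0 = foldCoord l s' t' 0 ∧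
      foldCoord k s t 1 = foldCoord l s' t' 1 ∧ foldCoord k s t 2 = foldCoord l s' t' 2 ∧
      foldCoord k s t 3 = foldCoord l s' t' 3 := by
  constructor
  · intro h
    rw [h]
    exact ⟨rfl, rfl, rfl, rfl⟩
  · rintro ⟨h0, h1, h2, h3⟩
    funext m
    fin_cases m
    exacts [h0, h1, h2, h3]

theorem foldCoord_nonneg_iff {k : Fin 4} {s t : ℝ} :
    (∀ l, 0 ≤ foldCoord k s t l) ↔ 0 ≤ foldCoord k s t 0 ∧ 0 ≤ foldCoord k s t 1 ∧
      0 ≤ foldCoord k s t 2 ∧ 0 ≤ foldCoord k s t 3 := by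
  constructor
  · exact fun h => ⟨h 0, h 1, h 2, h 3⟩
  · rintro ⟨h0, h1, h2, h3⟩ m
    fin_cases m
    exacts [h0, h1, h2, h3]

/-- Points of two pieces with the same coordinates agree or are exchanged by a half turn about the
midpoint of an edge. -/
theorem foldCoord_eq_cases (k l : Fin 4) :
    (∀ s t s' t', foldCoord k s t = foldCoord l s' t' → s = s' ∧ t = t') ∨
    (∀ s t s' t', foldCoord k s t = foldCoord l s' t' → s + s' = 1 ∧ t = 0 ∧ t' = 0) ∨
    (∀ s t s' t', foldCoord k s t = foldCoord l s' t' → s = 0 ∧ s' = 0 ∧ t + t' = 1) ∨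
    (∀ s t s' t', foldCoord k s t = foldCoord l s' t' → s + t = 1 ∧ s + s' = 1 ∧ t + t' = 1) := by
  have key : k = l ∨ k = 3 ∨ l = 3 ∨ (k = 0 ∧ l = 1) ∨ (k = 1 ∧ l = 0) ∨ (k = 0 ∧ l = 2) ∨
      (k = 2 ∧ l = 0) ∨ (k = 1 ∧ l = 2) ∨ (k = 2 ∧ l = 1) := by
    revert k l; decide
  rcases key with h | h | h | h | h | h | h | h | h
  · left
    subst h
    intro s t s' t' h
    rw [foldCoord_eq_iff] at h
    fin_cases k <;> simp [foldCoord] at h <;> constructor <;> linarith [h.1, h.2.1, h.2.2]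
  · left
    subst h
    intro s t s' t' h
    rw [foldCoord_eq_iff] at h
    fin_cases l <;> simp [foldCoord] at h <;> constructor <;> linarith [h.1, h.2.1, h.2.2]
  · left
    subst h
    intro s t s' t' h
    rw [foldCoord_eq_iff] at h
    fin_cases k <;> simp [foldCoord] at h <;> constructor <;> linarith [h.1, h.2.1, h.2.2]
  · obtain ⟨rfl, rfl⟩ := h
    refine Or.inr (Or.inl fun s t s' t' h => ?_)
    rw [foldCoord_eq_iff] at h
    simp [foldCoord] at h
    refine ⟨?_, ?_, ?_⟩ <;> linarith [h.1, h.2.1, h.2.2.1, h.2.2.2]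
  · obtain ⟨rfl, rfl⟩ := h
    refine Or.inr (Or.inl fun s t s' t' h => ?_)
    rw [foldCoord_eq_iff] at h
    simp [foldCoord] at h
    refine ⟨?_, ?_, ?_⟩ <;> linarith [h.1, h.2.1, h.2.2.1, h.2.2.2]
  · obtain ⟨rfl, rfl⟩ := h
    refine Or.inr (Or.inr (Or.inl fun s t s' t' h => ?_))
    rw [foldCoord_eq_iff] at h
    simp [foldCoord] at h
    refine ⟨?_, ?_, ?_⟩ <;> linarith [h.1, h.2.1, h.2.2.1, h.2.2.2]
  · obtain ⟨rfl, rfl⟩ := h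
    refine Or.inr (Or.inr (Or.inl fun s t s' t' h => ?_))
    rw [foldCoord_eq_iff] at h
    simp [foldCoord] at h
    refine ⟨?_, ?_, ?_⟩ <;> linarith [h.1, h.2.1, h.2.2.1, h.2.2.2]
  · obtain ⟨rfl, rfl⟩ := h
    refine Or.inr (Or.inr (Or.inr fun s t s' t' h => ?_))
    rw [foldCoord_eq_iff] at h
    simp [foldCoord] at h
    refine ⟨?_, ?_, ?_⟩ <;> linarith [h.1, h.2.1, h.2.2.1, h.2.2.2]
  · obtain ⟨rfl, rfl⟩ := h
    refine Or.inr (Or.inr (Or.inr fun s t s' t' h => ?_))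
    rw [foldCoord_eq_iff] at h
    simp [foldCoord] at h
    refine ⟨?_, ?_, ?_⟩ <;> linarith [h.1, h.2.1, h.2.2.1, h.2.2.2]

open Classical in
/-- The folding of a triangle to a tetrahedron. -/
def foldMap (s t : ℝ) : Fin 4 → ℝ :=
  if 0 ≤ 1 - 2 * s - 2 * t then foldCoord 0 s t else if 0 ≤ 2 * s - 1 then foldCoord 1 s t
  else if 0 ≤ 2 * t - 1 then foldCoord 2 s t else foldCoord 3 s t

/-- On the midlines, where pieces overlap, the affine formulas agree, so the order of the cases in
the definition is immaterial. -/
theorem foldMap_eq {k : Fin 4} {s t : ℝ} (h : ∀ l, 0 ≤ foldCoord k s t l) :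
    foldMap s t = foldCoord k s t := by
  rw [foldCoord_nonneg_iff] at h
  rw [foldMap]
  split_ifs with h1 h2 h3 <;> rw [foldCoord_eq_iff] <;> fin_cases k <;>
    simp only [foldCoord, Matrix.cons_val, Fin.zero_eta, Fin.mk_one, Fin.reduceFinMk] at h ⊢ <;>
    obtain ⟨h4, h5, h6, h7⟩ := h <;> refine ⟨?_, ?_, ?_, ?_⟩ <;> first | trivial | linarith

theorem exists_foldCoord_nonneg {s t : ℝ} (hs : 0 ≤ s) (ht : 0 ≤ t) (hst : s + t ≤ 1) :
    ∃ k, ∀ l, 0 ≤ foldCoord k s t l := by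
  by_cases h0 : 0 ≤ 1 - 2 * s - 2 * t
  · refine ⟨0, foldCoord_nonneg_iff.2 ?_⟩
    simp only [foldCoord, Matrix.cons_val]
    refine ⟨?_, ?_, ?_, ?_⟩ <;> linarith
  by_cases h1 : 0 ≤ 2 * s - 1
  · refine ⟨1, foldCoord_nonneg_iff.2 ?_⟩
    simp only [foldCoord, Matrix.cons_val]
    refine ⟨?_, ?_, ?_, ?_⟩ <;> linarith
  by_cases h2 : 0 ≤ 2 * t - 1
  · refine ⟨2, foldCoord_nonneg_iff.2 ?_⟩
    simp only [foldCoord, Matrix.cons_val]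
    refine ⟨?_, ?_, ?_, ?_⟩ <;> linarith
  refine ⟨3, foldCoord_nonneg_iff.2 ?_⟩
  simp only [foldCoord, Matrix.cons_val]
  push Not at h0 h1 h2
  refine ⟨?_, ?_, ?_, ?_⟩ <;> linarith

theorem of_foldCoord_nonneg {k : Fin 4} {s t : ℝ} (h : ∀ l, 0 ≤ foldCoord k s t l) :
    0 ≤ s ∧ 0 ≤ t ∧ s + t ≤ 1 := by
  rw [foldCoord_nonneg_iff] at h
  fin_cases k <;> simp only [foldCoord, Matrix.cons_val, Fin.zero_eta, Fin.mk_one, Fin.reduceFinMk] at h <;>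
    obtain ⟨h0, h1, h2, h3⟩ := h <;> refine ⟨?_, ?_, ?_⟩ <;> linarith

/-! ### The cone metric on the tetrahedron -/

section Tetra

variable {z : Fin 2 → ℂ}

theorem bary_eq_of_combo {v : Fin 3 → ℂ} (hv : area2 v ≠ 0) {w : Fin 3 → ℝ} (hw : ∑ i, w i = 1)
    (i : Fin 3) : bary v i (∑ j, w j • v j) = w i := by
  rw [Fin.sum_univ_three] at hw ⊢
  have h0 : w 0 = 1 - w 1 - w 2 := by linarith
  rw [bary, div_eq_iff hv]
  fin_cases i <;> simp [area2, cross, h0] <;> ring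

/-- The first coordinate with respect to a basis of the plane. -/
def coordFst (z : Fin 2 → ℂ) (x : ℂ) : ℝ := bary ![0, z 0, z 1] 1 x

/-- The second coordinate with respect to a basis of the plane. -/
def coordSnd (z : Fin 2 → ℂ) (x : ℂ) : ℝ := bary ![0, z 0, z 1] 2 x

theorem coord_combo (hz : z ∈ Hplus) (s t : ℝ) :
    coordFst z (s * z 0 + t * z 1) = s ∧ coordSnd z (s * z 0 + t * z 1) = t :=
  (bary_zero_combo hz s t).2

theorem coord_spec (hz : z ∈ Hplus) (x : ℂ) : x = coordFst z x * z 0 + coordSnd z x * z 1 := by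
  obtain ⟨s, t, rfl⟩ := exists_combo hz x
  rw [(coord_combo hz s t).1, (coord_combo hz s t).2]

theorem continuous_coordFst : Continuous (coordFst z) := continuous_bary 1

theorem continuous_coordSnd : Continuous (coordSnd z) := continuous_bary 2

theorem area2_foldVert (k : Fin 4) : area2 (foldVert z k) = area2 ![0, z 0, z 1] / 4 := by
  fin_cases k <;> simp [foldVert, area2, cross] <;> ring

theorem area2_foldVert_pos (hz : z ∈ Hplus) (k : Fin 4) : 0 < area2 (foldVert z k) := by
  rw [area2_foldVert]
  have := area2_pos_of_mem_Hplus hz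
  positivity

/-- The coordinates of a point of the plane with respect to a piece. -/
def foldPoint (z : Fin 2 → ℂ) (k : Fin 4) (x : ℂ) : Fin 4 → ℝ :=
  foldCoord k (coordFst z x) (coordSnd z x)

theorem continuous_foldPoint (k : Fin 4) : Continuous (foldPoint z k) := by
  have h1 := continuous_coordFst (z := z)
  have h2 := continuous_coordSnd (z := z)
  refine continuous_pi fun l => ?_
  fin_cases k <;> fin_cases l <;> simp [foldPoint, foldCoord] <;> fun_prop

/-- The link between the tables and the geometry: on each piece the tetrahedral coordinates are its
barycentric coordinates, rearranged by `foldLabel`. -/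
theorem bary_foldVert (hz : z ∈ Hplus) (k : Fin 4) (i : Fin 3) (x : ℂ) :
    bary (foldVert z k) i x = foldPoint z k x (foldLabel k i) := by
  obtain ⟨s, t, rfl⟩ := exists_combo hz x
  rw [foldPoint, (coord_combo hz s t).1, (coord_combo hz s t).2]
  have h1 : ∑ j, foldCoord k s t (foldLabel k j) = 1 := by
    fin_cases k <;> simp [foldCoord, foldLabel, Fin.sum_univ_three] <;> ring
  have h2 : (s * z 0 + t * z 1 : ℂ) = ∑ j, foldCoord k s t (foldLabel k j) • foldVert z k j := by
    fin_cases k <;> simp [foldCoord, foldLabel, foldVert, Fin.sum_univ_three] <;> ring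
  rw [h2]
  exact bary_eq_of_combo (w := fun j => foldCoord k s t (foldLabel k j))
    (area2_foldVert_pos hz k).ne' h1 i

theorem mem_foldTriangle_iff (hz : z ∈ Hplus) {k : Fin 4} {x : ℂ} :
    x ∈ triangle (foldVert z k) ↔ ∀ l, 0 ≤ foldPoint z k x l := by
  rw [mem_triangle_iff (area2_foldVert_pos hz k).ne']
  simp_rw [bary_foldVert hz]
  constructor
  · intro h l
    by_cases hl : l = k
    · rw [hl, foldPoint, foldCoord_self]
    · obtain ⟨i, rfl⟩ := exists_foldLabel_eq hl
      exact h i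
  · exact fun h i => h _

theorem foldPoint_mem (hz : z ∈ Hplus) {k : Fin 4} {x : ℂ} (hx : x ∈ triangle (foldVert z k)) :
    foldPoint z k x ∈ tetraBoundary :=
  foldCoord_mem ((mem_foldTriangle_iff hz).1 hx)

theorem foldPoint_vert (hz : z ∈ Hplus) (k : Fin 4) (i : Fin 3) :
    foldPoint z k (foldVert z k i) = Pi.single (foldLabel k i) 1 := by
  funext l
  by_cases hl : l = k
  · rw [hl, foldPoint, foldCoord_self, Pi.single_eq_of_ne (foldLabel_ne k i).symm]
  · obtain ⟨j, rfl⟩ := exists_foldLabel_eq hl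
    rw [← bary_foldVert hz]
    by_cases hij : i = j
    · rw [hij, bary_self (area2_foldVert_pos hz k).ne', Pi.single_eq_same]
    · rw [bary_of_ne hij, Pi.single_eq_of_ne fun h => hij (foldLabel_injective k h).symm]

theorem eq_of_coord_eq (hz : z ∈ Hplus) {x y : ℂ} (h1 : coordFst z x = coordFst z y)
    (h2 : coordSnd z x = coordSnd z y) : x = y := by
  rw [coord_spec hz x, coord_spec hz y, h1, h2]

/-- A point of the tetrahedron belongs to the face opposite to `k` if and only if its coordinate
`k` vanishes. -/
theorem exists_foldPoint_eq (hz : z ∈ Hplus) {β : Fin 4 → ℝ} (hβ : β ∈ tetraBoundary) {k : Fin 4}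
    (hk : β k = 0) : ∃ x ∈ triangle (foldVert z k), foldPoint z k x = β := by
  have h1 : ∑ i, β (foldLabel k i) = 1 := by
    have := hβ.2.1
    rw [Fin.sum_univ_four] at this
    rw [Fin.sum_univ_three]
    fin_cases k <;> simp [foldLabel] at hk ⊢ <;> linarith
  have h2 : foldPoint z k (∑ j, β (foldLabel k j) • foldVert z k j) = β := by
    funext l
    by_cases hl : l = k
    · rw [hl, foldPoint, foldCoord_self, hk]
    · obtain ⟨i, rfl⟩ := exists_foldLabel_eq hl
      rw [← bary_foldVert hz]
      exact bary_eq_of_combo (w := fun j => β (foldLabel k j)) (area2_foldVert_pos hz k).ne' h1 i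
  exact ⟨_, (mem_foldTriangle_iff hz).2 fun l => by rw [h2]; exact hβ.1 l, h2⟩

theorem single_mem_tetraBoundary (l : Fin 4) : (Pi.single l 1 : Fin 4 → ℝ) ∈ tetraBoundary := by
  refine ⟨fun k => ?_, by simp, l + 1, ?_⟩
  · rw [Pi.single_apply]
    split_ifs <;> norm_num
  · rw [Pi.single_eq_of_ne]
    revert l; decide

theorem single_injective : Function.Injective fun l : Fin 4 => (Pi.single l 1 : Fin 4 → ℝ) := by
  intro k l h
  by_contra hkl
  have := congrFun h k
  simp only [Pi.single_eq_same] at this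
  rw [Pi.single_eq_of_ne hkl] at this
  exact one_ne_zero this

/-- Piece `k` becomes the face of the tetrahedron where coordinate `k` vanishes, so two pieces meet
where both coordinates vanish, along an edge. -/
theorem foldInter (hz : z ∈ Hplus) (k l : Fin 4) (hkl : k ≠ l) :
    (fun x => tetraSphere (foldPoint z k x)) '' triangle (foldVert z k) ∩
      (fun x => tetraSphere (foldPoint z l x)) '' triangle (foldVert z l)
      = (fun x => tetraSphere (foldPoint z k x)) '' convexHull ℝ
        (foldVert z k '' (Finset.univ.filter fun i => foldLabel k i ≠ l)) := by
  have hface : ∀ x, x ∈ convexHull ℝ (foldVert z k '' (Finset.univ.filter fun i =>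
      foldLabel k i ≠ l : Finset (Fin 3))) ↔
      x ∈ triangle (foldVert z k) ∧ foldPoint z k x l = 0 := by
    intro x
    rw [mem_face_iff (area2_foldVert_pos hz k).ne', mem_triangle_iff (area2_foldVert_pos hz k).ne',
      forall_and]
    refine and_congr_right fun _ => ?_
    obtain ⟨i, rfl⟩ := exists_foldLabel_eq hkl.symm
    rw [← bary_foldVert hz]
    constructor
    · intro h
      exact h i (by simp)
    · intro h j hj
      have : j = i := foldLabel_injective k (by simpa using hj)
      rwa [this]
  ext p
  constructor
  · rintro ⟨⟨x, hx, rfl⟩, y, hy, hxy⟩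
    have h1 := injOn_tetraSphere (foldPoint_mem hz hy) (foldPoint_mem hz hx) hxy
    refine ⟨x, (hface x).2 ⟨hx, ?_⟩, rfl⟩
    rw [← h1, foldPoint, foldCoord_self]
  · rintro ⟨x, hx, rfl⟩
    obtain ⟨hx, h1⟩ := (hface x).1 hx
    obtain ⟨y, hy, h2⟩ := exists_foldPoint_eq hz (foldPoint_mem hz hx) h1
    exact ⟨⟨x, hx, rfl⟩, y, hy, by simp only [h2]⟩

theorem card_foldFace {k l : Fin 4} (h : k ≠ l) :
    (Finset.univ.filter fun i => foldLabel k i ≠ l).card ≤ 2 := by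
  revert k l; decide

/-- The triangle `0, z 0, z 1` folded along the midpoint triangle. -/
def foldedSphere (z : Fin 2 → ℂ) (hz : z ∈ Hplus) : FlatSphere where
  n := 4
  vert := foldVert z
  pos k := area2_pos_iff.2 (area2_foldVert_pos hz k)
  param k x := tetraSphere (foldPoint z k x)
  continuousOn k := continuousOn_tetraSphere.comp (continuous_foldPoint k).continuousOn
    fun _ hx => foldPoint_mem hz hx
  injOn k x hx y hy hxy := by
    have h := injOn_tetraSphere (foldPoint_mem hz hx) (foldPoint_mem hz hy) hxy
    refine eq_of_bary_eq (area2_foldVert_pos hz k).ne' fun i => ?_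
    rw [bary_foldVert hz, bary_foldVert hz, h]
  cover := by
    rw [Set.eq_univ_iff_forall]
    intro p
    obtain ⟨β, hβ, rfl⟩ := exists_tetraSphere_eq p
    obtain ⟨k, hk⟩ := hβ.2.2
    obtain ⟨x, hx, h⟩ := exists_foldPoint_eq hz hβ hk
    exact Set.mem_iUnion.2 ⟨k, x, hx, by simp only [h]⟩
  inter k l hkl := by
    refine ⟨_, _, card_foldFace hkl, card_foldFace hkl.symm, foldInter hz k l hkl, ?_⟩
    rw [Set.inter_comm]
    exact foldInter hz l k hkl.symm
  compat k l := by
    have key : ∀ x ∈ triangle (foldVert z k), ∀ y ∈ triangle (foldVert z l),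
        tetraSphere (foldPoint z k x) = tetraSphere (foldPoint z l y) →
        foldPoint z k x = foldPoint z l y := fun x hx y hy h =>
      injOn_tetraSphere (foldPoint_mem hz hx) (foldPoint_mem hz hy) h
    rcases foldCoord_eq_cases k l with h | h | h | h
    · refine ⟨IsometryEquiv.refl ℂ, fun x hx y hy hxy => ?_⟩
      obtain ⟨h1, h2⟩ := h _ _ _ _ (key x hx y hy hxy)
      exact eq_of_coord_eq hz h1 h2
    · refine ⟨IsometryEquiv.subLeft (z 0), fun x hx y hy hxy => ?_⟩
      obtain ⟨h1, h2, h3⟩ := h _ _ _ _ (key x hx y hy hxy)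
      change x = z 0 - y
      rw [coord_spec hz x, coord_spec hz y, h2, h3, eq_sub_of_add_eq h1]
      push_cast
      ring
    · refine ⟨IsometryEquiv.subLeft (z 1), fun x hx y hy hxy => ?_⟩
      obtain ⟨h1, h2, h3⟩ := h _ _ _ _ (key x hx y hy hxy)
      change x = z 1 - y
      rw [coord_spec hz x, coord_spec hz y, h1, h2, eq_sub_of_add_eq h3]
      push_cast
      ring
    · refine ⟨IsometryEquiv.subLeft (z 0 + z 1), fun x hx y hy hxy => ?_⟩
      obtain ⟨h1, h2, h3⟩ := h _ _ _ _ (key x hx y hy hxy)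
      change x = z 0 + z 1 - y
      rw [coord_spec hz x, coord_spec hz y, eq_sub_of_add_eq h2, eq_sub_of_add_eq h3]
      push_cast
      ring
  coherent k l i j h1 h2 := by
    simp only [foldPoint_vert hz] at h1 h2
    have h3 := single_injective (injOn_tetraSphere (single_mem_tetraBoundary _)
      (single_mem_tetraBoundary _) h1)
    have h4 := single_injective (injOn_tetraSphere (single_mem_tetraBoundary _)
      (single_mem_tetraBoundary _) h2)
    clear h1 h2
    revert k l i j
    decide
  closed k i := by
    simp only [foldPoint_vert hz]
    have : ∃ l j, foldLabel k i = foldLabel l (j + 1) ∧ foldLabel k (i + 1) = foldLabel l j := by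
      revert k i; decide
    obtain ⟨l, j, h1, h2⟩ := this
    exact ⟨l, j, by rw [h1], by rw [h2]⟩

end Tetra

/-! ### The folded triangle has four cone angles `π` -/

section FoldedAngles

variable {z : Fin 2 → ℂ}

/-- The pieces are homothetic to the whole triangle, with ratio `1 / 2` at the corners and `-1 / 2`
in the middle; so they have the same angles. -/
theorem foldVert_sub (k : Fin 4) : ∃ r : ℝ, r ≠ 0 ∧ ∀ i j, foldVert z k i - foldVert z k j
    = r • (![0, z 0, z 1] (foldType k i) - ![0, z 0, z 1] (foldType k j)) := by
  by_cases hk : k = 3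
  · subst hk
    refine ⟨-1 / 2, by norm_num, fun i j => ?_⟩
    fin_cases i <;> fin_cases j <;> simp [foldVert, foldType] <;> ring
  · refine ⟨1 / 2, by norm_num, fun i j => ?_⟩
    fin_cases k
    · fin_cases i <;> fin_cases j <;> simp [foldVert, foldType] <;> ring
    · fin_cases i <;> fin_cases j <;> simp [foldVert, foldType] <;> ring
    · fin_cases i <;> fin_cases j <;> simp [foldVert, foldType] <;> ring
    · exact absurd rfl hk

theorem foldType_add (k : Fin 4) (i j : Fin 3) : foldType k (i + j) = foldType k i + j := by
  revert k i j; decide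

theorem angle_foldVert (k : Fin 4) (i : Fin 3) :
    EuclideanGeometry.angle (foldVert z k (i + 1)) (foldVert z k i) (foldVert z k (i + 2))
      = EuclideanGeometry.angle (![0, z 0, z 1] (foldType k i + 1)) (![0, z 0, z 1] (foldType k i))
        (![0, z 0, z 1] (foldType k i + 2)) := by
  obtain ⟨r, hr, h⟩ := foldVert_sub (z := z) k
  rw [EuclideanGeometry.angle, EuclideanGeometry.angle, vsub_eq_sub, vsub_eq_sub, h, h,
    InnerProductGeometry.angle_smul_smul hr, foldType_add, foldType_add]
  rfl

/-- At each vertex of the tetrahedron three pieces meet, each with a different one of the three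
angles of the triangle. -/
theorem sum_foldType (f : Fin 3 → ℝ) (l : Fin 4) :
    ∑ k, ∑ i, (if foldLabel k i = l then f (foldType k i) else 0) = f 0 + f 1 + f 2 := by
  simp only [Fin.sum_univ_four, Fin.sum_univ_three]
  fin_cases l <;> simp [foldLabel, foldType] <;> ring

theorem param_foldVert_eq_iff (hz : z ∈ Hplus) {k l : Fin 4} {i : Fin 3} :
    (foldedSphere z hz).param k ((foldedSphere z hz).vert k i) = tetraSphere (Pi.single l 1) ↔
      foldLabel k i = l := by
  change tetraSphere (foldPoint z k (foldVert z k i)) = _ ↔ _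
  rw [foldPoint_vert hz]
  constructor
  · intro h
    exact single_injective (injOn_tetraSphere (single_mem_tetraBoundary _)
      (single_mem_tetraBoundary _) h)
  · rintro rfl
    rfl

theorem coneAngle_foldedSphere (hz : z ∈ Hplus) (l : Fin 4) :
    (foldedSphere z hz).coneAngle (tetraSphere (Pi.single l 1)) = Real.pi := by
  have hex : ∃ k i, foldLabel k i = l := by revert l; decide
  obtain ⟨k, i, hki⟩ := hex
  rw [FlatSphere.coneAngle, if_pos ⟨k, i, (param_foldVert_eq_iff hz).2 hki⟩]
  have h1 := sum_foldType (fun j => EuclideanGeometry.angle (![0, z 0, z 1] (j + 1))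
    (![0, z 0, z 1] j) (![0, z 0, z 1] (j + 2))) l
  simp only [← angle_foldVert] at h1
  refine (Eq.trans (Finset.sum_congr rfl fun k _ => Finset.sum_congr rfl fun i _ =>
    if_congr (param_foldVert_eq_iff hz) rfl rfl) h1).trans ?_
  have h0 : z 0 ≠ 0 := by
    intro h0
    rw [mem_Hplus_iff, h0] at hz
    simp at hz
  have h2 := EuclideanGeometry.angle_add_angle_add_angle_eq_pi (p₁ := 0) (p₂ := z 0) (z 1) h0
  rw [← h2]
  change EuclideanGeometry.angle (z 0) 0 (z 1) + EuclideanGeometry.angle (z 1) (z 0) 0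
    + EuclideanGeometry.angle 0 (z 1) (z 0) = _
  rw [EuclideanGeometry.angle_comm (z 1) (z 0) 0, EuclideanGeometry.angle_comm 0 (z 1) (z 0),
    EuclideanGeometry.angle_comm (z 0) 0 (z 1)]
  ring

theorem singularSet_foldedSphere (hz : z ∈ Hplus) : (foldedSphere z hz).singularSet
    = Set.range fun l : Fin 4 => tetraSphere (Pi.single l 1) := by
  ext p
  constructor
  · intro hp
    by_contra h
    refine hp (if_neg ?_)
    rintro ⟨k, i, hki⟩
    exact h ⟨foldLabel k i, ((param_foldVert_eq_iff hz).2 rfl).symm.trans hki⟩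
  · rintro ⟨l, rfl⟩
    change (foldedSphere z hz).coneAngle (tetraSphere (Pi.single l 1)) ≠ 2 * Real.pi
    rw [coneAngle_foldedSphere hz]
    linarith [Real.pi_pos]

theorem isPiPiPiPi_foldedSphere (hz : z ∈ Hplus) : (foldedSphere z hz).IsPiPiPiPi := by
  refine ⟨?_, ?_⟩
  · rw [singularSet_foldedSphere, ← Set.image_univ, Set.ncard_image_of_injective, Set.ncard_univ]
    · simp
    · intro k l h
      exact single_injective (injOn_tetraSphere (single_mem_tetraBoundary _)
        (single_mem_tetraBoundary _) h)
  · intro p hp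
    rw [singularSet_foldedSphere] at hp
    obtain ⟨l, rfl⟩ := hp
    exact coneAngle_foldedSphere hz l

/-! ### The folded triangle is a gluing -/

/-- The quotient map from the triangle to the folded triangle. -/
def foldQuot (z : Fin 2 → ℂ) (x : ℂ) : Sphere2 :=
  tetraSphere (foldMap (coordFst z x) (coordSnd z x))

theorem foldQuot_eq (hz : z ∈ Hplus) {k : Fin 4} {x : ℂ} (hx : x ∈ triangle (foldVert z k)) :
    foldQuot z x = (foldedSphere z hz).param k x := by
  change tetraSphere _ = tetraSphere _
  rw [foldMap_eq ((mem_foldTriangle_iff hz).1 hx)]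
  rfl

theorem mem_triangle_iff_coord (hz : z ∈ Hplus) {x : ℂ} : x ∈ triangle ![0, z 0, z 1] ↔
    0 ≤ coordFst z x ∧ 0 ≤ coordSnd z x ∧ coordFst z x + coordSnd z x ≤ 1 := by
  rw [← combo_mem_triangle_iff hz, ← coord_spec hz x]

theorem foldTriangle_subset (hz : z ∈ Hplus) (k : Fin 4) :
    triangle (foldVert z k) ⊆ triangle ![0, z 0, z 1] := fun _ hx =>
  (mem_triangle_iff_coord hz).2 (of_foldCoord_nonneg ((mem_foldTriangle_iff hz).1 hx))

theorem exists_mem_foldTriangle (hz : z ∈ Hplus) {x : ℂ} (hx : x ∈ triangle ![0, z 0, z 1]) :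
    ∃ k, x ∈ triangle (foldVert z k) := by
  obtain ⟨h1, h2, h3⟩ := (mem_triangle_iff_coord hz).1 hx
  obtain ⟨k, hk⟩ := exists_foldCoord_nonneg h1 h2 h3
  exact ⟨k, (mem_foldTriangle_iff hz).2 hk⟩

theorem foldMap_fst {s : ℝ} : foldMap s 0 = foldMap (1 - s) 0 := by
  rw [foldMap, foldMap]
  split_ifs <;> rw [foldCoord_eq_iff] <;> simp only [foldCoord, Matrix.cons_val] <;>
    refine ⟨?_, ?_, ?_, ?_⟩ <;> first | trivial | linarith

theorem foldMap_snd {s : ℝ} : foldMap 0 s = foldMap 0 (1 - s) := by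
  rw [foldMap, foldMap]
  split_ifs <;> rw [foldCoord_eq_iff] <;> simp only [foldCoord, Matrix.cons_val] <;>
    refine ⟨?_, ?_, ?_, ?_⟩ <;> first | trivial | linarith

theorem foldMap_diag {s : ℝ} : foldMap s (1 - s) = foldMap (1 - s) s := by
  rw [foldMap, foldMap]
  split_ifs <;> rw [foldCoord_eq_iff] <;> simp only [foldCoord, Matrix.cons_val] <;>
    refine ⟨?_, ?_, ?_, ?_⟩ <;> first | trivial | linarith

theorem foldQuot_eq_of_foldStep (hz : z ∈ Hplus) {x y : ℂ} (h : FoldStep z x y) :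
    foldQuot z x = foldQuot z y := by
  obtain ⟨s, -, -, ⟨rfl, rfl⟩ | ⟨rfl, rfl⟩ | ⟨rfl, rfl⟩⟩ := foldStep_combo h <;>
    rw [foldQuot, foldQuot, (coord_combo hz _ _).1, (coord_combo hz _ _).2,
      (coord_combo hz _ _).1, (coord_combo hz _ _).2]
  · rw [foldMap_fst]
  · rw [foldMap_diag]
  · rw [foldMap_snd]

theorem foldQuot_eq_iff (hz : z ∈ Hplus) {x y : ℂ} (hx : x ∈ triangle ![0, z 0, z 1])
    (hy : y ∈ triangle ![0, z 0, z 1]) :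
    foldQuot z x = foldQuot z y ↔ Relation.EqvGen (FoldStep z) x y := by
  constructor
  · intro h
    obtain ⟨k, hk⟩ := exists_mem_foldTriangle hz hx
    obtain ⟨l, hl⟩ := exists_mem_foldTriangle hz hy
    rw [foldQuot_eq hz hk, foldQuot_eq hz hl] at h
    have h1 : foldCoord k (coordFst z x) (coordSnd z x)
        = foldCoord l (coordFst z y) (coordSnd z y) :=
      injOn_tetraSphere (foldPoint_mem hz hk) (foldPoint_mem hz hl) h
    obtain ⟨hx1, hx2, hx3⟩ := (mem_triangle_iff_coord hz).1 hx
    have ex := coord_spec hz x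
    have ey := coord_spec hz y
    generalize coordFst z x = s at h1 hx1 hx3 ex
    generalize coordSnd z x = t at h1 hx2 hx3 ex
    generalize coordFst z y = s' at h1 ey
    generalize coordSnd z y = t' at h1 ey
    rcases foldCoord_eq_cases k l with h2 | h2 | h2 | h2
    · obtain ⟨rfl, rfl⟩ := h2 _ _ _ _ h1
      rw [ex, ← ey]
      exact .refl y
    · obtain ⟨h3, rfl, rfl⟩ := h2 _ _ _ _ h1
      refine .rel _ _ (Or.inl ⟨⟨1 - s, s, by linarith, hx1, by ring, ?_⟩, ?_⟩)
      · rw [ex]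
        simp
      · rw [ex, ey, eq_sub_iff_add_eq'.2 h3]
        push_cast
        ring
    · obtain ⟨rfl, rfl, h5⟩ := h2 _ _ _ _ h1
      refine .rel _ _ (Or.inr (Or.inr ⟨⟨1 - t, t, by linarith, hx2, by ring, ?_⟩, ?_⟩))
      · rw [ex]
        simp
      · rw [ex, ey, eq_sub_iff_add_eq'.2 h5]
        push_cast
        ring
    · obtain ⟨h3, h4, h5⟩ := h2 _ _ _ _ h1
      refine .rel _ _ (Or.inr (Or.inl ⟨⟨s, t, hx1, hx2, h3, ?_⟩, ?_⟩))
      · rw [ex]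
        simp
      · rw [ex, ey, eq_sub_iff_add_eq'.2 h4, eq_sub_iff_add_eq'.2 h5]
        push_cast
        ring
  · intro h
    clear hx hy
    induction h with
    | rel x y h => exact foldQuot_eq_of_foldStep hz h
    | refl x => rfl
    | symm x y _ ih => exact ih.symm
    | trans x y w _ _ h1 h2 => exact h1.trans h2

theorem eventually_mem_foldTriangle (hz : z ∈ Hplus) (w : ℂ) :
    ∀ᶠ u in 𝓝[triangle ![0, z 0, z 1]] w, ∃ k, w ∈ triangle (foldVert z k) ∧
      u ∈ triangle (foldVert z k) := by
  have h : ∀ᶠ u in 𝓝 w, ∀ k, u ∈ triangle (foldVert z k) → w ∈ triangle (foldVert z k) := by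
    rw [Filter.eventually_all]
    intro k
    by_cases hw : w ∈ triangle (foldVert z k)
    · exact Filter.Eventually.of_forall fun _ _ => hw
    · filter_upwards [isCompact_triangle.isClosed.isOpen_compl.mem_nhds hw] with u hu hu'
      exact absurd hu' hu
  filter_upwards [nhdsWithin_le_nhds h, self_mem_nhdsWithin] with u h1 h2
  obtain ⟨k, hk⟩ := exists_mem_foldTriangle hz h2
  exact ⟨k, h1 k hk, hk⟩

/-- A segment in a piece is a segment in the triangle. Conversely a segment of the triangle may
cross several pieces, but locally its points share a piece with the given point, so it is a chain of
the same length. -/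
theorem isChainLength_foldedSphere_iff (hz : z ∈ Hplus) {p q : Sphere2} {L : ℝ} :
    IsChainLength (foldedSphere z hz).tri (foldedSphere z hz).param p q L ↔
      IsChainLength (fun _ : Unit => triangle ![0, z 0, z 1]) (fun _ => foldQuot z) p q L := by
  constructor
  · intro h
    induction h with
    | refl x => exact .refl x
    | cons k a b y L ha hb h ih =>
      rw [← foldQuot_eq hz ha]
      rw [← foldQuot_eq hz hb] at ih
      exact .cons () a b y L (foldTriangle_subset hz k ha) (foldTriangle_subset hz k hb) ih
  · intro h
    induction h with
    | refl x => exact .refl x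
    | cons _ a b y L ha hb h ih =>
      refine IsChainLength.trans (isChainLength_of_locally_segment fun w hw => ?_) ih
      have hseg : segment ℝ a b ⊆ triangle ![0, z 0, z 1] := convex_triangle.segment_subset ha hb
      filter_upwards [(eventually_mem_foldTriangle hz w).filter_mono (nhdsWithin_mono w hseg)]
        with u hu
      obtain ⟨k, h1, h2⟩ := hu
      exact ⟨k, w, h1, u, h2, (foldQuot_eq hz h1).symm, (foldQuot_eq hz h2).symm, rfl⟩

theorem continuousOn_foldQuot (hz : z ∈ Hplus) :
    ContinuousOn (foldQuot z) (triangle ![0, z 0, z 1]) := by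
  have h : ContinuousOn (foldQuot z) (⋃ k, triangle (foldVert z k)) :=
    (locallyFinite_of_finite _).continuousOn_iUnion (fun k => isCompact_triangle.isClosed)
      fun k => ((foldedSphere z hz).continuousOn k).congr fun x hx => foldQuot_eq hz hx
  exact h.mono fun x hx => Set.mem_iUnion.2 (exists_mem_foldTriangle hz hx)

theorem isGluing_foldedSphere (hz : z ∈ Hplus) : IsGluing z (foldedSphere z hz) := by
  refine ⟨foldQuot z, continuousOn_foldQuot hz, ?_, fun x hx y hy => foldQuot_eq_iff hz hx hy,
    fun x y => ?_, ?_⟩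
  · rw [Set.eq_univ_iff_forall]
    intro p
    obtain ⟨k, x, hx, rfl⟩ := (foldedSphere z hz).exists_param_eq p
    exact ⟨x, foldTriangle_subset hz k hx, foldQuot_eq hz hx⟩
  · rw [FlatSphere.dist, gluedDist, gluedDist]
    simp only [isChainLength_foldedSphere_iff]
  · intro _ k x w hx hw hxw
    change foldQuot z x = (foldedSphere z hz).param k w at hxw
    change w ∈ interior (triangle (foldVert z k)) at hw
    rw [← foldQuot_eq hz (interior_subset hw)] at hxw
    have h1 := foldTriangle_subset hz k (interior_subset hw)
    have h2 : x = w := eq_of_eqvGen_foldStep hz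
      ((foldQuot_eq_iff hz (interior_subset hx) h1).1 hxw) (Or.inl hx)
    subst h2
    -- The pieces are not moved in the plane, so both coordinates coincide and the rotation is
    -- trivial.
    refine ⟨1, ?_⟩
    filter_upwards [isOpen_interior.mem_nhds hw] with u hu
    change foldQuot z u = (foldedSphere z hz).param k (x + 1 * (u - x))
    rw [one_mul, add_sub_cancel, foldQuot_eq hz (interior_subset hu)]

end FoldedAngles

/-! ### The main theorem -/

/-- The standard generators `S` and `T` of `SL(2, ℤ)` are words in the two cuts, and generation
passes to the quotient by the centre. -/
theorem closure_cut_eq_top :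
    Subgroup.closure {(cutOne : PSL(2, ℤ)), (cutTwo : PSL(2, ℤ))} = (⊤ : Subgroup PSL(2, ℤ)) := by
  have h1 : Subgroup.closure {cutOne, cutTwo} = (⊤ : Subgroup SL(2, ℤ)) := by
    rw [eq_top_iff, ← SpecialLinearGroup.SL2Z_generators, Subgroup.closure_le]
    have m1 : cutOne ∈ Subgroup.closure {cutOne, cutTwo} := Subgroup.subset_closure (by simp)
    have m2 : cutTwo ∈ Subgroup.closure {cutOne, cutTwo} := Subgroup.subset_closure (by simp)
    rintro x (rfl | rfl)
    · have : ModularGroup.S = cutTwo * cutOne * cutTwo := by decide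
      rw [this]
      exact mul_mem (mul_mem m2 m1) m2
    · have : ModularGroup.T = cutTwo⁻¹ := by decide
      rw [this]
      exact inv_mem m2
  have h2 := congrArg (Subgroup.map (QuotientGroup.mk' (Subgroup.center SL(2, ℤ)))) h1
  rw [MonoidHom.map_closure, Set.image_pair,
    Subgroup.map_top_of_surjective _ (QuotientGroup.mk'_surjective _)] at h2
  exact h2

namespace FlatSphere

/-- A lattice basis which uniformizes a cone metric with four cone angles `π`. -/
def IsPiPiPiPi.basis {T : FlatSphere} (hT : T.IsPiPiPiPi) : Hplus :=
  ⟨hT.exists_isUniformized.choose, hT.exists_isUniformized.choose_spec.1⟩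

theorem IsPiPiPiPi.isUniformized_basis {T : FlatSphere} (hT : T.IsPiPiPiPi) :
    ∃ E, IsUniformized hT hT.basis.1 E :=
  hT.exists_isUniformized.choose_spec.2

end FlatSphere

/-- The shape of a cone metric. -/
def ConePi.shape : ConePi → MulAction.orbitRel.Quotient PSL(2, ℤ) PHplus :=
  Quot.lift (fun T => Quotient.mk _ (toPHplus T.2.basis)) fun T T' h => by
    obtain ⟨E, hE⟩ := T.2.isUniformized_basis
    obtain ⟨E', hE'⟩ := T'.2.isUniformized_basis
    obtain ⟨κ, hκ, h1⟩ := hE.exists_of_similar hE' h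
    exact orbit_eq_of_lattice hκ h1

/-- The same metric is uniformized by its chosen basis and, as a gluing, by `z`; the similarity of
the metric with itself makes the two lattices homothetic. -/
theorem ConePi.shape_mk_of_isGluing {z : Hplus} {T : {T : FlatSphere // T.IsPiPiPiPi}}
    (h : IsGluing z.1 T.1) : ConePi.shape (Quot.mk _ T) = Quotient.mk _ (toPHplus z) := by
  obtain ⟨E, hE⟩ := T.2.isUniformized_basis
  obtain ⟨E', hE'⟩ := T.2.isUniformized_of_isGluing z.2 h
  obtain ⟨κ, hκ, h1⟩ := hE.exists_of_similar hE' hE.similar_refl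
  exact orbit_eq_of_lattice hκ h1

theorem ConePi.shape_injective : Function.Injective ConePi.shape := by
  rintro ⟨T⟩ ⟨T'⟩ h
  obtain ⟨E, hE⟩ := T.2.isUniformized_basis
  obtain ⟨E', hE'⟩ := T'.2.isUniformized_basis
  obtain ⟨κ, hκ, h1⟩ := lattice_of_orbit_eq h
  exact Quot.sound (hE.similar hE' hκ h1)

theorem exists_isGluing (z : Hplus) : ∃ T : {T : FlatSphere // T.IsPiPiPiPi}, IsGluing z.1 T.1 :=
  ⟨⟨foldedSphere z.1 z.2, isPiPiPiPi_foldedSphere z.2⟩, isGluing_foldedSphere z.2⟩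

theorem ConePi.shape_surjective : Function.Surjective ConePi.shape := by
  intro p
  obtain ⟨⟨_, z, hz, rfl⟩, rfl⟩ := Quotient.exists_rep p
  obtain ⟨T, hT⟩ := exists_isGluing ⟨z, hz⟩
  exact ⟨Quot.mk _ T, ConePi.shape_mk_of_isGluing hT⟩

end

theorem mainTheorem2 :
    Subgroup.closure {(cutOne : PSL(2, ℤ)), (cutTwo : PSL(2, ℤ))} = (⊤ : Subgroup PSL(2, ℤ)) ∧
    (∀ z : Hplus, ∃ T : {T : FlatSphere // T.IsPiPiPiPi}, IsGluing z.1 T.1) ∧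
    ∃ Φ : MulAction.orbitRel.Quotient PSL(2, ℤ) PHplus → ConePi,
      (∀ (z : Hplus) (T : {T : FlatSphere // T.IsPiPiPiPi}), IsGluing z.1 T.1 →
        Φ (Quotient.mk _ (toPHplus z)) = Quot.mk _ T) ∧
      Function.Injective Φ ∧ Function.Surjective Φ := by
  refine ⟨closure_cut_eq_top, exists_isGluing, ?_⟩
  -- The map is taken to be the inverse of the shape, so its independence of the triangle and of the
  -- gluing needs no separate proof.
  set e := Equiv.ofBijective ConePi.shape ⟨ConePi.shape_injective, ConePi.shape_surjective⟩ with he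
  refine ⟨e.symm, fun z T h => ?_, e.symm.injective, e.symm.surjective⟩
  exact (Equiv.symm_apply_eq e).2 (ConePi.shape_mk_of_isGluing h).symm
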